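/- Let $(R,\mathfrak m,k)$ be a commutative Noetherian local ring, $L$ a finitely generated $R$-module, and $M\subseteq L$ a Burch submodule, i.e. $\mathfrak m(M:_L\mathfrak m)\neq \mathfrak m M$, where $(M:_L\mathfrak m)=\{x\in L:\mathfrak m x\subseteq M\}$. Set $S=R[X]_{\langle\mathfrak m,X\rangle}$, $L'=L[X]_{\langle\mathfrak m,X\rangle}$ and $M'=(M+XL[X])_{\langle\mathfrak m,X\rangle}\subseteq L'$. Then: (1) $R$ is regular (resp. a complete intersection, Gorenstein, Cohen–Macaulay) if and only if $S$ is so. (2) $M'$ is a Burch submodule of the $S$-module $L'$. (3) $M'/XM'\cong M\oplus L/M$ as $R$-modules. (4) If $L$ is free, then (i) $\operatorname{H-dim}_R(L/M)=\operatorname{H-dim}_S(M')$, where $\operatorname{H-dim}$ is any one of the projective dimension, the CI-dimension, the G-dimension and the CM-dimension; (ii) $\operatorname{cx}_R(M)=\operatorname{cx}_S(M')$ and $\operatorname{curv}_R(M)=\operatorname{curv}_S(M')$. (5) $\operatorname{cx}_R(k)=\operatorname{cx}_S(k)$ and $\operatorname{curv}_R(k)=\operatorname{curv}_S(k)$, where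 $k$ is also the residue field of $S$. Here, for a finitely generated module $N$ over a Noetherian local ring $(A,\mathfrak a,\kappa)$: - $\beta_n^A(N)=\dim_\kappa \operatorname{Ext}^n_A(N,\kappa)$; $\operatorname{cx}_A(N)$ is the least integer $b\ge 0$ such that for some real $\alpha>0$ one has $\beta_n^A(N)\le\alpha n^{b-1}$ for all $n\ge1$ (and $\infty$ if there is none); and $\operatorname{curv}_A(N)=\limsup_{n\to\infty}\sqrt[n]{\beta^A_n(N)}$. - $N$ is G-projective if $N\to N^{**}$ is an isomorphism and $\operatorname{Ext}_A^i(N,A)=0=\operatorname{Ext}_A^i(N^*,A)$ for all $i>0$, where $N^*=\operatorname{Hom}_A(N,A)$; $\operatorname{G-dim}_A(N)$ is the least $n\ge 0$ such that there is an exact sequence $0\to X_n\to\cdots\to X_0\to N\to0$ with all $X_i$ finitely generated and G-projective (and $\infty$ if there is none). - $\operatorname{CI-dim}_A(N)$ is the infimum of $\operatorname{pd}_Q(A'\otimes_AN)-\operatorname{pd}_Q(A')$ over all diagrams $A\to A'\leftarrow Q$ of local homomorphisms of Noetherian local rings with $A\to A'$ flat and $Q\to A'$ surjective with kernel generated by a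 $Q$-regular sequence. $\operatorname{CM-dim}_A(N)$ is the infimum of $\operatorname{G-dim}_Q(A'\otimes_AN)-\operatorname{G-dim}_Q(A')$ over all such diagrams in which, instead, the kernel $I$ of the surjection $Q\to A'$ is G-perfect, i.e. $\operatorname{G-dim}_Q(Q/I)=\operatorname{grade}(Q/I)$. Both dimensions of the zero module are $0$. -/

import Mathlib

universe u

open CategoryTheory Abelian IsLocalRing
open scoped TensorProduct Polynomial Pointwise ENNReal

namespace BurchExt

section RingProperties

variable (R : Type u) [CommRing R] [IsLocalRing R]

/-- The depth of a local ring: the supremum of the lengths of regular sequences.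
(Every `R`-regular sequence lies in the maximal ideal, as it generates a proper ideal.) -/
noncomputable def ringDepth : ℕ∞ :=
  ⨆ (rs : List R) (_ : RingTheory.Sequence.IsRegular R rs), (rs.length : ℕ∞)

/-- A (Noetherian) local ring is Cohen-Macaulay if its depth equals its Krull dimension. -/
def IsCohenMacaulay : Prop :=
  (ringDepth R : WithBot ℕ∞) = ringKrullDim R

/-- A (Noetherian) local ring is Gorenstein if it has finite injective dimension over itself. -/
def IsGorenstein : Prop :=
  injectiveDimension (ModuleCat.of R R) ≠ ⊤

/-- A (Noetherian) local ring is a complete intersection if its completion is the quotient of a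
regular local ring by an ideal generated by a regular sequence. -/
def IsCompleteIntersection : Prop :=
  ∃ (Q : Type u) (_ : CommRing Q) (_ : IsRegularLocalRing Q) (rs : List Q),
    RingTheory.Sequence.IsRegular Q rs ∧
      Nonempty ((Q ⧸ Ideal.ofList rs) ≃+* AdicCompletion (maximalIdeal R) R)

end RingProperties

section Betti

variable {R : Type u} [CommRing R] [IsLocalRing R]

/-- `Ext_R^n(M, k)` is annihilated by the maximal ideal. -/
lemma ext_residueField_isTorsionBySet (M : ModuleCat.{u} R) (n : ℕ) :
    Module.IsTorsionBySet R (Ext M (ModuleCat.of R (ResidueField R)) n)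
      (maximalIdeal R : Set R) := by
  rintro e ⟨a, ha⟩
  have h0 : a • 𝟙 (ModuleCat.of R (ResidueField R)) = 0 := by
    ext x
    have hx : a • x = 0 := by
      rw [Algebra.smul_def, ResidueField.algebraMap_eq, (residue_eq_zero_iff a).2 ha, zero_mul]
    simpa using hx
  change a • e = 0
  rw [Ext.smul_eq_comp_mk₀, h0, Ext.mk₀_zero, Ext.comp_zero]

/-- The structure of a vector space over the residue field `k = R ⧸ 𝔪` on `Ext_R^n(M, k)`. -/
noncomputable instance extResidueFieldModule (M : ModuleCat.{u} R) (n : ℕ) :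
    Module (ResidueField R) (Ext M (ModuleCat.of R (ResidueField R)) n) :=
  (ext_residueField_isTorsionBySet M n).module

/-- The `n`-th Betti number `rank_k Ext_R^n(M, k)`. -/
noncomputable def betti (M : ModuleCat.{u} R) (n : ℕ) : ℕ :=
  Module.finrank (ResidueField R) (Ext M (ModuleCat.of R (ResidueField R)) n)

/-- The (projective) complexity: the least integer `b ≥ 0` such that
`β_n(M) ≤ α n ^ (b - 1)` for some `α > 0` and all `n ≥ 1`; it is `∞` if there is none. -/
noncomputable def complexity (M : ModuleCat.{u} R) : ℕ∞ :=
  ⨅ (b : ℕ) (_ : ∃ α : ℝ, 0 < α ∧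
    ∀ n : ℕ, 1 ≤ n → (betti M n : ℝ) ≤ α * (n : ℝ) ^ ((b : ℤ) - 1)), (b : ℕ∞)

/-- The (projective) curvature: `limsup` of the `n`-th roots of the Betti numbers. -/
noncomputable def curvature (M : ModuleCat.{u} R) : ℝ≥0∞ :=
  Filter.limsup (fun n : ℕ => (betti M n : ℝ≥0∞) ^ (1 / (n : ℝ))) Filter.atTop

end Betti

section GDimension

variable {R : Type u} [CommRing R]

/-- Totally reflexive (`G`-projective) modules: finitely generated modules `X` such that the
natural map `X → X**` is an isomorphism and `Ext^i(X, R) = Ext^i(X*, R) = 0` for all `i > 0`. -/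
structure IsGProjective (X : ModuleCat.{u} R) : Prop where
  finite : Module.Finite R X
  reflexive : Function.Bijective (Module.Dual.eval R X)
  ext_self (i : ℕ) (hi : 0 < i) : Subsingleton (Ext X (ModuleCat.of R R) i)
  ext_dual (i : ℕ) (hi : 0 < i) :
    Subsingleton (Ext (ModuleCat.of R (Module.Dual R X)) (ModuleCat.of R R) i)

/-- `HasGResolution n M`: there is an exact sequence `0 → X_n → ⋯ → X_1 → X_0 → M → 0` with all
`X_i` being `G`-projective. It is spelled out recursively, splitting off `X_0 → M` and
continuing with its kernel. -/
def HasGResolution : ℕ → ModuleCat.{u} R → Prop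
  | 0, M => IsGProjective M
  | n + 1, M => ∃ (X : ModuleCat.{u} R) (f : X →ₗ[R] M),
      IsGProjective X ∧ Function.Surjective f ∧
        HasGResolution n (ModuleCat.of R (LinearMap.ker f))

/-- The Gorenstein dimension of a (finitely generated) module. -/
noncomputable def gDim (M : ModuleCat.{u} R) : ℕ∞ :=
  ⨅ (n : ℕ) (_ : HasGResolution n M), (n : ℕ∞)

/-- The grade of a (finitely generated) module: the least `i` with `Ext^i(M, R) ≠ 0`. -/
noncomputable def moduleGrade (M : ModuleCat.{u} R) : ℕ∞ :=
  ⨅ (i : ℕ) (_ : ¬ Subsingleton (Ext M (ModuleCat.of R R) i)), (i : ℕ∞)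

end GDimension

/-- A diagram `R → R' ← Q` of local homomorphisms of Noetherian local rings in which `R → R'` is
flat and `Q → R'` is surjective. -/
structure FlatSurjDiagram (R : Type u) [CommRing R] where
  R' : Type u
  Q : Type u
  [commRingR' : CommRing R']
  [commRingQ : CommRing Q]
  [localR' : IsLocalRing R']
  [localQ : IsLocalRing Q]
  [noetherianR' : IsNoetherianRing R']
  [noetherianQ : IsNoetherianRing Q]
  [algebraR : Algebra R R']
  [algebraQ : Algebra Q R']
  [localHomR : IsLocalHom (algebraMap R R')]
  [localHomQ : IsLocalHom (algebraMap Q R')]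
  [flat : Module.Flat R R']
  surjective : Function.Surjective (algebraMap Q R')

namespace FlatSurjDiagram

attribute [instance] commRingR' commRingQ localR' localQ noetherianR' noetherianQ algebraR algebraQ
  localHomR localHomQ flat

variable {R : Type u} [CommRing R] (D : FlatSurjDiagram R)

/-- The ring `R'` as a `Q`-module. -/
noncomputable def ringModule : ModuleCat.{u} D.Q := ModuleCat.of D.Q D.R'

/-- The base change `R' ⊗ M` of an `R`-module, regarded as a `Q`-module. -/
noncomputable def baseChange (M : ModuleCat.{u} R) : ModuleCat.{u} D.Q :=
  (ModuleCat.restrictScalars (algebraMap D.Q D.R')).obj (ModuleCat.of D.R' (D.R' ⊗[R] M))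

/-- The diagram is a quasi-deformation if the kernel of `Q → R'` is generated by a `Q`-regular
sequence. -/
def IsQuasiDeformation : Prop :=
  ∃ rs : List D.Q, RingTheory.Sequence.IsRegular D.Q rs ∧
    RingHom.ker (algebraMap D.Q D.R') = Ideal.ofList rs

/-- The diagram is a G-quasi-deformation if the kernel `I` of `Q → R'` is G-perfect: the
Gorenstein dimension of the `Q`-module `Q ⧸ I` equals its grade. -/
def IsGQuasiDeformation : Prop :=
  gDim (ModuleCat.of D.Q (D.Q ⧸ RingHom.ker (algebraMap D.Q D.R'))) =
    moduleGrade (ModuleCat.of D.Q (D.Q ⧸ RingHom.ker (algebraMap D.Q D.R')))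

end FlatSurjDiagram

/-- Extended natural numbers as extended reals. -/
noncomputable def enatToEReal (n : ℕ∞) : EReal := ((n : ℝ≥0∞) : EReal)

/-- The projective dimension as an extended real number (`-∞` for the zero module). -/
noncomputable def pdEReal {R : Type u} [CommRing R] (M : ModuleCat.{u} R) : EReal :=
  (projectiveDimension M).recBotCoe ⊥ enatToEReal

open Classical in
/-- The complete intersection dimension: the infimum of `pd_Q(R' ⊗ M) - pd_Q(R')` over all
quasi-deformations `R → R' ← Q`, and `0` for the zero module. -/
noncomputable def ciDim {R : Type u} [CommRing R] (M : ModuleCat.{u} R) : EReal :=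
  if Subsingleton M then 0 else
    ⨅ (D : FlatSurjDiagram R) (_ : D.IsQuasiDeformation),
      (pdEReal (D.baseChange M) - pdEReal D.ringModule)

open Classical in
/-- The Cohen-Macaulay dimension: the infimum of `Gdim_Q(R' ⊗ M) - Gdim_Q(R')` over all
G-quasi-deformations `R → R' ← Q`, and `0` for the zero module. -/
noncomputable def cmDim {R : Type u} [CommRing R] (M : ModuleCat.{u} R) : EReal :=
  if Subsingleton M then 0 else
    ⨅ (D : FlatSurjDiagram R) (_ : D.IsGQuasiDeformation),
      (enatToEReal (gDim (D.baseChange M)) - enatToEReal (gDim D.ringModule))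

section Burch

variable {R : Type u} [CommRing R] {L : Type u} [AddCommGroup L] [Module R L]

/-- The submodule `(M :_L I) = {x ∈ L | I x ⊆ M}`. -/
def colonSubmodule (M : Submodule R L) (I : Ideal R) : Submodule R L where
  carrier := {x | ∀ a ∈ I, a • x ∈ M}
  add_mem' hx hy a ha := by rw [smul_add]; exact M.add_mem (hx a ha) (hy a ha)
  zero_mem' a _ := by rw [smul_zero]; exact M.zero_mem
  smul_mem' c x hx a ha := by rw [smul_comm]; exact M.smul_mem c (hx a ha)

/-- `M` is a Burch submodule of `L` if `𝔪 (M :_L 𝔪) ≠ 𝔪 M`. -/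
def IsBurch [IsLocalRing R] (M : Submodule R L) : Prop :=
  maximalIdeal R • colonSubmodule M (maximalIdeal R) ≠ maximalIdeal R • M

end Burch

section Extension

variable (R : Type u) [CommRing R] [IsLocalRing R]

/-- The ideal `⟨𝔪, X⟩` of `R[X]`. -/
noncomputable def idealMX : Ideal R[X] :=
  (maximalIdeal R).map Polynomial.C ⊔ Ideal.span {Polynomial.X}

/-- `⟨𝔪, X⟩` consists of the polynomials with constant term in `𝔪`. -/
lemma idealMX_eq_comap :
    idealMX R = (maximalIdeal R).comap (Polynomial.constantCoeff (R := R)) := by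
  apply le_antisymm
  · refine sup_le (Ideal.map_le_iff_le_comap.2 fun a ha => ?_)
      ((Ideal.span_singleton_le_iff_mem _).2 ?_)
    · simpa [Ideal.mem_comap] using ha
    · simp [Ideal.mem_comap]
  · intro f hf
    rw [← Polynomial.X_mul_divX_add f]
    refine (idealMX R).add_mem ((idealMX R).mul_mem_right _ ?_) ?_
    · exact Ideal.mem_sup_right (Ideal.mem_span_singleton_self _)
    · exact Ideal.mem_sup_left (Ideal.mem_map_of_mem _ (by simpa using hf))

instance idealMX_isPrime : (idealMX R).IsPrime := by
  rw [idealMX_eq_comap]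
  exact Ideal.comap_isPrime _ _

/-- The local ring `S = R[X]_⟨𝔪, X⟩`. -/
abbrev ringS : Type u := Localization.AtPrime (idealMX R)

/-- The variable `X` as an element of `S`. -/
noncomputable def varS : ringS R := algebraMap R[X] (ringS R) Polynomial.X

variable {R} {L : Type u} [AddCommGroup L] [Module R L]

/-- The `R[X]`-submodule `M + X L[X]` of `L[X]`, i.e. the polynomials with coefficients in `L`
whose constant coefficient lies in `M`. -/
def addXMul (M : Submodule R L) : Submodule R[X] (PolynomialModule R L) where
  carrier := {f | f.coeff 0 ∈ M}
  add_mem' hf hg := M.add_mem hf hg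
  zero_mem' := M.zero_mem
  smul_mem' p f hf := by
    change (p • f).coeff 0 ∈ M
    simpa [PolynomialModule.smul_apply] using M.smul_mem (p.coeff 0) hf

variable (R L) in
/-- The `S`-module `L' = L[X]_⟨𝔪, X⟩`. -/
abbrev extModule : Type u := LocalizedModule (idealMX R).primeCompl (PolynomialModule R L)

/-- The `S`-submodule `M' = (M + X L[X])_⟨𝔪, X⟩` of `L'`. -/
noncomputable def extSubmodule (M : Submodule R L) : Submodule (ringS R) (extModule R L) :=
  (addXMul M).localized (idealMX R).primeCompl

end Extension

end BurchExt

set_option linter.unusedSectionVars false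


/-! Everything is deduced from the retraction `R → S → R`: `S` is flat over `R`, and evaluation at
`X = 0` is onto with kernel generated by the regular element `x = X` (`isRetraction`). Under
`extModuleEquiv` the module `L'` becomes `S ⊗ L`, and `M'` becomes the preimage `augComap` of `M`
under the augmentation `S ⊗ L → L`. Elements of this preimage look like `m + x l`. Reading off `l`
modulo `M` gives the exact sequence `S ⊗ M → M' → S ⊗ (L/M)` (`ses_augComap`), and reducing both
parts modulo `x` gives `M'/xM' ≅ M ⊕ L/M`, which is (3). The Burch property passes to `M'` because
the augmentation is onto and respects maximal ideals.

For (4), bounds on projective and G-dimension go up by flat base change and the sequence above, and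
go down by reduction modulo `x`, since `L/M` is a direct summand of `M'/xM'`. Betti numbers do not
change under reduction modulo `x`, so those of `M'` are `β_n(M) + β_n(L/M)`. For free `L` this
equals `β_n(M) + β_{n-1}(M)` when `n ≥ 2`, which has the same polynomial and exponential growth as
`β_n(M)`. Taking `M = 𝔪` in `L = R` makes `M'` the maximal ideal of `S`, the first syzygy of its
residue field; this yields (5).

For CI- and CM-dimension, a diagram over `S` restricts to `R`, and a diagram over `R` extends to `S`
by applying `A ↦ A[X]_⟨𝔪, X⟩` to all of its rings. Going down needs a G-dimension bound for `A` from
one for `A/qA` when `q` is regular on `A` but possibly a zero divisor on the ring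
(`hasGRes_of_quotSMulTop`); this is the hardest step. The subtracted dimension is controlled by
perfection: over a perfect quotient `P` of `Q`, no nonzero finite `P`-module has smaller dimension
over `Q` than `P`.

For (1), embedding dimension, Krull dimension and depth each grow by one, the Gorenstein property is
expressed by vanishing of Ext, and complete intersections are compared through `Ŝ ≅ R̂⟦X⟧`. -/

namespace BurchExt

/-! ### Short exact sequences and vanishing of Ext -/

section ExtTools

variable {R : Type u} [CommRing R]

/-- Vanishing of `Ext^i_R(M, N)` for unbundled modules. -/
abbrev ExtZero (R : Type u) [CommRing R] (M N : Type u) [AddCommGroup M] [Module R M]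
    [AddCommGroup N] [Module R N] (i : ℕ) : Prop :=
  Subsingleton (Ext (ModuleCat.of R M) (ModuleCat.of R N) i)

variable {A B C N : Type u} [AddCommGroup A] [Module R A] [AddCommGroup B] [Module R B]
  [AddCommGroup C] [Module R C] [AddCommGroup N] [Module R N]

/-- Short exact sequences of unbundled modules. -/
structure SES (f : A →ₗ[R] B) (g : B →ₗ[R] C) : Prop where
  inj : Function.Injective f
  exact : Function.Exact f g
  surj : Function.Surjective g

lemma SES.of_surjective {g : B →ₗ[R] C} (hg : Function.Surjective g) :
    SES (LinearMap.ker g).subtype g :=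
  ⟨Subtype.val_injective, g.exact_subtype_ker_map, hg⟩

/-- The kernel of the surjection in a short exact sequence is the submodule. -/
noncomputable def SES.kerEquiv {f : A →ₗ[R] B} {g : B →ₗ[R] C} (h : SES f g) :
    A ≃ₗ[R] LinearMap.ker g :=
  (LinearEquiv.ofInjective f h.inj).trans
    (LinearEquiv.ofEq _ _ (LinearMap.exact_iff.1 h.exact).symm)

@[simp]
lemma SES.kerEquiv_apply {f : A →ₗ[R] B} {g : B →ₗ[R] C} (h : SES f g) (a : A) :
    (h.kerEquiv a : B) = f a := rfl

lemma SES.shortExact {f : A →ₗ[R] B} {g : B →ₗ[R] C} (h : SES f g) :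
    (ModuleCat.shortComplexOfCompEqZero f g h.exact.linearMap_comp_eq_zero).ShortExact :=
  ModuleCat.shortComplex_shortExact _ h.exact h.inj h.surj

lemma extZero_congr_left (e : A ≃ₗ[R] B) (i : ℕ) : ExtZero R A N i ↔ ExtZero R B N i := by
  suffices ∀ {A B : Type u} [AddCommGroup A] [Module R A] [AddCommGroup B] [Module R B]
      (e : A ≃ₗ[R] B), ExtZero R A N i → ExtZero R B N i from ⟨this e, this e.symm⟩
  intro A B _ _ _ _ e h
  refine subsingleton_of_forall_eq 0 fun x => ?_
  have : x = (Ext.mk₀ e.toModuleIso.inv).comp ((Ext.mk₀ e.toModuleIso.hom).comp x (zero_add i))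
      (zero_add i) := by
    rw [← Ext.comp_assoc_of_second_deg_zero, Ext.mk₀_comp_mk₀, Iso.inv_hom_id, Ext.mk₀_id_comp]
  rw [this, Subsingleton.elim ((Ext.mk₀ e.toModuleIso.hom).comp x (zero_add i)) 0, Ext.comp_zero]

lemma extZero_of_projective [Module.Projective R A] (i : ℕ) : ExtZero R A N (i + 1) := by
  have : Projective (ModuleCat.of R A) := (IsProjective.iff_projective A).1 inferInstance
  exact Ext.subsingleton_of_projective _ _ i

lemma extZero_of_subsingleton_left [Subsingleton A] (i : ℕ) : ExtZero R A N i := by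
  refine subsingleton_of_forall_eq 0 fun x => ?_
  have : 𝟙 (ModuleCat.of R A) = 0 := by ext y; exact Subsingleton.elim (α := A) _ _
  rw [← Ext.mk₀_id_comp x, this, Ext.mk₀_zero, Ext.zero_comp]

lemma extZero_zero_iff : ExtZero R A N 0 ↔ Subsingleton (A →ₗ[R] N) :=
  (Ext.addEquiv₀.trans ModuleCat.homAddEquiv).subsingleton_congr

variable {f : A →ₗ[R] B} {g : B →ₗ[R] C}

lemma SES.ext_mid (h : SES f g) {i : ℕ} (hA : ExtZero R A N i) (hC : ExtZero R C N i) :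
    ExtZero R B N i := by
  refine subsingleton_of_forall_eq 0 fun x => ?_
  obtain ⟨y, rfl⟩ := Ext.contravariant_sequence_exact₂ h.shortExact _ x (hA.elim _ _)
  rw [hC.elim y 0, Ext.comp_zero]

lemma SES.ext_left (h : SES f g) {i : ℕ} (hB : ExtZero R B N i) (hC : ExtZero R C N (i + 1)) :
    ExtZero R A N i := by
  refine subsingleton_of_forall_eq 0 fun x => ?_
  obtain ⟨y, rfl⟩ := Ext.contravariant_sequence_exact₁ h.shortExact _ x (add_comm 1 i)
    (hC.elim _ _)
  rw [hB.elim y 0, Ext.comp_zero]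

lemma SES.ext_right (h : SES f g) {i : ℕ} (hA : ExtZero R A N i) (hB : ExtZero R B N (i + 1)) :
    ExtZero R C N (i + 1) := by
  refine subsingleton_of_forall_eq 0 fun x => ?_
  obtain ⟨y, rfl⟩ := Ext.contravariant_sequence_exact₃ h.shortExact _ x (hB.elim _ _)
    (add_comm 1 i)
  rw [hA.elim y 0, Ext.comp_zero]

lemma SES.ext_right' (h : SES f g) {i : ℕ} (hB : ExtZero R N B i) (hA : ExtZero R N A (i + 1)) :
    ExtZero R N C i := by
  refine subsingleton_of_forall_eq 0 fun x => ?_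
  obtain ⟨y, rfl⟩ := Ext.covariant_sequence_exact₃ _ h.shortExact x rfl (hA.elim _ _)
  rw [hB.elim y 0, Ext.zero_comp]

lemma SES.extend (h : SES f g) (hC : ExtZero R C N 1) (φ : A →ₗ[R] N) :
    ∃ ψ : B →ₗ[R] N, ψ ∘ₗ f = φ := by
  obtain ⟨y, hy⟩ := Ext.contravariant_sequence_exact₁ h.shortExact _
    (Ext.mk₀ (ModuleCat.ofHom φ)) (add_comm 1 0) (hC.elim _ _)
  obtain ⟨ψ, rfl⟩ := (Ext.mk₀_bijective _ _).2 y
  refine ⟨ψ.hom, ?_⟩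
  rw [Ext.mk₀_comp_mk₀, (Ext.mk₀_bijective _ _).1.eq_iff] at hy
  exact congrArg ModuleCat.Hom.hom hy

/-- The connecting map `Hom(A, N) → Ext¹(C, N)` is onto because `Ext¹(B, N) = 0`, and it kills every
map that extends to `B`. -/
lemma SES.ext_one (h : SES f g) (hB : ExtZero R B N 1)
    (hN : ∀ φ : A →ₗ[R] N, ∃ ψ : B →ₗ[R] N, ψ ∘ₗ f = φ) : ExtZero R C N 1 := by
  refine subsingleton_of_forall_eq 0 fun x => ?_
  obtain ⟨y, rfl⟩ := Ext.contravariant_sequence_exact₃ h.shortExact _ x (hB.elim _ _)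
    (add_comm 1 0)
  obtain ⟨φ, rfl⟩ := (Ext.mk₀_bijective _ _).2 y
  obtain ⟨ψ, hψ⟩ := hN φ.hom
  have : φ = ModuleCat.ofHom f ≫ ModuleCat.ofHom ψ := by
    ext x; exact (LinearMap.congr_fun hψ x).symm
  rw [this, ← Ext.mk₀_comp_mk₀, ← Ext.comp_assoc_of_second_deg_zero]
  exact (congrArg (fun z => Ext.comp z _ _) h.shortExact.extClass_comp).trans (Ext.zero_comp _ _ _ _ _)

lemma SES.ext_iff (h : SES f g) [Module.Projective R B] (i : ℕ) :
    ExtZero R C N (i + 2) ↔ ExtZero R A N (i + 1) :=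
  ⟨fun hC => h.ext_left (extZero_of_projective i) hC,
    fun hA => h.ext_right hA (extZero_of_projective _)⟩

lemma extZero_prod_left {i : ℕ} (h : ExtZero R (A × B) N i) : ExtZero R A N i := by
  refine subsingleton_of_forall_eq 0 fun x => ?_
  have : x = (Ext.mk₀ (ModuleCat.ofHom (LinearMap.inl R A B))).comp
      ((Ext.mk₀ (ModuleCat.ofHom (LinearMap.fst R A B))).comp x (zero_add i)) (zero_add i) := by
    rw [← Ext.comp_assoc_of_second_deg_zero, Ext.mk₀_comp_mk₀, ← ModuleCat.ofHom_comp,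
      LinearMap.fst_comp_inl, ModuleCat.ofHom_id, Ext.mk₀_id_comp]
  rw [this, h.elim (Ext.comp _ _ _) 0, Ext.comp_zero]

lemma SES.prod : SES (LinearMap.inl R A B) (LinearMap.snd R A B) :=
  ⟨LinearMap.inl_injective, .inl_snd, LinearMap.snd_surjective⟩

end ExtTools

end BurchExt


namespace BurchExt

/-! ### The five lemma for short exact sequences -/

section FiveLemma

variable {R : Type u} [CommRing R] {A B C A' B' C' : Type u}
  [AddCommGroup A] [Module R A] [AddCommGroup B] [Module R B] [AddCommGroup C] [Module R C]
  [AddCommGroup A'] [Module R A'] [AddCommGroup B'] [Module R B'] [AddCommGroup C'] [Module R C']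
  {f : A →ₗ[R] B} {g : B →ₗ[R] C} {f' : A' →ₗ[R] B'} {g' : B' →ₗ[R] C'}
  {α : A →ₗ[R] A'} {β : B →ₗ[R] B'} {γ : C →ₗ[R] C'}

lemma SES.bijective_mid (h : SES f g) (h' : SES f' g') (h₁ : β ∘ₗ f = f' ∘ₗ α)
    (h₂ : γ ∘ₗ g = g' ∘ₗ β) (hα : Function.Bijective α) (hγ : Function.Bijective γ) :
    Function.Bijective β := by
  replace h₁ (x) : β (f x) = f' (α x) := LinearMap.congr_fun h₁ x
  replace h₂ (x) : γ (g x) = g' (β x) := LinearMap.congr_fun h₂ x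
  constructor
  · rw [injective_iff_map_eq_zero]
    intro b hb
    obtain ⟨a, rfl⟩ := (h.exact b).1 (hγ.1 (by rw [h₂, hb, map_zero, map_zero]))
    have : a = 0 := hα.1 (h'.inj (by rw [← h₁, hb, map_zero, map_zero]))
    rw [this, map_zero]
  · intro b
    obtain ⟨c, hc⟩ := hγ.2 (g' b)
    obtain ⟨b₀, rfl⟩ := h.surj c
    obtain ⟨a', ha'⟩ := (h'.exact (b - β b₀)).1 (by rw [map_sub, ← h₂, hc, sub_self])
    obtain ⟨a, rfl⟩ := hα.2 a'
    exact ⟨f a + b₀, by rw [map_add, h₁, ha', sub_add_cancel]⟩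

lemma SES.bijective_left (h : SES f g) (h' : SES f' g') (h₁ : β ∘ₗ f = f' ∘ₗ α)
    (h₂ : γ ∘ₗ g = g' ∘ₗ β) (hβ : Function.Bijective β) (hγ : Function.Bijective γ) :
    Function.Bijective α := by
  replace h₁ (x) : β (f x) = f' (α x) := LinearMap.congr_fun h₁ x
  replace h₂ (x) : γ (g x) = g' (β x) := LinearMap.congr_fun h₂ x
  constructor
  · intro a b hab
    exact h.inj (hβ.1 (by rw [h₁, h₁, hab]))
  · intro a'
    obtain ⟨b, hb⟩ := hβ.2 (f' a')
    obtain ⟨a, rfl⟩ := (h.exact b).1 (hγ.1 (by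
      rw [h₂, hb, map_zero, h'.exact.apply_apply_eq_zero]))
    exact ⟨a, h'.inj (by rw [← h₁, hb])⟩

lemma SES.bijective_right (h : SES f g) (h' : SES f' g') (h₁ : β ∘ₗ f = f' ∘ₗ α)
    (h₂ : γ ∘ₗ g = g' ∘ₗ β) (hα : Function.Bijective α) (hβ : Function.Bijective β) :
    Function.Bijective γ := by
  replace h₁ (x) : β (f x) = f' (α x) := LinearMap.congr_fun h₁ x
  replace h₂ (x) : γ (g x) = g' (β x) := LinearMap.congr_fun h₂ x
  constructor
  · rw [injective_iff_map_eq_zero]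
    intro c hc
    obtain ⟨b, rfl⟩ := h.surj c
    obtain ⟨a', ha'⟩ := (h'.exact (β b)).1 (by rw [← h₂, hc])
    obtain ⟨a, rfl⟩ := hα.2 a'
    rw [← hβ.1 ((h₁ a).trans ha'), h.exact.apply_apply_eq_zero]
  · intro c'
    obtain ⟨b', rfl⟩ := h'.surj c'
    obtain ⟨b, rfl⟩ := hβ.2 b'
    exact ⟨g b, h₂ b⟩

end FiveLemma

/-! ### Totally reflexive modules in short exact sequences -/

section GProjective

variable {R : Type u} [CommRing R] {A B C : Type u}
  [AddCommGroup A] [Module R A] [AddCommGroup B] [Module R B] [AddCommGroup C] [Module R C]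

/-- `IsGProjective` for unbundled modules. -/
abbrev GProj (R : Type u) [CommRing R] (A : Type u) [AddCommGroup A] [Module R A] : Prop :=
  IsGProjective (ModuleCat.of R A)

lemma GProj.isReflexive (h : GProj R A) : Module.IsReflexive R A := ⟨h.reflexive⟩

lemma GProj.extZero (h : GProj R A) (i : ℕ) : ExtZero R A R (i + 1) := h.ext_self _ i.succ_pos

lemma GProj.extZero_dual (h : GProj R A) (i : ℕ) : ExtZero R (Module.Dual R A) R (i + 1) :=
  h.ext_dual _ i.succ_pos

lemma GProj.mk' [hf : Module.Finite R A] [hr : Module.IsReflexive R A]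
    (h : ∀ i, ExtZero R A R (i + 1))
    (h' : ∀ i, ExtZero R (Module.Dual R A) R (i + 1)) : GProj R A where
  finite := hf
  reflexive := hr.1
  ext_self i hi := by
    obtain ⟨i, rfl⟩ := Nat.exists_eq_succ_of_ne_zero hi.ne'
    exact h i
  ext_dual i hi := by
    obtain ⟨i, rfl⟩ := Nat.exists_eq_succ_of_ne_zero hi.ne'
    exact h' i

lemma GProj.of_projective [Module.Finite R A] [Module.Projective R A] : GProj R A :=
  .mk' (fun _ => extZero_of_projective _) (fun _ => extZero_of_projective _)

lemma GProj.congr (e : A ≃ₗ[R] B) (h : GProj R A) : GProj R B := by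
  have := h.finite
  have : Module.Finite R B := Module.Finite.equiv e
  have := h.isReflexive
  have := Module.equiv e
  exact .mk' (fun i => (extZero_congr_left e _).1 (h.extZero i))
    (fun i => (extZero_congr_left e.symm.dualMap _).1 (h.extZero_dual i))

lemma GProj.dual [IsNoetherianRing R] (h : GProj R A) : GProj R (Module.Dual R A) := by
  have : Module.Finite R A := h.finite
  have := h.isReflexive
  exact .mk' h.extZero_dual
    (fun i => (extZero_congr_left (Module.evalEquiv R A) _).1 (h.extZero i))

variable {f : A →ₗ[R] B} {g : B →ₗ[R] C}

/-- The only obstruction to exactness of the dual is extending functionals from `A` to `B`, and it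
lies in `Ext¹(C, R)`. -/
lemma SES.dual (h : SES f g) (hC : ExtZero R C R 1) : SES g.dualMap f.dualMap := by
  refine ⟨LinearMap.dualMap_injective_of_surjective h.surj, fun φ => ⟨fun hφ => ?_, ?_⟩,
    fun φ => h.extend hC φ⟩
  · have hle : LinearMap.ker g ≤ LinearMap.ker φ := by
      rw [LinearMap.exact_iff.1 h.exact]
      rintro _ ⟨a, rfl⟩
      exact LinearMap.congr_fun hφ a
    refine ⟨(Submodule.liftQ _ φ hle) ∘ₗ (g.quotKerEquivOfSurjective h.surj).symm.toLinearMap, ?_⟩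
    ext b
    have : (g.quotKerEquivOfSurjective h.surj).symm (g b) = Submodule.Quotient.mk b := by
      rw [LinearEquiv.symm_apply_eq]; rfl
    simp [this]
  · rintro ⟨ψ, rfl⟩
    ext a
    simp [h.exact.apply_apply_eq_zero]

lemma SES.finite_left [IsNoetherianRing R] [Module.Finite R B] (h : SES f g) :
    Module.Finite R A := Module.Finite.of_injective f h.inj

lemma SES.finite_right [Module.Finite R B] (h : SES f g) :
    Module.Finite R C := Module.Finite.of_surjective g h.surj

lemma SES.finite_mid [Module.Finite R A] [Module.Finite R C] (h : SES f g) :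
    Module.Finite R B :=
  have : Module.Finite R (LinearMap.ker g) := Module.Finite.equiv h.kerEquiv
  have : Module.Finite R (B ⧸ LinearMap.ker g) :=
    Module.Finite.equiv (g.quotKerEquivOfSurjective h.surj).symm
  Module.Finite.of_submodule_quotient (LinearMap.ker g)

lemma dual_eval_comp (f : A →ₗ[R] B) :
    Module.Dual.eval R B ∘ₗ f = f.dualMap.dualMap ∘ₗ Module.Dual.eval R A := rfl

lemma SES.gProj_mid (h : SES f g) (hA : GProj R A) (hC : GProj R C) : GProj R B := by
  have : Module.Finite R A := hA.finite
  have : Module.Finite R C := hC.finite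
  have := h.finite_mid
  have hd := h.dual (hC.extZero 0)
  have : Module.IsReflexive R B := ⟨h.bijective_mid (hd.dual (hA.extZero_dual 0))
    (dual_eval_comp f) (dual_eval_comp g) hA.reflexive hC.reflexive⟩
  exact .mk' (fun i => h.ext_mid (hA.extZero i) (hC.extZero i))
    (fun i => hd.ext_mid (hC.extZero_dual i) (hA.extZero_dual i))

lemma SES.gProj_left [IsNoetherianRing R] (h : SES f g) (hB : GProj R B) (hC : GProj R C) :
    GProj R A := by
  have : Module.Finite R B := hB.finite
  have := h.finite_left
  have hd := h.dual (hC.extZero 0)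
  have hA (i) : ExtZero R (Module.Dual R A) R (i + 1) := by
    cases i with
    | zero =>
      -- By reflexivity a functional on `C*` is evaluation at some `c`; evaluation at a lift of `c`
      -- to `B` extends it to `B*`.
      refine hd.ext_one (hB.extZero_dual 0) fun φ => ?_
      obtain ⟨c, rfl⟩ := hC.reflexive.2 φ
      obtain ⟨b, rfl⟩ := h.surj c
      exact ⟨Module.Dual.eval R B b, rfl⟩
    | succ i => exact hd.ext_right (hC.extZero_dual i) (hB.extZero_dual _)
  have : Module.IsReflexive R A := ⟨h.bijective_left (hd.dual (hA 0))
    (dual_eval_comp f) (dual_eval_comp g) hB.reflexive hC.reflexive⟩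
  exact .mk' (fun i => h.ext_left (hB.extZero i) (hC.extZero _)) hA

/-- A cokernel may have G-dimension one, hence the condition on `Ext¹(C, R)`. It makes the dual
sequence exact, so `C*` is the kernel of a surjection of totally reflexive modules and is itself
one; dualising again and applying the five lemma gives reflexivity of `C`. -/
lemma SES.gProj_right [IsNoetherianRing R] (h : SES f g) (hA : GProj R A) (hB : GProj R B)
    (hC : ExtZero R C R 1) : GProj R C := by
  have : Module.Finite R B := hB.finite
  have := h.finite_right
  have hd := h.dual hC
  have hC' := hd.gProj_left hB.dual hA.dual
  have : Module.IsReflexive R C := ⟨h.bijective_right (hd.dual (hA.extZero_dual 0))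
    (dual_eval_comp f) (dual_eval_comp g) hA.reflexive hB.reflexive⟩
  refine .mk' (fun i => ?_) hC'.extZero
  cases i with
  | zero => exact hC
  | succ i => exact h.ext_right (hA.extZero i) (hB.extZero _)

lemma GProj.of_prod (h : GProj R (A × B)) : GProj R A := by
  have : Module.Finite R (A × B) := h.finite
  have : Module.Finite R A := 
    Module.Finite.of_surjective (LinearMap.fst R A B) LinearMap.fst_surjective
  have := h.isReflexive
  have : Module.IsReflexive R A := .of_split (LinearMap.inl R A B) (LinearMap.fst R A B)
    (LinearMap.fst_comp_inl R A B)
  refine .mk' (fun i => extZero_prod_left (h.extZero i)) (fun i => ?_)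
  exact extZero_prod_left ((extZero_congr_left (Module.dualProdDualEquivDual R A B) _).2
    (h.extZero_dual i))

end GProjective

/-! ### G-resolutions, G-dimension and grade -/

section GResolution

variable {R : Type u} [CommRing R] [IsNoetherianRing R] {A B C : Type u}
  [AddCommGroup A] [Module R A] [AddCommGroup B] [Module R B] [AddCommGroup C] [Module R C]
  {f : A →ₗ[R] B} {g : B →ₗ[R] C}

/-- `HasGResolution` for unbundled modules. -/
abbrev HasGRes (R : Type u) [CommRing R] (n : ℕ) (A : Type u) [AddCommGroup A] [Module R A] :
    Prop :=
  HasGResolution n (ModuleCat.of R A)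

lemma HasGRes.congr {n : ℕ} (e : A ≃ₗ[R] B) (h : HasGRes R n A) : HasGRes R n B := by
  cases n with
  | zero => exact GProj.congr e h
  | succ n =>
    obtain ⟨X, f, hX, hf, hK⟩ := h
    refine ⟨X, e.toLinearMap ∘ₗ f, hX, e.surjective.comp hf, ?_⟩
    have : LinearMap.ker (e.toLinearMap ∘ₗ f) = LinearMap.ker f := by simp
    change HasGResolution n (ModuleCat.of R (LinearMap.ker (e.toLinearMap ∘ₗ f)))
    rwa [this]

lemma SES.hasGRes_succ {n : ℕ} (h : SES f g) (hB : GProj R B) (hA : HasGRes R n A) :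
    HasGRes R (n + 1) C :=
  ⟨ModuleCat.of R B, g, hB, h.surj, hA.congr h.kerEquiv⟩

lemma HasGRes.exists_ses {n : ℕ} (h : HasGRes R (n + 1) C) :
    ∃ (A B : Type u) (_ : AddCommGroup A) (_ : Module R A) (_ : AddCommGroup B) (_ : Module R B)
      (f : A →ₗ[R] B) (g : B →ₗ[R] C), SES f g ∧ GProj R B ∧ HasGRes R n A := by
  obtain ⟨X, f, hX, hf, hK⟩ := h
  exact ⟨_, X, _, _, _, _, _, f, .of_surjective hf, hX, hK⟩

lemma HasGRes.finite {n : ℕ} (h : HasGRes R n A) : Module.Finite R A := by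
  cases n with
  | zero => exact IsGProjective.finite h
  | succ n =>
    obtain ⟨X, f, hX, hf, hK⟩ := h
    have := hX.finite
    exact Module.Finite.of_surjective f hf

lemma SES.zero_id : SES (0 : PUnit.{u + 1} →ₗ[R] A) (LinearMap.id : A →ₗ[R] A) :=
  ⟨Function.injective_of_subsingleton _, fun a => by simp [eq_comm], Function.surjective_id⟩

lemma HasGRes.succ {n : ℕ} (h : HasGRes R n A) : HasGRes R (n + 1) A := by
  induction n generalizing A with
  | zero => exact SES.zero_id.hasGRes_succ (A := PUnit.{u + 1}) h GProj.of_projective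
  | succ n ih =>
    obtain ⟨_, _, _, _, _, _, _, _, hs, hB, hA⟩ := h.exists_ses
    exact hs.hasGRes_succ hB (ih hA)

lemma HasGRes.mono {n m : ℕ} (hnm : n ≤ m) (h : HasGRes R n A) : HasGRes R m A := by
  induction hnm with
  | refl => exact h
  | step _ ih => exact ih.succ

variable {D E : Type u} [AddCommGroup D] [Module R D] [AddCommGroup E] [Module R E]

/-- The kernel of `E → B → C` is the preimage of `A`, an extension of `A` by `D`. This rotates a
short exact sequence through a cover of its middle term. -/
lemma SES.ker_comp (h : SES f g) {i : D →ₗ[R] E} {p : E →ₗ[R] B} (h' : SES i p) :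
    ∃ (i' : D →ₗ[R] LinearMap.ker (g ∘ₗ p)) (p' : LinearMap.ker (g ∘ₗ p) →ₗ[R] A),
      SES i' p' := by
  have hp (x : LinearMap.ker (g ∘ₗ p)) : p x ∈ LinearMap.ker g := x.2
  refine ⟨i.codRestrict _ fun d => by simp [h'.exact.apply_apply_eq_zero],
    h.kerEquiv.symm.toLinearMap ∘ₗ (p ∘ₗ Submodule.subtype _).codRestrict _ hp, ?_, ?_, ?_⟩
  · intro x y hxy
    exact h'.inj (congrArg Subtype.val hxy)
  · intro x
    have : p x = 0 ↔ ∃ y, i y = x := h'.exact x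
    simp only [LinearMap.coe_comp, LinearEquiv.coe_coe, Function.comp_apply,
      LinearEquiv.map_eq_zero_iff, Set.mem_range, Subtype.ext_iff, LinearMap.codRestrict_apply]
    exact this
  · intro a
    obtain ⟨y, hy⟩ := h'.surj (f a)
    refine ⟨⟨y, by simp [hy, h.exact.apply_apply_eq_zero]⟩, ?_⟩
    simp only [LinearMap.coe_comp, LinearEquiv.coe_coe, Function.comp_apply,
      LinearEquiv.symm_apply_eq]
    exact Subtype.ext hy

lemma HasGRes.prod {n : ℕ} (hA : HasGRes R n A) (hB : GProj R B) : HasGRes R n (A × B) := by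
  cases n with
  | zero => exact SES.prod.gProj_mid hA hB
  | succ n =>
    obtain ⟨K, X, _, _, _, _, i, p, hs, hX, hK⟩ := hA.exists_ses
    refine SES.hasGRes_succ (f := (LinearMap.inl R X B) ∘ₗ i) (g := p.prodMap LinearMap.id)
      ⟨LinearMap.inl_injective.comp hs.inj, fun x => ?_,
        hs.surj.prodMap Function.surjective_id⟩ (SES.prod.gProj_mid hX hB) hK
    have := hs.exact x.1
    aesop

/-- If `X → B` starts a resolution, the kernel of `X → C` is totally reflexive and covers `A` with
the same kernel as `X → B`. -/
lemma SES.hasGRes_left_of_gProj {n : ℕ} (h : SES f g) (hB : HasGRes R n B) (hC : GProj R C) :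
    HasGRes R n A := by
  cases n with
  | zero => exact h.gProj_left hB hC
  | succ n =>
    obtain ⟨K, X, _, _, _, _, i, p, hs, hX, hK⟩ := hB.exists_ses
    obtain ⟨i', p', h'⟩ := h.ker_comp hs
    exact h'.hasGRes_succ
      ((SES.of_surjective (g := g ∘ₗ p) (h.surj.comp hs.surj)).gProj_left hX hC) hK

/-- A Schanuel argument: lifting `g` through the first step `X → C` of a resolution with kernel `K`
gives an exact sequence `A → K × B → X`. Hence any finite projective cover, not only the given one,
lowers the length by one. -/
lemma SES.hasGRes_syzygy {n : ℕ} (h : SES f g) [Module.Finite R B] [Module.Projective R B]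
    (hC : HasGRes R (n + 1) C) : HasGRes R n A := by
  obtain ⟨K, X, _, _, _, _, i, p, hs, hX, hK⟩ := hC.exists_ses
  obtain ⟨l, hl⟩ := Module.projective_lifting_property p g hs.surj
  replace hl (b) : p (l b) = g b := LinearMap.congr_fun hl b
  have hlf (a) : l (f a) ∈ LinearMap.ker p := by simp [hl, h.exact.apply_apply_eq_zero]
  let j : A →ₗ[R] K := hs.kerEquiv.symm.toLinearMap ∘ₗ (l ∘ₗ f).codRestrict _ hlf
  have hj (a) : i (j a) = l (f a) := by
    rw [← hs.kerEquiv_apply]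
    simp [j]
  refine SES.hasGRes_left_of_gProj (f := (-j).prod f) (g := i.coprod l) ⟨?_, ?_, ?_⟩
    (hK.prod .of_projective) hX
  · intro a b hab
    exact h.inj (congrArg Prod.snd hab)
  · rintro ⟨k, b⟩
    constructor
    · intro hkb
      replace hkb : i k + l b = 0 := hkb
      have hb : g b = 0 := by
        have := congrArg p hkb
        simpa [hs.exact.apply_apply_eq_zero, hl] using this
      obtain ⟨a, rfl⟩ := (h.exact b).1 hb
      refine ⟨a, Prod.ext (hs.inj ?_) rfl⟩
      change i (-j a) = i k
      rw [map_neg, hj, eq_neg_of_add_eq_zero_left hkb]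
    · rintro ⟨a, ha⟩
      rw [← ha]
      simp [hj]
  · intro x
    obtain ⟨b, hb⟩ := h.surj (p x)
    obtain ⟨k, hk⟩ := (hs.exact (x - l b)).1 (by simp [hl, hb])
    exact ⟨(k, b), by simp [hk]⟩

lemma exists_free_ses [Module.Finite R C] :
    ∃ (P : Type u) (_ : AddCommGroup P) (_ : Module R P) (_ : Module.Free R P)
      (_ : Module.Finite R P) (g : P →ₗ[R] C), SES (LinearMap.ker g).subtype g := by
  obtain ⟨P, i1, i2, i3, i4, g, hg⟩ := Module.exists_finite_presentation R C
  exact ⟨P, i1, i2, i3, i4, g, .of_surjective hg⟩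

/-- The three closure properties of modules with bounded G-resolutions in short exact sequences
are proved by rotating the sequence through syzygies. -/
lemma hasGRes_ses_aux (n : ℕ) :
    (∀ {A B C : Type u} [AddCommGroup A] [Module R A] [AddCommGroup B] [Module R B]
      [AddCommGroup C] [Module R C] {f : A →ₗ[R] B} {g : B →ₗ[R] C}, SES f g →
      HasGRes R n A → HasGRes R n C → HasGRes R n B) ∧
    (∀ {A B C : Type u} [AddCommGroup A] [Module R A] [AddCommGroup B] [Module R B]
      [AddCommGroup C] [Module R C] {f : A →ₗ[R] B} {g : B →ₗ[R] C}, SES f g →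
      HasGRes R n B → HasGRes R (n + 1) C → HasGRes R n A) := by
  induction n with
  | zero =>
    refine ⟨fun h => h.gProj_mid, fun {A B C} _ _ _ _ _ _ f g h hB hC => ?_⟩
    have : Module.Finite R B := hB.finite
    obtain ⟨P, _, _, _, _, p, hp⟩ := exists_free_ses (R := R) (C := B)
    obtain ⟨i', p', h'⟩ := h.ker_comp hp
    have hK : GProj R (LinearMap.ker p) := hp.gProj_left .of_projective hB
    have hK' : GProj R (LinearMap.ker (g ∘ₗ p)) :=
      (SES.of_surjective (g := g ∘ₗ p) (h.surj.comp hp.surj)).hasGRes_syzygy hC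
    -- The required `Ext¹(A, R) = 0` follows from `Ext¹(B, R) = 0` and `Ext²(C, R) ≅ Ext¹(ker (g ∘
    -- p), R) = 0`.
    refine h'.gProj_right hK hK' (h.ext_left (GProj.extZero hB 0) ?_)
    exact ((SES.of_surjective (g := g ∘ₗ p) (h.surj.comp hp.surj)).ext_iff 0).2 (hK'.extZero 0)
  | succ n ih =>
    obtain ⟨ih₁, ih₂⟩ := ih
    -- The syzygy of a cokernel is an extension of `A` by a syzygy of `B`, so the induction
    -- hypothesis on extensions applies. Kernels are then treated as cokernels of the rotated
    -- sequence.
    have cok : ∀ {A B C : Type u} [AddCommGroup A] [Module R A] [AddCommGroup B] [Module R B]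
        [AddCommGroup C] [Module R C] {f : A →ₗ[R] B} {g : B →ₗ[R] C}, SES f g →
        HasGRes R n A → HasGRes R (n + 1) B → HasGRes R (n + 1) C := by
      intro A B C _ _ _ _ _ _ f g h hA hB
      have : Module.Finite R B := hB.finite
      obtain ⟨P, _, _, _, _, p, hp⟩ := exists_free_ses (R := R) (C := B)
      obtain ⟨i', p', h'⟩ := h.ker_comp hp
      exact (SES.of_surjective (g := g ∘ₗ p) (h.surj.comp hp.surj)).hasGRes_succ .of_projective
        (ih₁ h' (hp.hasGRes_syzygy hB) hA)
    constructor
    · intro A B C _ _ _ _ _ _ f g h hA hC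
      have : Module.Finite R A := hA.finite
      have : Module.Finite R C := hC.finite
      have : Module.Finite R B := h.finite_mid
      obtain ⟨P, _, _, _, _, p, hp⟩ := exists_free_ses (R := R) (C := B)
      obtain ⟨i', p', h'⟩ := h.ker_comp hp
      exact hp.hasGRes_succ .of_projective (ih₂ h'
        ((SES.of_surjective (g := g ∘ₗ p) (h.surj.comp hp.surj)).hasGRes_syzygy hC) hA)
    · intro A B C _ _ _ _ _ _ f g h hB hC
      have : Module.Finite R B := hB.finite
      obtain ⟨P, _, _, _, _, p, hp⟩ := exists_free_ses (R := R) (C := B)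
      obtain ⟨i', p', h'⟩ := h.ker_comp hp
      exact cok h' (hp.hasGRes_syzygy hB)
        ((SES.of_surjective (g := g ∘ₗ p) (h.surj.comp hp.surj)).hasGRes_syzygy hC)

lemma SES.hasGRes_mid {n : ℕ} (h : SES f g) (hA : HasGRes R n A) (hC : HasGRes R n C) :
    HasGRes R n B :=
  (hasGRes_ses_aux n).1 h hA hC

lemma SES.hasGRes_left {n : ℕ} (h : SES f g) (hB : HasGRes R n B) (hC : HasGRes R (n + 1) C) :
    HasGRes R n A :=
  (hasGRes_ses_aux n).2 h hB hC

lemma SES.hasGRes_right {n : ℕ} (h : SES f g) (hA : HasGRes R n A) (hB : HasGRes R (n + 1) B) :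
    HasGRes R (n + 1) C := by
  have : Module.Finite R B := hB.finite
  obtain ⟨P, _, _, _, _, p, hp⟩ := exists_free_ses (R := R) (C := B)
  obtain ⟨i', p', h'⟩ := h.ker_comp hp
  exact (SES.of_surjective (g := g ∘ₗ p) (h.surj.comp hp.surj)).hasGRes_succ .of_projective
    (h'.hasGRes_mid (hp.hasGRes_syzygy hB) hA)

lemma HasGRes.of_prod {n : ℕ} (h : HasGRes R n (A × B)) : HasGRes R n A := by
  induction n generalizing A B with
  | zero => exact GProj.of_prod h
  | succ n ih =>
    have : Module.Finite R (A × B) := h.finite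
    have : Module.Finite R A := Module.Finite.of_surjective (LinearMap.fst R A B)
      LinearMap.fst_surjective
    have : Module.Finite R B := Module.Finite.of_surjective (LinearMap.snd R A B)
      LinearMap.snd_surjective
    obtain ⟨P, _, _, _, _, p, hp⟩ := exists_free_ses (R := R) (C := A)
    obtain ⟨Q, _, _, _, _, q, hq⟩ := exists_free_ses (R := R) (C := B)
    have hs : SES ((LinearMap.ker p).subtype.prodMap (LinearMap.ker q).subtype) (p.prodMap q) :=
      ⟨hp.inj.prodMap hq.inj, fun x => by simp [Prod.ext_iff], hp.surj.prodMap hq.surj⟩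
    exact hp.hasGRes_succ .of_projective (ih (hs.hasGRes_syzygy h))

lemma HasGRes.extZero {n i : ℕ} (h : HasGRes R n A) (hi : n < i) : ExtZero R A R i := by
  obtain ⟨i, rfl⟩ := Nat.exists_eq_succ_of_ne_zero (Nat.ne_zero_of_lt hi)
  induction n generalizing A i with
  | zero => exact GProj.extZero h i
  | succ n ih =>
    obtain ⟨K, X, _, _, _, _, f, p, hs, hX, hK⟩ := h.exists_ses
    obtain ⟨i, rfl⟩ := Nat.exists_eq_succ_of_ne_zero (show i ≠ 0 by lia)
    exact hs.ext_right (ih hK _ (by lia)) (hX.extZero _)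

/-- The vanishing is inherited by the first kernel of a resolution, so that kernel is totally
reflexive by induction, and `SES.gProj_right` passes this on to `A`. -/
lemma HasGRes.gProj {n : ℕ} (h : HasGRes R n A) (hA : ∀ i, ExtZero R A R (i + 1)) :
    GProj R A := by
  induction n generalizing A with
  | zero => exact h
  | succ n ih =>
    obtain ⟨K, X, _, _, _, _, f, p, hs, hX, hK⟩ := h.exists_ses
    exact hs.gProj_right (ih hK fun i => hs.ext_left (hX.extZero i) (hA _)) hX (hA 0)

/-- Such a module is totally reflexive with zero dual, and it embeds in its bidual. -/
lemma HasGRes.subsingleton {n : ℕ} (h : HasGRes R n A) (hA : ∀ i, ExtZero R A R i) :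
    Subsingleton A := by
  have hG := h.gProj fun i => hA (i + 1)
  have := extZero_zero_iff.1 (hA 0)
  have : Subsingleton (Module.Dual R (Module.Dual R A)) :=
    ⟨fun f g => LinearMap.ext fun x => by rw [Subsingleton.elim x 0, map_zero, map_zero]⟩
  exact hG.reflexive.1.subsingleton

lemma gDim_le_iff {n : ℕ} : gDim (ModuleCat.of R A) ≤ n ↔ HasGRes R n A := by
  constructor
  · intro h
    have : gDim (ModuleCat.of R A) < (n + 1 : ℕ) :=
      lt_of_le_of_lt h (by exact_mod_cast n.lt_succ_self)
    simp only [gDim, iInf_lt_iff] at this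
    obtain ⟨m, hm, hmn⟩ := this
    exact HasGRes.mono (Nat.lt_succ_iff.1 (by exact_mod_cast hmn)) hm
  · intro h
    exact iInf₂_le n h

lemma gDim_le_of_forall {S : Type u} [CommRing S] [IsNoetherianRing S] {T : Type u}
    [AddCommGroup T] [Module S T] {k : ℕ}
    (h : ∀ n : ℕ, HasGRes S n T → HasGRes R (n + k) A) :
    gDim (ModuleCat.of R A) ≤ gDim (ModuleCat.of S T) + k := by
  induction hd : gDim (ModuleCat.of S T) with
  | top => simp
  | coe n => exact_mod_cast gDim_le_iff.2 (h n (gDim_le_iff.1 hd.le))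

lemma gDim_congr (e : A ≃ₗ[R] B) : gDim (ModuleCat.of R A) = gDim (ModuleCat.of R B) :=
  le_antisymm (by simpa using gDim_le_of_forall (k := 0) fun n h => h.congr e.symm)
    (by simpa using gDim_le_of_forall (k := 0) fun n h => h.congr e)

lemma natCast_le_moduleGrade_iff {n : ℕ} :
    n ≤ moduleGrade (ModuleCat.of R A) ↔ ∀ i < n, ExtZero R A R i := by
  simp only [moduleGrade, le_iInf_iff, Nat.cast_le]
  exact forall_congr' fun i => by rw [not_imp_comm, not_le]

/-- If the grade exceeded a finite G-dimension `n`, then `Ext^i(A, R)` would vanish for `i ≤ n` by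
the grade and for `i > n` by the resolution, forcing `A = 0`. -/
lemma moduleGrade_le_gDim [Nontrivial A] :
    moduleGrade (ModuleCat.of R A) ≤ gDim (ModuleCat.of R A) := by
  induction hd : gDim (ModuleCat.of R A) with
  | top => simp
  | coe n =>
    by_contra! hlt
    have h := gDim_le_iff.1 hd.le
    have hg := natCast_le_moduleGrade_iff.1 (by exact_mod_cast Order.add_one_le_of_lt hlt)
    refine not_subsingleton A (h.subsingleton fun i => ?_)
    obtain hi | hi := le_or_gt i n
    · exact hg i (Nat.lt_succ_of_le hi)
    · exact h.extZero hi

lemma moduleGrade_congr (e : A ≃ₗ[R] B) :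
    moduleGrade (ModuleCat.of R A) = moduleGrade (ModuleCat.of R B) := by
  simp only [moduleGrade, show ∀ i, Subsingleton (Ext (ModuleCat.of R A) (ModuleCat.of R R) i) ↔
    Subsingleton (Ext (ModuleCat.of R B) (ModuleCat.of R R) i) from extZero_congr_left e]

lemma extZero_pi {N : Type u} [AddCommGroup N] [Module R N] {i : ℕ} (h : ExtZero R A N i)
    (m : ℕ) : ExtZero R (Fin m → A) N i := by
  induction m with
  | zero => exact extZero_of_subsingleton_left i
  | succ m ih =>
    exact (extZero_congr_left (Fin.consLinearEquiv R (fun _ => A)) i).1 (SES.prod.ext_mid h ih)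

/-- The grade of a finite module over `R ⧸ I` is at least the grade of `R ⧸ I`. -/
lemma moduleGrade_le_of_surjective {S : Type u} [CommRing S] [Algebra R S]
    (hS : Function.Surjective (algebraMap R S)) [Module S A] [IsScalarTower R S A]
    [Module.Finite S A] :
    moduleGrade (ModuleCat.of R S) ≤ moduleGrade (ModuleCat.of R A) := by
  have : IsNoetherianRing S := isNoetherianRing_of_surjective R S _ hS
  suffices ∀ n : ℕ, n ≤ moduleGrade (ModuleCat.of R S) → n ≤ moduleGrade (ModuleCat.of R A) from
    ENat.forall_natCast_le_iff_le.1 this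
  intro n hn
  rw [natCast_le_moduleGrade_iff] at hn ⊢
  intro i hi
  induction i generalizing A with
  | zero =>
    obtain ⟨m, f, hf⟩ := Module.Finite.exists_fin' S A
    exact extZero_zero_iff.2 ⟨fun φ ψ => by
      have := extZero_zero_iff.1 (extZero_pi (hn 0 hi) m)
      have := LinearMap.congr_fun (Subsingleton.elim (φ ∘ₗ f.restrictScalars R)
        (ψ ∘ₗ f.restrictScalars R))
      exact LinearMap.ext fun a => by obtain ⟨x, rfl⟩ := hf a; exact this x⟩
  | succ i ih =>
    -- The syzygy is taken over `S`, so it is again a finite `S`-module, while the middle term is a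
    -- power of `S`.
    obtain ⟨m, f, hf⟩ := Module.Finite.exists_fin' S A
    have h := SES.of_surjective (g := f.restrictScalars R) hf
    exact h.ext_right (ih (A := LinearMap.ker f) (by lia)) (extZero_pi (hn _ hi) m)

end GResolution

end BurchExt


namespace BurchExt

/-! ### Nakayama's lemma for a single element -/

section Nakayama

variable {R : Type u} [CommRing R] [IsLocalRing R] {A : Type u} [AddCommGroup A] [Module R A]

lemma eq_top_of_forall_exists_smul_add [Module.Finite R A] {x : R} (hx : x ∈ maximalIdeal R)
    (N : Submodule R A) (h : ∀ a : A, ∃ b : A, a - x • b ∈ N) : N = ⊤ := by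
  refine top_le_iff.1 (Submodule.le_of_le_smul_of_le_jacobson_bot Module.Finite.fg_top
    (maximalIdeal_le_jacobson _) fun a _ => ?_)
  obtain ⟨b, hb⟩ := h a
  rw [← sub_add_cancel a (x • b)]
  exact Submodule.add_mem_sup hb (Submodule.smul_mem_smul hx trivial)

lemma subsingleton_of_forall_exists_smul [Module.Finite R A] {x : R} (hx : x ∈ maximalIdeal R)
    (h : ∀ a : A, ∃ b : A, a = x • b) : Subsingleton A := by
  rw [← Submodule.subsingleton_iff R]
  exact subsingleton_of_bot_eq_top (eq_top_of_forall_exists_smul_add hx _ fun a => by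
    obtain ⟨b, hb⟩ := h a
    exact ⟨b, by simp [← hb]⟩)

end Nakayama

/-! ### Descent of G-dimension along an element that need not be regular on the ring -/

section Descent

variable {R : Type u} [CommRing R] [IsLocalRing R] [IsNoetherianRing R]
  {A B C F N : Type u} [AddCommGroup A] [Module R A] [AddCommGroup B] [Module R B]
  [AddCommGroup C] [Module R C] [AddCommGroup F] [Module R F] [AddCommGroup N] [Module R N]
  {f : A →ₗ[R] B} {g : B →ₗ[R] C} {x : R} {φ : A →ₗ[R] B} {a : A →ₗ[R] F} {b : F →ₗ[R] B}

/-- The summand `b ∘ a` factors through a projective module, so it acts as zero on Ext in positive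
degrees. -/
lemma ext_mk₀_comp_eq [Module.Projective R F] (hf : f = x • φ + b ∘ₗ a) {i : ℕ}
    (y : Ext (ModuleCat.of R B) (ModuleCat.of R N) (i + 1)) :
    (Ext.mk₀ (ModuleCat.ofHom f)).comp y (zero_add _) =
      x • (Ext.mk₀ (ModuleCat.ofHom φ)).comp y (zero_add _) := by
  have : ModuleCat.ofHom f = x • ModuleCat.ofHom φ + ModuleCat.ofHom a ≫ ModuleCat.ofHom b := by
    rw [hf]; rfl
  rw [this, Ext.mk₀_add, Ext.add_comp, Ext.mk₀_smul, Ext.smul_comp, ← Ext.mk₀_comp_mk₀,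
    Ext.comp_assoc_of_second_deg_zero,
    (extZero_of_projective i : ExtZero R F N (i + 1)).elim (Ext.comp _ y _) 0, Ext.comp_zero,
    add_zero]

/-- Every class on `A` is pulled back along `f`, hence is `x` times another class; Nakayama applies
because Ext of finite modules is finite. -/
lemma SES.ext_left_of_eq [Module.Projective R F] [Module.Finite R A] [Module.Finite R N]
    (h : SES f g) (hx : x ∈ maximalIdeal R)
    (hf : f = x • φ + b ∘ₗ a) {i : ℕ} (hC : ExtZero R C N (i + 2)) : ExtZero R A N (i + 1) := by
  refine subsingleton_of_forall_exists_smul (R := R) hx fun e => ?_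
  obtain ⟨y, rfl⟩ := Ext.contravariant_sequence_exact₁ h.shortExact _ e (add_comm 1 _)
    (hC.elim _ _)
  exact ⟨_, ext_mk₀_comp_eq hf y⟩

lemma SES.ext_mid_of_eq [Module.Projective R F] [Module.Finite R B] [Module.Finite R N]
    {f : A →ₗ[R] B} {g : B →ₗ[R] C} {φ : B →ₗ[R] C} {a : B →ₗ[R] F} {b : F →ₗ[R] C}
    (h : SES f g) (hx : x ∈ maximalIdeal R)
    (hg : g = x • φ + b ∘ₗ a) {i : ℕ} (hA : ExtZero R A N (i + 1)) : ExtZero R B N (i + 1) := by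
  refine subsingleton_of_forall_exists_smul (R := R) hx fun e => ?_
  obtain ⟨y, rfl⟩ := Ext.contravariant_sequence_exact₂ h.shortExact _ e (hA.elim _ _)
  exact ⟨_, ext_mk₀_comp_eq hg y⟩

/-- Nothing beyond finiteness is known about `B`; instead, `f` is divisible by `x` up to a map
through a projective module, and Nakayama supplies the missing vanishing and reflexivity. The
projective summand is allowed because the shape of `f` must survive passage to syzygies. -/
lemma SES.gProj_left_of_eq [Module.Projective R F] [Module.Finite R F] [Module.Finite R B]
    (h : SES f g) (hx : x ∈ maximalIdeal R) (hf : f = x • φ + b ∘ₗ a) (hC : GProj R C) :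
    GProj R A := by
  have := h.finite_left
  have hd := h.dual (hC.extZero 0)
  have hfd : f.dualMap = x • φ.dualMap + a.dualMap ∘ₗ b.dualMap := by rw [hf]; ext; simp
  have hB (i) : ExtZero R (Module.Dual R B) R (i + 1) :=
    hd.ext_mid_of_eq hx hfd (hC.extZero_dual i)
  have hA (i) : ExtZero R (Module.Dual R A) R (i + 1) := by
    cases i with
    | zero =>
      refine hd.ext_one (hB 0) fun ψ => ?_
      obtain ⟨c, rfl⟩ := hC.reflexive.2 ψ
      obtain ⟨b, rfl⟩ := h.surj c
      exact ⟨Module.Dual.eval R B b, rfl⟩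
    | succ i => exact hd.ext_right (hC.extZero_dual i) (hB _)
  have hdd := hd.dual (hA 0)
  have hfdd (u) : f.dualMap.dualMap u =
      x • φ.dualMap.dualMap u + b.dualMap.dualMap (a.dualMap.dualMap u) := by
    rw [hfd]; ext; simp
  have hF := Module.bijective_dual_eval R F
  have hBbij : Function.Bijective (Module.Dual.eval R B) := by
    constructor
    -- An element of the kernel dies in `C`, so it is `f u` with `u` killed by evaluation.
    -- Reflexivity of `F` gives `a u = 0`, so the element is `x • φ u`, and `φ u` is again in the
    -- kernel.
    · rw [← LinearMap.ker_eq_bot, ← Submodule.subsingleton_iff_eq_bot]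
      refine subsingleton_of_forall_exists_smul (R := R) hx fun ⟨k, hk⟩ => ?_
      rw [LinearMap.mem_ker] at hk
      have hgk : g k = 0 := hC.reflexive.1 (by
        change g.dualMap.dualMap (Module.Dual.eval R B k) = _
        rw [hk, map_zero, map_zero])
      obtain ⟨u, rfl⟩ := (h.exact k).1 hgk
      have hu : Module.Dual.eval R A u = 0 := hdd.inj (by rw [map_zero]; exact hk)
      have hau : a u = 0 := hF.1 (by
        change a.dualMap.dualMap (Module.Dual.eval R A u) = _
        rw [hu, map_zero, map_zero])
      refine ⟨⟨φ u, ?_⟩, ?_⟩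
      · change φ.dualMap.dualMap (Module.Dual.eval R A u) = 0
        rw [hu, map_zero]
      · ext
        simp [hf, hau]
    -- Subtracting evaluation at a lift to `B` of the image in `C**` leaves something from `A**`;
    -- its part through `F` is an evaluation too, so only a multiple of `x` remains.
    · rw [← LinearMap.range_eq_top]
      refine eq_top_of_forall_exists_smul_add hx _ fun ζ => ?_
      obtain ⟨c, hc⟩ := hC.reflexive.2 (g.dualMap.dualMap ζ)
      obtain ⟨e, rfl⟩ := h.surj c
      obtain ⟨u, hu⟩ := (hdd.exact (ζ - Module.Dual.eval R B e)).1 (by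
        rw [map_sub, ← hc]; exact sub_self _)
      obtain ⟨w, hw⟩ := hF.2 (a.dualMap.dualMap u)
      refine ⟨φ.dualMap.dualMap u, e + b w, ?_⟩
      have : Module.Dual.eval R B (b w) = b.dualMap.dualMap (a.dualMap.dualMap u) := by
        rw [← hw]; rfl
      rw [map_add, this]
      rw [hfdd] at hu
      rw [eq_sub_iff_add_eq, eq_comm] at hu
      rw [hu]
      abel
  have : Module.IsReflexive R A := ⟨h.bijective_left hdd
    (dual_eval_comp f) (dual_eval_comp g) hBbij hC.reflexive⟩
  exact .mk' (fun i => h.ext_left_of_eq hx hf (hC.extZero _)) hA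

/-- The horseshoe lemma for kernels. -/
lemma SES.horseshoe (h : SES f g) {P Q : Type u} [AddCommGroup P] [Module R P] [AddCommGroup Q]
    [Module R Q] [Module.Projective R Q] {p : P →ₗ[R] A} {q : Q →ₗ[R] C}
    (hp : Function.Surjective p) (hq : Function.Surjective q) :
    ∃ r : P × Q →ₗ[R] B, Function.Surjective r ∧ r ∘ₗ LinearMap.inl R P Q = f ∘ₗ p ∧
      ∃ (i : LinearMap.ker p →ₗ[R] LinearMap.ker r) (j : LinearMap.ker r →ₗ[R] LinearMap.ker q),
        SES i j ∧ ∀ k, (i k : P × Q) = (k.1, 0) := by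
  obtain ⟨l, hl⟩ := Module.projective_lifting_property g q h.surj
  replace hl (y) : g (l y) = q y := LinearMap.congr_fun hl y
  let r : P × Q →ₗ[R] B := (f ∘ₗ p).coprod l
  have hr (z) : g (r z) = q z.2 := by simp [r, hl, h.exact.apply_apply_eq_zero]
  refine ⟨r, fun b => ?_, by ext; simp [r],
    (LinearMap.inl R P Q ∘ₗ Submodule.subtype _).codRestrict _ fun k => ?_,
    (LinearMap.snd R P Q ∘ₗ Submodule.subtype _).codRestrict _ fun k => ?_, ⟨?_, ?_, ?_⟩,
    fun k => rfl⟩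
  · obtain ⟨y, hy⟩ := hq (g b)
    obtain ⟨u, hu⟩ := (h.exact (b - l y)).1 (by simp [hl, hy])
    obtain ⟨s, rfl⟩ := hp u
    exact ⟨(s, y), by simp [r, hu]⟩
  · simp [r]
  · have := hr k
    rw [LinearMap.mem_ker.1 k.2, map_zero] at this
    exact this.symm
  · intro s t hst
    exact Subtype.ext (congrArg (fun z => z.1.1) hst)
  · rintro ⟨⟨s, t⟩, hst⟩
    constructor
    · intro ht
      obtain rfl : t = 0 := congrArg Subtype.val ht
      have hs : p s = 0 := h.inj (by simpa [r] using hst)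
      exact ⟨⟨s, hs⟩, rfl⟩
    · rintro ⟨k, hk⟩
      rw [← hk]
      rfl
  · rintro ⟨t, ht⟩
    obtain ⟨u, hu⟩ := (h.exact (l t)).1 (by rw [hl]; exact ht)
    obtain ⟨s, hs⟩ := hp (-u)
    exact ⟨⟨(s, t), by simp [r, hs, hu]⟩, rfl⟩

/-- The relation on `f` passes to horseshoe syzygies. With lifts `φ'` and `b'`, the discrepancy `δ`
between `P → P × Q` and `x φ' + b' a p` lands in `ker r`. On `ker p` the term with `p` disappears,
so the inclusion is `x φ' + δ`, with `P` as the new projective module. -/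
lemma SES.hasGRes_left_of_eq {n : ℕ} [Module.Projective R F] [Module.Finite R F]
    [Module.Finite R B] (h : SES f g) (hx : x ∈ maximalIdeal R) (hf : f = x • φ + b ∘ₗ a)
    (hC : HasGRes R n C) : HasGRes R n A := by
  induction n generalizing A B C F with
  | zero => exact h.gProj_left_of_eq hx hf hC
  | succ n ih =>
    have := h.finite_left
    have := h.finite_right
    obtain ⟨P, _, _, _, _, p, hp⟩ := exists_free_ses (R := R) (C := A)
    obtain ⟨Q, _, _, _, _, q, hq⟩ := exists_free_ses (R := R) (C := C)
    obtain ⟨r, hr, hrf, i, j, hij, hi⟩ := h.horseshoe hp.surj hq.surj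
    obtain ⟨φ', hφ'⟩ := Module.projective_lifting_property r (φ ∘ₗ p) hr
    obtain ⟨b', hb'⟩ := Module.projective_lifting_property r b hr
    replace hφ' (y) : r (φ' y) = φ (p y) := LinearMap.congr_fun hφ' y
    replace hb' (y) : r (b' y) = b y := LinearMap.congr_fun hb' y
    let δ : P →ₗ[R] P × Q := LinearMap.inl R P Q - x • φ' - b' ∘ₗ a ∘ₗ p
    have hδ (y) : δ y ∈ LinearMap.ker r := by
      have : r (y, 0) = f (p y) := LinearMap.congr_fun hrf y
      simp [δ, this, hφ', hb', hf]
    have hker (y : LinearMap.ker p) : φ' y ∈ LinearMap.ker r := by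
      simp [hφ']
    refine hp.hasGRes_succ .of_projective (ih (F := P) hij (φ := (φ' ∘ₗ
      Submodule.subtype _).codRestrict _ hker) (a := Submodule.subtype _)
      (b := δ.codRestrict _ hδ) ?_ (hq.hasGRes_syzygy hC))
    ext y : 2
    rw [hi]
    have : ((φ' ∘ₗ Submodule.subtype _).codRestrict _ hker y : P × Q) = φ' y := rfl
    simp [δ, this]

/-- Once some resolution is finite, its length can be shortened to the last degree of nonzero Ext,
by `HasGRes.gProj` applied to a syzygy. -/
lemma HasGRes.of_extZero {n m : ℕ} (h : HasGRes R m A) (hA : ∀ i, n < i → ExtZero R A R i) :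
    HasGRes R n A := by
  induction n generalizing A m with
  | zero => exact h.gProj fun i => hA _ i.succ_pos
  | succ n ih =>
    have : Module.Finite R A := h.finite
    obtain ⟨P, _, _, _, _, p, hp⟩ := exists_free_ses (R := R) (C := A)
    refine hp.hasGRes_succ .of_projective (ih (hp.hasGRes_syzygy h.succ) fun i hi => ?_)
    obtain ⟨i, rfl⟩ := Nat.exists_eq_succ_of_ne_zero (Nat.ne_zero_of_lt hi)
    exact (hp.ext_iff i).1 (hA _ (by lia))

lemma SES.quotSMulTop (hA : IsSMulRegular A x) :
    SES (x • LinearMap.id : A →ₗ[R] A) (x • (⊤ : Submodule R A)).mkQ :=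
  ⟨hA, fun y => by simp [Submodule.mem_smul_pointwise_iff_exists], Submodule.mkQ_surjective _⟩

/-- As `x` may be a zero divisor on `R`, base change to `R/xR` is not available. Multiplication by
`x` on `A` has the required shape with zero projective part; this gives length `n + 1`, and
vanishing of Ext above `n` removes the extra step. -/
lemma hasGRes_of_quotSMulTop [Module.Finite R A] {n : ℕ} (hx : x ∈ maximalIdeal R)
    (hA : IsSMulRegular A x) (h : HasGRes R (n + 1) (QuotSMulTop x A)) : HasGRes R n A := by
  have hs := SES.quotSMulTop hA
  have hf : x • LinearMap.id = x • (LinearMap.id : A →ₗ[R] A) +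
    (0 : PUnit.{u + 1} →ₗ[R] A) ∘ₗ (0 : A →ₗ[R] PUnit.{u + 1}) := by simp
  refine HasGRes.of_extZero (hs.hasGRes_left_of_eq hx hf h) fun i hi => ?_
  obtain ⟨i, rfl⟩ := Nat.exists_eq_succ_of_ne_zero (Nat.ne_zero_of_lt hi)
  exact hs.ext_left_of_eq hx hf (h.extZero (by lia))

end Descent

end BurchExt


namespace BurchExt

/-! ### Dimension shifting for Ext -/

section ExtEquiv

variable {R : Type u} [CommRing R] {A B C N : Type u} [AddCommGroup A] [Module R A]
  [AddCommGroup B] [Module R B] [AddCommGroup C] [Module R C] [AddCommGroup N] [Module R N]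
  {f : A →ₗ[R] B} {g : B →ₗ[R] C}

lemma SES.nonempty_extEquiv [Module.Projective R B] (h : SES f g) (i : ℕ) :
    Nonempty (Ext (ModuleCat.of R A) (ModuleCat.of R N) (i + 1) ≃ₗ[R]
      Ext (ModuleCat.of R C) (ModuleCat.of R N) (i + 2)) := by
  refine ⟨LinearEquiv.ofBijective (h.shortExact.extClass.precompOfLinear R _ (add_comm 1 _))
    ⟨?_, fun x => Ext.contravariant_sequence_exact₃ h.shortExact _ x
      ((extZero_of_projective _ : ExtZero R B N (i + 2)).elim _ _) (add_comm 1 _)⟩⟩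
  rw [injective_iff_map_eq_zero]
  intro x hx
  obtain ⟨y, rfl⟩ := Ext.contravariant_sequence_exact₁ h.shortExact _ x (add_comm 1 _) hx
  rw [(extZero_of_projective _ : ExtZero R B N (i + 1)).elim y 0, Ext.comp_zero]

/-- Degree one needs its own formula because `Hom(B, N)` does not vanish: `Ext¹(C, N)` is only a
cokernel. -/
lemma SES.nonempty_extOneEquiv [Module.Projective R B] (h : SES f g) :
    Nonempty (((A →ₗ[R] N) ⧸ LinearMap.range (LinearMap.lcomp R N f)) ≃ₗ[R]
      Ext (ModuleCat.of R C) (ModuleCat.of R N) 1) := by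
  let δ : (A →ₗ[R] N) →ₗ[R] Ext (ModuleCat.of R C) (ModuleCat.of R N) 1 :=
    h.shortExact.extClass.precompOfLinear R _ (add_comm 1 0) ∘ₗ
      (Ext.linearEquiv₀.trans ModuleCat.homLinearEquiv).symm.toLinearMap
  have hδ (φ) : δ φ = h.shortExact.extClass.comp (Ext.mk₀ (ModuleCat.ofHom φ)) (add_comm 1 0) := rfl
  have hsurj : Function.Surjective δ := fun x => by
    obtain ⟨y, rfl⟩ := Ext.contravariant_sequence_exact₃ h.shortExact _ x
      ((extZero_of_projective _ : ExtZero R B N 1).elim _ _) (add_comm 1 0)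
    obtain ⟨φ, rfl⟩ := (Ext.mk₀_bijective _ _).2 y
    exact ⟨φ.hom, rfl⟩
  have hker : LinearMap.ker δ = LinearMap.range (LinearMap.lcomp R N f) := by
    ext φ
    rw [LinearMap.mem_ker, hδ]
    constructor
    · intro hφ
      obtain ⟨y, hy⟩ := Ext.contravariant_sequence_exact₁ h.shortExact _ _ (add_comm 1 0) hφ
      obtain ⟨ψ, rfl⟩ := (Ext.mk₀_bijective _ _).2 y
      rw [Ext.mk₀_comp_mk₀, (Ext.mk₀_bijective _ _).1.eq_iff] at hy
      exact ⟨ψ.hom, congrArg ModuleCat.Hom.hom hy⟩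
    · rintro ⟨ψ, rfl⟩
      have : ModuleCat.ofHom (LinearMap.lcomp R N f ψ) =
        ModuleCat.ofHom f ≫ ModuleCat.ofHom ψ := rfl
      rw [this, ← Ext.mk₀_comp_mk₀, ← Ext.comp_assoc_of_second_deg_zero]
      exact (congrArg (fun z => Ext.comp z _ _) h.shortExact.extClass_comp).trans
        (Ext.zero_comp _ _ _ _ _)
  exact ⟨(Submodule.quotEquivOfEq _ _ hker.symm).trans (δ.quotKerEquivOfSurjective hsurj)⟩

end ExtEquiv

lemma SES.lift {R : Type u} [CommRing R] {A B C N : Type u} [AddCommGroup A] [Module R A]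
    [AddCommGroup B] [Module R B] [AddCommGroup C] [Module R C] [AddCommGroup N] [Module R N]
    {f : A →ₗ[R] B} {g : B →ₗ[R] C} (h : SES f g) (hA : ExtZero R N A 1) (φ : N →ₗ[R] C) :
    ∃ ψ : N →ₗ[R] B, g ∘ₗ ψ = φ := by
  obtain ⟨y, hy⟩ := Ext.covariant_sequence_exact₃ _ h.shortExact
    (Ext.mk₀ (ModuleCat.ofHom φ)) (zero_add 1) (hA.elim _ _)
  obtain ⟨ψ, rfl⟩ := (Ext.mk₀_bijective _ _).2 y
  refine ⟨ψ.hom, ?_⟩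
  rw [Ext.mk₀_comp_mk₀, (Ext.mk₀_bijective _ _).1.eq_iff] at hy
  exact congrArg ModuleCat.Hom.hom hy

/-! ### Base change of Ext, G-dimension and projective dimension -/

section BaseChange

variable (R S : Type u) [CommRing R] [CommRing S] [Algebra R S]

/-- A class of `R`-modules that is closed under submodules and on which the base change to `S` is
exact. -/
structure BaseChangeClass where
  Good : ∀ (T : Type u) [AddCommGroup T] [Module R T], Prop
  of_free : ∀ {P : Type u} [AddCommGroup P] [Module R P], Module.Free R P → Good P
  of_injective : ∀ {A P : Type u} [AddCommGroup A] [Module R A] [AddCommGroup P] [Module R P]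
    {f : A →ₗ[R] P}, Function.Injective f → Good P → Good A
  ses : ∀ {A P T : Type u} [AddCommGroup A] [Module R A] [AddCommGroup P] [Module R P]
    [AddCommGroup T] [Module R T] {f : A →ₗ[R] P} {g : P →ₗ[R] T}, SES f g →
    Good T → SES (f.baseChange S) (g.baseChange S)

/-- Flat base change. -/
def flatClass [Module.Flat R S] : BaseChangeClass R S where
  Good _ _ _ := True
  of_free _ := trivial
  of_injective _ _ := trivial
  ses h _ := ⟨Module.Flat.lTensor_preserves_injective_linearMap _ h.inj,
    lTensor_exact S h.exact h.surj, LinearMap.lTensor_surjective S h.surj⟩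

variable {R S}

lemma isSMulRegular_of_free {x : R} (hR : IsSMulRegular R x) (P : Type u) [AddCommGroup P]
    [Module R P] [Module.Free R P] : IsSMulRegular P x := by
  have := (Module.Free.chooseBasis R P).repr.symm.isSMulRegular_congr x
  rw [← this]
  intro a b hab
  ext i
  exact hR (DFunLike.congr_fun hab i)

lemma one_tmul_eq_zero_iff {x : R} (hS : Function.Surjective (algebraMap R S))
    (hx : RingHom.ker (algebraMap R S) = Ideal.span {x}) {M : Type u} [AddCommGroup M]
    [Module R M] (m : M) : (1 : S) ⊗ₜ[R] m = 0 ↔ ∃ m', m = x • m' := by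
  have hxS : algebraMap R S x = 0 := by
    rw [← RingHom.mem_ker, hx]; exact Ideal.mem_span_singleton_self x
  constructor
  · intro h
    have hex : Function.Exact (LinearMap.mulLeft R x) (Algebra.linearMap R S) := by
      intro r
      rw [Algebra.linearMap_apply, ← RingHom.mem_ker, hx, Ideal.mem_span_singleton']
      exact ⟨fun ⟨a, ha⟩ => ⟨a, by simpa [mul_comm] using ha⟩,
        fun ⟨a, ha⟩ => ⟨a, by simpa [mul_comm] using ha⟩⟩
    obtain ⟨z, hz⟩ := (rTensor_exact M hex hS (1 ⊗ₜ m)).1 (by simpa using h)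
    refine ⟨TensorProduct.lid R M z, ?_⟩
    have : ∀ z : R ⊗[R] M, TensorProduct.lid R M ((LinearMap.mulLeft R x).rTensor M z) =
        x • TensorProduct.lid R M z := fun z => by
      induction z with
      | zero => simp
      | tmul a b => simp [mul_smul]
      | add a b ha hb => simp only [map_add, ha, hb, smul_add]
    rw [← this, hz, TensorProduct.lid_tmul, one_smul]
  · rintro ⟨m', rfl⟩
    rw [← TensorProduct.smul_tmul, Algebra.smul_def, hxS, zero_mul, TensorProduct.zero_tmul]

variable (R S) in
/-- Base change to the quotient by a regular element `x`, for modules on which `x` is regular. -/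
def regularClass (x : R) (hS : Function.Surjective (algebraMap R S))
    (hx : RingHom.ker (algebraMap R S) = Ideal.span {x}) (hR : IsSMulRegular R x) :
    BaseChangeClass R S where
  Good T _ _ := IsSMulRegular T x
  of_free {P} _ _ _ := isSMulRegular_of_free hR P
  of_injective {A P} _ _ _ _ f h hP := hP.of_injective f h
  ses {A P T} _ _ _ _ _ _ f g h hT := by
    refine ⟨?_, lTensor_exact S h.exact h.surj, LinearMap.lTensor_surjective S h.surj⟩
    rw [injective_iff_map_eq_zero]
    intro z hz
    obtain ⟨a, rfl⟩ := TensorProduct.mk_surjective R A S hS z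
    obtain ⟨p, hp⟩ := (one_tmul_eq_zero_iff hS hx (f a)).1 (by simpa using hz)
    have hgp : g p = 0 := hT (by
      simp only [← map_smul, ← hp, smul_zero]; exact (h.exact _).2 ⟨a, rfl⟩)
    obtain ⟨a', rfl⟩ := (h.exact p).1 hgp
    exact (one_tmul_eq_zero_iff hS hx a).2 ⟨a', h.inj (by rw [hp, map_smul])⟩

namespace BaseChangeClass

variable (𝒞 : BaseChangeClass R S)

lemma good_ker (T : Type u) [AddCommGroup T] [Module R T] :
    𝒞.Good (LinearMap.ker (Finsupp.linearCombination R (id : T → T))) :=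
  𝒞.of_injective
    (f := (LinearMap.ker (Finsupp.linearCombination R (id : T → T))).subtype)
    (Submodule.subtype_injective _) (𝒞.of_free (Module.Free.finsupp R R T))

/-- Compatibility of `Ext` with a base change that is exact on syzygies. -/
theorem exists_extEquiv (N : Type u) [AddCommGroup N] [Module R N] [Module S N]
    [IsScalarTower R S N] (i : ℕ) (T : Type u) [AddCommGroup T] [Module R T] (hT : 𝒞.Good T) :
    ∃ e : Ext (ModuleCat.of R T) (ModuleCat.of R N) i ≃+
        Ext (ModuleCat.of S (S ⊗[R] T)) (ModuleCat.of S N) i,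
      ∀ (r : R) y, e (r • y) = algebraMap R S r • e y := by
  -- Degree zero is the Hom-tensor adjunction and degree one the induced map of cokernels. From
  -- degree two on, the claim shifts to the kernel of a free cover, which is good as a submodule of
  -- a free module.
  induction i using Nat.twoStepInduction generalizing T with
  | zero =>
    let e₁ : Ext (ModuleCat.of R T) (ModuleCat.of R N) 0 ≃ₗ[R] (T →ₗ[R] N) :=
      Ext.linearEquiv₀.trans ModuleCat.homLinearEquiv
    let e₂ : Ext (ModuleCat.of S (S ⊗[R] T)) (ModuleCat.of S N) 0 ≃ₗ[S] (S ⊗[R] T →ₗ[S] N) :=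
      Ext.linearEquiv₀.trans ModuleCat.homLinearEquiv
    let e₃ : (T →ₗ[R] N) ≃ₗ[S] (S ⊗[R] T →ₗ[S] N) := LinearMap.liftBaseChangeEquiv S
    refine ⟨(e₁.toAddEquiv.trans e₃.toAddEquiv).trans e₂.symm.toAddEquiv, fun r y => ?_⟩
    change e₂.symm (e₃ (e₁ (r • y))) = _ • e₂.symm (e₃ (e₁ y))
    rw [← map_smul, ← map_smul, map_smul e₁]
    congr 2
    ext t
    simp
  | one =>
    have h := SES.of_surjective (Finsupp.linearCombination_id_surjective R T)
    have h' := 𝒞.ses h hT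
    obtain ⟨e₁⟩ := h.nonempty_extOneEquiv (N := N)
    obtain ⟨e₂⟩ := h'.nonempty_extOneEquiv (N := N)
    let A := LinearMap.ker (Finsupp.linearCombination R (id : T → T))
    let P := T →₀ R
    let f : A →ₗ[R] P := A.subtype
    let a : (A →ₗ[R] N) ≃ₗ[S] (S ⊗[R] A →ₗ[S] N) := LinearMap.liftBaseChangeEquiv S
    let b : (P →ₗ[R] N) ≃ₗ[S] (S ⊗[R] P →ₗ[S] N) := LinearMap.liftBaseChangeEquiv S
    have hab (φ : P →ₗ[R] N) : a (φ ∘ₗ f) = b φ ∘ₗ f.baseChange S := by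
      ext; simp [a, b]
    let e₃ : ((A →ₗ[R] N) ⧸ LinearMap.range (LinearMap.lcomp R N f)) ≃+
        ((S ⊗[R] A →ₗ[S] N) ⧸ LinearMap.range (LinearMap.lcomp S N (f.baseChange S))) :=
      QuotientAddGroup.congr (LinearMap.range (LinearMap.lcomp R N f)).toAddSubgroup
      (LinearMap.range (LinearMap.lcomp S N (f.baseChange S))).toAddSubgroup a.toAddEquiv (by
        ext φ
        constructor
        · rintro ⟨_, ⟨ψ, rfl⟩, rfl⟩
          exact ⟨b ψ, (hab ψ).symm⟩
        · rintro ⟨ψ, rfl⟩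
          obtain ⟨ψ, rfl⟩ := b.surjective ψ
          exact ⟨_, ⟨ψ, rfl⟩, hab ψ⟩)
    have he₃ (φ : A →ₗ[R] N) : e₃ (Submodule.Quotient.mk φ) = Submodule.Quotient.mk (a φ) := rfl
    refine ⟨(e₁.symm.toAddEquiv.trans e₃).trans e₂.toAddEquiv, fun r y => ?_⟩
    obtain ⟨y, rfl⟩ := e₁.surjective y
    obtain ⟨φ, rfl⟩ := Submodule.Quotient.mk_surjective _ y
    change e₂ (e₃ (e₁.symm (r • e₁ _))) = _ • e₂ (e₃ (e₁.symm (e₁ _)))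
    rw [← map_smul e₁, e₁.symm_apply_apply, e₁.symm_apply_apply, ← Submodule.Quotient.mk_smul, he₃,
      he₃, ← map_smul e₂, ← Submodule.Quotient.mk_smul, ← map_smul a]
    congr 3
    ext; simp
  | more i _ ih =>
    have h := SES.of_surjective (Finsupp.linearCombination_id_surjective R T)
    have h' := 𝒞.ses h hT
    obtain ⟨e₁⟩ := h.nonempty_extEquiv (N := N) i
    obtain ⟨e₂⟩ := h'.nonempty_extEquiv (N := N) i
    obtain ⟨e₃, he₃⟩ := ih _ (𝒞.good_ker T)
    refine ⟨(e₁.symm.toAddEquiv.trans e₃).trans e₂.toAddEquiv, fun r y => ?_⟩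
    change e₂ (e₃ (e₁.symm (r • y))) = _ • e₂ (e₃ (e₁.symm y))
    rw [map_smul e₁.symm, he₃, map_smul e₂]

lemma extZero_iff (N : Type u) [AddCommGroup N] [Module R N] [Module S N]
    [IsScalarTower R S N] (i : ℕ) (T : Type u) [AddCommGroup T] [Module R T] (hT : 𝒞.Good T) :
    ExtZero S (S ⊗[R] T) N i ↔ ExtZero R T N i :=
  (𝒞.exists_extEquiv N i T hT).choose.toEquiv.subsingleton_congr.symm

variable (S) in
/-- The comparison of the base change of the dual with the dual of the base change. -/
noncomputable def dualComparison (T : Type u) [AddCommGroup T] [Module R T] :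
    S ⊗[R] Module.Dual R T →ₗ[S] Module.Dual S (S ⊗[R] T) :=
  (Module.Dual.baseChange S).liftBaseChange S

lemma dualComparison_tmul (T : Type u) [AddCommGroup T] [Module R T] (s t : S)
    (d : Module.Dual R T) (y : T) :
    dualComparison S T (s ⊗ₜ d) (t ⊗ₜ y) = s * (t * algebraMap R S (d y)) := by
  simp [dualComparison, Algebra.smul_def]
  ring

/-- The comparison of the base change of the dual with the dual of the base change is bijective
on totally reflexive modules, and their base change has vanishing `Ext`. -/
structure PreservesGProj (𝒞 : BaseChangeClass R S) : Prop where
  good : ∀ (T : Type u) [AddCommGroup T] [Module R T], GProj R T → 𝒞.Good T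
  bijective : ∀ (T : Type u) [AddCommGroup T] [Module R T], GProj R T →
    Function.Bijective (dualComparison (R := R) S T)
  extZero : ∀ (T : Type u) [AddCommGroup T] [Module R T], GProj R T →
    ∀ i, ExtZero S (S ⊗[R] T) S (i + 1)

variable {𝒞}

lemma PreservesGProj.gProj [IsNoetherianRing R] (h𝒞 : 𝒞.PreservesGProj) {T : Type u} [AddCommGroup T] [Module R T]
    (hT : GProj R T) : GProj S (S ⊗[R] T) := by
  have := hT.finite
  have : Module.Finite R T := this
  have hβ := h𝒞.bijective T hT
  have hβ' := h𝒞.bijective _ hT.dual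
  have : Module.IsReflexive S (S ⊗[R] T) := by
    constructor
    -- In this naturality square every map other than the evaluation of `S ⊗ T` is known to be
    -- bijective.
    have hcomp : (dualComparison S T).dualMap ∘ₗ Module.Dual.eval S (S ⊗[R] T) =
        dualComparison S (Module.Dual R T) ∘ₗ (Module.Dual.eval R T).baseChange S := by
      ext t d
      simp [dualComparison_tmul]
    have h1 : Function.Bijective (dualComparison S T).dualMap :=
      ((LinearEquiv.ofBijective _ hβ).dualMap).bijective
    have h2 : Function.Bijective ((Module.Dual.eval R T).baseChange S) :=
      ((LinearEquiv.ofBijective _ hT.reflexive).baseChange R S _ _).bijective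
    rw [← h1.of_comp_iff', ← LinearMap.coe_comp, hcomp, LinearMap.coe_comp]
    exact hβ'.comp h2
  exact GProj.mk' (h𝒞.extZero T hT) fun i =>
    (extZero_congr_left (LinearEquiv.ofBijective _ hβ) _).1 (h𝒞.extZero _ hT.dual i)

lemma PreservesGProj.hasGRes [IsNoetherianRing R] [IsNoetherianRing S] (h𝒞 : 𝒞.PreservesGProj) {n : ℕ} {T : Type u} [AddCommGroup T]
    [Module R T] (hT : HasGRes R n T) (hT' : 𝒞.Good T) : HasGRes S n (S ⊗[R] T) := by
  induction n generalizing T with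
  | zero => exact h𝒞.gProj hT
  | succ n ih =>
    obtain ⟨A, X, _, _, _, _, f, g, h, hX, hA⟩ := hT.exists_ses
    exact (𝒞.ses h hT').hasGRes_succ (h𝒞.gProj hX)
      (ih hA (𝒞.of_injective h.inj (h𝒞.good X hX)))

lemma hasProjectiveDimensionLE (𝒞 : BaseChangeClass R S) {n : ℕ} {T : Type u} [AddCommGroup T]
    [Module R T] (hT' : 𝒞.Good T) (hT : HasProjectiveDimensionLE (ModuleCat.of R T) n) :
    HasProjectiveDimensionLE (ModuleCat.of S (S ⊗[R] T)) n := by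
  induction n generalizing T with
  | zero =>
    have : Module.Projective R T := by
      rw [IsProjective.iff_projective]
      exact projective_iff_hasProjectiveDimensionLT_one.2 hT
    infer_instance
  | succ n ih =>
    have h := SES.of_surjective (Finsupp.linearCombination_id_surjective R T)
    have h' := 𝒞.ses h hT'
    have h1 := (h.shortExact.hasProjectiveDimensionLT_X₃_iff n
      ((IsProjective.iff_projective _).1 inferInstance)).1 hT
    have h2 := ih (𝒞.good_ker T) h1
    exact (h'.shortExact.hasProjectiveDimensionLT_X₃_iff n
      ((IsProjective.iff_projective _).1 inferInstance)).2 h2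

end BaseChangeClass

lemma dualComparison_bijective_of_flat [Module.Flat R S] (T : Type u) [AddCommGroup T] [Module R T]
    [Module.FinitePresentation R T] :
    Function.Bijective (BaseChangeClass.dualComparison (R := R) S T) := by
  have h := Module.FinitePresentation.isBaseChange_map R T R S
  let e : (S ⊗[R] T →ₗ[S] S ⊗[R] R) ≃ₗ[S] Module.Dual S (S ⊗[R] T) :=
    LinearEquiv.congrRight (TensorProduct.AlgebraTensorModule.rid R S S)
  have : BaseChangeClass.dualComparison (R := R) S T = (h.equiv.trans e).toLinearMap := by
    ext d t
    change BaseChangeClass.dualComparison (R := R) S T (1 ⊗ₜ d) (1 ⊗ₜ t) =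
      TensorProduct.AlgebraTensorModule.rid R S S (h.equiv (1 ⊗ₜ d) (1 ⊗ₜ t))
    simp [BaseChangeClass.dualComparison_tmul, IsBaseChange.equiv_tmul, Algebra.smul_def]
  rw [this]
  exact (h.equiv.trans e).bijective

/-- Vanishing of `Ext` against the ring is preserved by flat base change. -/
lemma extZero_baseChange_of_flat [Module.Flat R S] [IsNoetherianRing R] (i : ℕ) (T : Type u)
    [AddCommGroup T] [Module R T] [Module.Finite R T] (hT : ExtZero R T R i) :
    ExtZero S (S ⊗[R] T) S i := by
  have hfp (T : Type u) [AddCommGroup T] [Module R T] [Module.Finite R T] :=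
    Module.finitePresentation_of_finite R T
  induction i using Nat.twoStepInduction generalizing T with
  | zero =>
    rw [extZero_zero_iff] at hT ⊢
    have : Subsingleton (S ⊗[R] Module.Dual R T) := by
      have : Subsingleton (Module.Dual R T) := hT
      infer_instance
    exact (Equiv.ofBijective _ (dualComparison_bijective_of_flat (R := R) (S := S) T)).symm.subsingleton
  | one =>
    obtain ⟨P, _, _, _, _, g, h⟩ := exists_free_ses (R := R) (C := T)
    have := h.finite_left
    have h' := (flatClass R S).ses h trivial
    -- By flatness a functional on the base-changed kernel is a sum of terms `s ⊗ d`, and each `d`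
    -- extends to `P` since `Ext¹(T, R) = 0`.
    refine h'.ext_one (extZero_of_projective _) fun φ => ?_
    obtain ⟨z, rfl⟩ := (dualComparison_bijective_of_flat (R := R) (S := S) _).2 φ
    induction z with
    | zero => exact ⟨0, by simp⟩
    | tmul s d =>
      obtain ⟨ψ, hψ⟩ := h.extend hT d
      refine ⟨BaseChangeClass.dualComparison S P (s ⊗ₜ ψ), ?_⟩
      ext a
      simp [BaseChangeClass.dualComparison_tmul, ← hψ]
    | add z w hz hw =>
      obtain ⟨a, ha⟩ := hz
      obtain ⟨b, hb⟩ := hw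
      exact ⟨a + b, by rw [LinearMap.add_comp, ha, hb, map_add]⟩
  | more i _ ih =>
    obtain ⟨P, _, _, _, _, g, h⟩ := exists_free_ses (R := R) (C := T)
    have := h.finite_left
    have h' := (flatClass R S).ses h trivial
    exact (h'.ext_iff i).2 (ih _ ((h.ext_iff i).1 hT))

lemma flatClass_preservesGProj [Module.Flat R S] [IsNoetherianRing R] :
    (flatClass R S).PreservesGProj where
  good _ _ _ _ := trivial
  bijective T _ _ hT := by
    have : Module.Finite R T := hT.finite
    have : Module.FinitePresentation R T := Module.finitePresentation_of_finite R T
    exact dualComparison_bijective_of_flat T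
  extZero T _ _ hT i := by
    have : Module.Finite R T := hT.finite
    exact extZero_baseChange_of_flat _ T (hT.extZero i)

section Regular

variable {x : R} (hS : Function.Surjective (algebraMap R S))
  (hx : RingHom.ker (algebraMap R S) = Ideal.span {x}) (hR : IsSMulRegular R x)

include hS hx hR

lemma ses_mul_algebraMap : SES (LinearMap.mulLeft R x) (Algebra.linearMap R S) where
  inj := hR
  exact r := by
    rw [Algebra.linearMap_apply, ← RingHom.mem_ker, hx, Ideal.mem_span_singleton']
    exact ⟨fun ⟨a, ha⟩ => ⟨a, by simpa [mul_comm] using ha⟩,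
      fun ⟨a, ha⟩ => ⟨a, by simpa [mul_comm] using ha⟩⟩
  surj := hS

/-- Rees' argument: over `S`, Ext of `T/xT` into `S` is Ext of `T` into `S` over `R`, and the
sequence `R → R → S` given by `x` bounds the latter by two consecutive Ext modules into `R`. -/
lemma extZero_baseChange_of_regular (T : Type u) [AddCommGroup T] [Module R T]
    (hT : IsSMulRegular T x) {i : ℕ} (h : ExtZero R T R i) (h' : ExtZero R T R (i + 1)) :
    ExtZero S (S ⊗[R] T) S i :=
  ((regularClass R S x hS hx hR).extZero_iff S i T hT).2
    ((ses_mul_algebraMap hS hx hR).ext_right' h h')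

/-- A totally reflexive `T` embeds in its bidual, so `x` is regular on it. A functional with values
in `xR` can be divided by `x`, giving injectivity of the comparison; a functional `T → S` lifts to
`R` because `Ext¹(T, R) = 0`, giving surjectivity. -/
lemma regularClass_preservesGProj [IsNoetherianRing R] :
    (regularClass R S x hS hx hR).PreservesGProj where
  good T _ _ hT := by
    have : Module.IsReflexive R T := hT.isReflexive
    intro a b hab
    refine (Module.bijective_dual_eval R T).1 (LinearMap.ext fun d => hR ?_)
    simpa using congrArg d hab
  bijective T _ _ hT := by
    constructor
    · rw [injective_iff_map_eq_zero]
      intro z hz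
      obtain ⟨d, rfl⟩ := TensorProduct.mk_surjective R (Module.Dual R T) S hS z
      have hd (t : T) : ∃ r, d t = x * r := by
        have := LinearMap.congr_fun hz (1 ⊗ₜ t)
        simp only [TensorProduct.mk_apply, BaseChangeClass.dualComparison_tmul, one_mul,
          LinearMap.zero_apply] at this
        rw [← RingHom.mem_ker, hx, Ideal.mem_span_singleton'] at this
        obtain ⟨a, ha⟩ := this
        exact ⟨a, by rw [← ha, mul_comm]⟩
      choose r hr using hd
      refine (one_tmul_eq_zero_iff hS hx d).2 ⟨⟨⟨r, fun a b => hR ?_⟩, fun c a => hR ?_⟩, ?_⟩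
      · simp [mul_add, ← hr]
      · simp [← hr, mul_left_comm x c]
      · ext t; simp [hr]
    · intro φ
      obtain ⟨ψ, hψ⟩ : ∃ ψ : T →ₗ[R] R, Algebra.linearMap R S ∘ₗ ψ =
          φ.restrictScalars R ∘ₗ TensorProduct.mk R S T 1 := by
        obtain ⟨ψ, hψ⟩ := (ses_mul_algebraMap hS hx hR).lift (hT.extZero 0)
          (φ.restrictScalars R ∘ₗ TensorProduct.mk R S T 1)
        exact ⟨ψ, hψ⟩
      refine ⟨1 ⊗ₜ ψ, ?_⟩
      ext t
      simpa [BaseChangeClass.dualComparison_tmul] using LinearMap.congr_fun hψ t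
  extZero T _ _ hT i :=
    extZero_baseChange_of_regular hS hx hR T (by
      have : Module.IsReflexive R T := hT.isReflexive
      intro a b hab
      refine (Module.bijective_dual_eval R T).1 (LinearMap.ext fun d => hR ?_)
      simpa using congrArg d hab) (hT.extZero i) (hT.extZero (i + 1))

end Regular

end BaseChange
end BurchExt


namespace BurchExt

/-! ### Betti numbers -/

section BettiNumbers

variable {R : Type u} [CommRing R] [IsLocalRing R]
  {A B C : Type u} [AddCommGroup A] [Module R A] [AddCommGroup B] [Module R B]
  [AddCommGroup C] [Module R C] {f : A →ₗ[R] B} {g : B →ₗ[R] C}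

lemma residue_smul_ext (M : ModuleCat.{u} R) (n : ℕ) (r : R)
    (y : Ext M (ModuleCat.of R (ResidueField R)) n) : residue R r • y = r • y := rfl

instance (M : ModuleCat.{u} R) (n : ℕ) : IsScalarTower R (ResidueField R)
    (Ext M (ModuleCat.of R (ResidueField R)) n) :=
  ⟨fun r s y => by
    obtain ⟨s, rfl⟩ := residue_surjective s
    rw [Algebra.smul_def, mul_smul]
    rfl⟩

lemma linearMap_map_residue_smul {M N : ModuleCat.{u} R} {n m : ℕ}
    (e : Ext M (ModuleCat.of R (ResidueField R)) n →ₗ[R] Ext N (ModuleCat.of R (ResidueField R)) m)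
    (c : ResidueField R) (y) : e (c • y) = c • e y := by
  obtain ⟨r, rfl⟩ := residue_surjective c
  rw [residue_smul_ext, residue_smul_ext, map_smul]

lemma betti_eq_of_linearEquiv {M N : ModuleCat.{u} R} {n m : ℕ}
    (e : Ext M (ModuleCat.of R (ResidueField R)) n ≃ₗ[R] Ext N (ModuleCat.of R (ResidueField R)) m) :
    betti M n = betti N m :=
  LinearEquiv.finrank_eq
    { e with map_smul' := linearMap_map_residue_smul e.toLinearMap }

lemma betti_congr (e : A ≃ₗ[R] B) (n : ℕ) :
    betti (ModuleCat.of R A) n = betti (ModuleCat.of R B) n :=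
  betti_eq_of_linearEquiv (LinearEquiv.ofLinearMap
    ((Ext.mk₀ (ModuleCat.ofHom e.symm.toLinearMap)).precompOfLinear R _ (zero_add n))
    ((Ext.mk₀ (ModuleCat.ofHom e.toLinearMap)).precompOfLinear R _ (zero_add n))
    (by ext y; simp [← Ext.comp_assoc_of_second_deg_zero, ← ModuleCat.ofHom_comp])
    (by ext y; simp [← Ext.comp_assoc_of_second_deg_zero, ← ModuleCat.ofHom_comp]))

/-- The cover is not assumed minimal, so the shift begins only in degree two of `C`. -/
lemma SES.betti_succ [Module.Projective R B] (h : SES f g) (n : ℕ) :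
    betti (ModuleCat.of R C) (n + 2) = betti (ModuleCat.of R A) (n + 1) :=
  betti_eq_of_linearEquiv (h.nonempty_extEquiv n).some.symm

instance [IsNoetherianRing R] [Module.Finite R A] (n : ℕ) : Module.Finite (ResidueField R)
    (Ext (ModuleCat.of R A) (ModuleCat.of R (ResidueField R)) n) :=
  Module.Finite.of_restrictScalars_finite R _ _

lemma betti_prod [IsNoetherianRing R] [Module.Finite R A] [Module.Finite R B] (n : ℕ) :
    betti (ModuleCat.of R (A × B)) n = betti (ModuleCat.of R A) n + betti (ModuleCat.of R B) n := by
  let E (T : Type u) [AddCommGroup T] [Module R T] :=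
    Ext (ModuleCat.of R T) (ModuleCat.of R (ResidueField R)) n
  let pull {T U : Type u} [AddCommGroup T] [Module R T] [AddCommGroup U] [Module R U]
      (φ : T →ₗ[R] U) : E U →ₗ[R] E T :=
    (Ext.mk₀ (ModuleCat.ofHom φ)).precompOfLinear R _ (zero_add n)
  have comp {T U V : Type u} [AddCommGroup T] [Module R T] [AddCommGroup U] [Module R U]
      [AddCommGroup V] [Module R V] (φ : T →ₗ[R] U) (ψ : U →ₗ[R] V) (y : E V) :
      pull φ (pull ψ y) = pull (ψ ∘ₗ φ) y := by
    change (Ext.mk₀ _).comp ((Ext.mk₀ _).comp y (zero_add n)) (zero_add n) =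
      (Ext.mk₀ _).comp y (zero_add n)
    rw [← Ext.comp_assoc_of_second_deg_zero, Ext.mk₀_comp_mk₀, ← ModuleCat.ofHom_comp]
  have id' {T : Type u} [AddCommGroup T] [Module R T] (y : E T) : pull LinearMap.id y = y :=
    Ext.mk₀_id_comp _
  have zero' {T U : Type u} [AddCommGroup T] [Module R T] [AddCommGroup U] [Module R U]
      (y : E U) : pull (0 : T →ₗ[R] U) y = 0 := by
    change (Ext.mk₀ _).comp y (zero_add n) = 0
    rw [ModuleCat.ofHom_zero, Ext.mk₀_zero, Ext.zero_comp]
  have add' {T U : Type u} [AddCommGroup T] [Module R T] [AddCommGroup U] [Module R U]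
      (φ ψ : T →ₗ[R] U) (y : E U) : pull (φ + ψ) y = pull φ y + pull ψ y := by
    change (Ext.mk₀ _).comp y (zero_add n) =
      (Ext.mk₀ _).comp y (zero_add n) + (Ext.mk₀ _).comp y (zero_add n)
    rw [ModuleCat.ofHom_add, Ext.mk₀_add, Ext.add_comp]
  let e : E (A × B) ≃ₗ[ResidueField R] E A × E B :=
    { toFun y := (pull (LinearMap.inl R A B) y, pull (LinearMap.inr R A B) y)
      invFun y := pull (LinearMap.fst R A B) y.1 + pull (LinearMap.snd R A B) y.2
      map_add' := by simp
      map_smul' c y := by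
        ext
        · exact linearMap_map_residue_smul (pull _) c y
        · exact linearMap_map_residue_smul (pull _) c y
      left_inv y := by
        simp only [comp, ← add']
        convert id' y
        ext <;> simp
      right_inv y := by
        ext
        · simp only [map_add, comp, LinearMap.fst_comp_inl, LinearMap.snd_comp_inl, id', zero',
            add_zero]
        · simp only [map_add, comp, LinearMap.fst_comp_inr, LinearMap.snd_comp_inr, id', zero',
            zero_add] }
  exact e.finrank_eq.trans (Module.finrank_prod ..)

/-- Ext into the residue field of `S` can be computed over either ring, and `hk` identifies this
coefficient module with the residue field of `R`. -/
lemma betti_baseChange {S : Type u} [CommRing S] [IsLocalRing S] [Algebra R S]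
    [IsLocalHom (algebraMap R S)]
    (hk : Function.Bijective (algebraMap (ResidueField R) (ResidueField S)))
    (𝒞 : BaseChangeClass R S) (hA : 𝒞.Good A) (n : ℕ) :
    betti (ModuleCat.of S (S ⊗[R] A)) n = betti (ModuleCat.of R A) n := by
  obtain ⟨e, he⟩ := 𝒞.exists_extEquiv (ResidueField S) n A hA
  let e₀ : ResidueField R ≃ₗ[R] ResidueField S :=
    LinearEquiv.ofBijective (IsScalarTower.toAlgHom R (ResidueField R) (ResidueField S)).toLinearMap
      hk
  let e₁ : Ext (ModuleCat.of R A) (ModuleCat.of R (ResidueField R)) n ≃ₗ[R]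
      Ext (ModuleCat.of R A) (ModuleCat.of R (ResidueField S)) n :=
    LinearEquiv.ofLinearMap ((Ext.mk₀ (ModuleCat.ofHom e₀.toLinearMap)).postcompOfLinear R _ (add_zero n))
      ((Ext.mk₀ (ModuleCat.ofHom e₀.symm.toLinearMap)).postcompOfLinear R _ (add_zero n))
      (by ext y; simp [← ModuleCat.ofHom_comp]) (by ext y; simp [← ModuleCat.ofHom_comp])
  refine (congrArg Cardinal.toNat (rank_eq_of_equiv_equiv
    (algebraMap (ResidueField R) (ResidueField S)) (e₁.toAddEquiv.trans e) hk fun r y => ?_)).symm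
  obtain ⟨r, rfl⟩ := residue_surjective r
  change e (e₁ (r • y)) = (residue S (algebraMap R S r)) • e (e₁ y)
  rw [map_smul, he, residue_smul_ext]

end BettiNumbers

/-! ### Growth of integer sequences -/

section Growth

variable {a b : ℕ → ℕ}

lemma exists_growth_bound_iff (hab : ∀ n, b (n + 2) = a (n + 2) + a (n + 1)) (c : ℕ) :
    (∃ α : ℝ, 0 < α ∧ ∀ n : ℕ, 1 ≤ n → (a n : ℝ) ≤ α * (n : ℝ) ^ ((c : ℤ) - 1)) ↔
      ∃ α : ℝ, 0 < α ∧ ∀ n : ℕ, 1 ≤ n → (b n : ℝ) ≤ α * (n : ℝ) ^ ((c : ℤ) - 1) := by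
  -- The factor `2` is for `c = 0`, where the exponent is `-1` and the power decreases.
  have hpow (m : ℕ) : ((m + 1 : ℕ) : ℝ) ^ ((c : ℤ) - 1) ≤ 2 * ((m + 2 : ℕ) : ℝ) ^ ((c : ℤ) - 1) := by
    have h1 : (0 : ℝ) < (m + 1 : ℕ) := by positivity
    have h2 : (0 : ℝ) < (m + 2 : ℕ) := by positivity
    cases c with
    | zero =>
      simp only [Nat.cast_zero, zero_sub, zpow_neg, zpow_one]
      rw [← div_eq_mul_inv, le_div_iff₀ h2, inv_mul_le_iff₀ h1]
      push_cast
      linarith [(Nat.cast_nonneg m : (0 : ℝ) ≤ m)]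
    | succ c =>
      simp only [Nat.cast_add, Nat.cast_one, add_sub_cancel_right, zpow_natCast]
      push_cast at h1 h2 ⊢
      calc ((m : ℝ) + 1) ^ c ≤ ((m : ℝ) + 2) ^ c := by gcongr; norm_num
        _ ≤ _ := le_mul_of_one_le_left (by positivity) (by norm_num)
  constructor
  · rintro ⟨α, hα, h⟩
    -- The two summands of `b n` cost `α` and `2 α`; `b 1` covers `n = 1`, which the recursion does
    -- not reach.
    refine ⟨3 * α + b 1, by positivity, fun n hn => ?_⟩
    obtain rfl | ⟨m, rfl⟩ : n = 1 ∨ ∃ m, n = m + 2 :=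
      hn.eq_or_lt.imp Eq.symm fun h => ⟨n - 2, by lia⟩
    · simp only [Nat.cast_one, one_zpow, mul_one]; linarith
    · have h1 := h (m + 2) (by lia)
      have h2 := h (m + 1) (by lia)
      have h3 := mul_le_mul_of_nonneg_left (hpow m) hα.le
      have h4 : 0 ≤ (b 1 : ℝ) * ((m + 2 : ℕ) : ℝ) ^ ((c : ℤ) - 1) := by positivity
      rw [hab]
      push_cast at h1 h2 h3 h4 ⊢
      linarith
  · rintro ⟨α, hα, h⟩
    refine ⟨α + a 1, by positivity, fun n hn => ?_⟩
    obtain rfl | ⟨m, rfl⟩ : n = 1 ∨ ∃ m, n = m + 2 :=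
      hn.eq_or_lt.imp Eq.symm fun h => ⟨n - 2, by lia⟩
    · simp only [Nat.cast_one, one_zpow, mul_one]; linarith
    · have h1 := h (m + 2) (by lia)
      have h4 : 0 ≤ (a 1 : ℝ) * ((m + 2 : ℕ) : ℝ) ^ ((c : ℤ) - 1) := by positivity
      have h5 : 0 ≤ (a (m + 1) : ℝ) := by positivity
      rw [hab] at h1
      push_cast at h1 h4 ⊢
      linarith

/-- Eventually `a ≤ b`, which is one inequality. For the other, take `d` above the limsup for `a`.
If `d ≥ 1`, then `b n ≤ 2 d ^ n` eventually, and the `n`-th roots of `2` tend to `1`. If `d < 1`,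
the integers `a n` are eventually below `1`, so both sequences vanish eventually. -/
lemma limsup_rpow_eq (hab : ∀ n, b (n + 2) = a (n + 2) + a (n + 1)) :
    Filter.limsup (fun n : ℕ => (a n : ℝ≥0∞) ^ (1 / (n : ℝ))) Filter.atTop =
      Filter.limsup (fun n : ℕ => (b n : ℝ≥0∞) ^ (1 / (n : ℝ))) Filter.atTop := by
  have hab' : ∀ᶠ n : ℕ in Filter.atTop, b n = a n + a (n - 1) := by
    filter_upwards [Filter.eventually_ge_atTop 2] with n hn
    obtain ⟨m, rfl⟩ : ∃ m, n = m + 2 := ⟨n - 2, by lia⟩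
    exact hab m
  refine le_antisymm (Filter.limsup_le_limsup ?_) (le_of_forall_gt_imp_ge_of_dense fun d hd => ?_)
  · filter_upwards [hab'] with n hn
    exact ENNReal.rpow_le_rpow (by exact_mod_cast (by lia)) (by positivity)
  have hroot {c : ℕ → ℕ} {n : ℕ} (hn : 0 < n) (d : ℝ≥0∞) :
      (c n : ℝ≥0∞) ^ (1 / (n : ℝ)) ≤ d ↔ (c n : ℝ≥0∞) ≤ d ^ n := by
    rw [one_div, ENNReal.rpow_inv_le_iff (by exact_mod_cast hn), ENNReal.rpow_natCast]
  have ha : ∀ᶠ n : ℕ in Filter.atTop, (a n : ℝ≥0∞) ≤ d ^ n := by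
    filter_upwards [Filter.eventually_lt_of_limsup_lt hd, Filter.eventually_gt_atTop 0] with n h hn
    exact (hroot hn d).1 h.le
  have ha' : ∀ᶠ n : ℕ in Filter.atTop, (a (n - 1) : ℝ≥0∞) ≤ d ^ (n - 1) :=
    (Filter.tendsto_sub_atTop_nat 1).eventually ha
  obtain h1 | h1 := lt_or_ge d 1
  · refine Filter.limsup_le_of_le (by isBoundedDefault) ?_
    filter_upwards [ha, ha', hab', Filter.eventually_gt_atTop 1] with n h h' hn hn1
    have key {m k : ℕ} (hk : k ≠ 0) (h : (m : ℝ≥0∞) ≤ d ^ k) : m = 0 := by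
      have : (m : ℝ≥0∞) < 1 := h.trans_lt (pow_lt_one₀ zero_le h1 hk)
      exact Nat.lt_one_iff.1 (by exact_mod_cast this)
    rw [hroot (by lia), hn, key (by lia) h, key (by lia) h']
    simp
  · have hlim : Filter.Tendsto (fun n : ℕ => (2 : ℝ≥0∞) ^ (1 / (n : ℝ)) * d) Filter.atTop
        (nhds (1 * d)) := by
      refine ENNReal.Tendsto.mul_const ?_ (Or.inl one_ne_zero)
      have h2 : Filter.Tendsto (fun n : ℕ => ENNReal.ofReal ((2 : ℝ) ^ (1 / (n : ℝ)))) Filter.atTop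
          (nhds (ENNReal.ofReal ((2 : ℝ) ^ (0 : ℝ)))) :=
        ENNReal.tendsto_ofReal ((Real.continuous_const_rpow two_ne_zero).continuousAt.tendsto.comp
          tendsto_one_div_atTop_nhds_zero_nat)
      rw [Real.rpow_zero, ENNReal.ofReal_one] at h2
      refine h2.congr fun n => ?_
      rw [← ENNReal.ofReal_rpow_of_pos two_pos, ENNReal.ofReal_ofNat]
    rw [one_mul] at hlim
    rw [← hlim.limsup_eq]
    refine Filter.limsup_le_limsup ?_
    filter_upwards [ha, ha', hab', Filter.eventually_gt_atTop 0] with n h h' hn hn0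
    rw [hroot hn0, mul_pow, ← ENNReal.rpow_natCast (_ ^ _), ← ENNReal.rpow_mul, one_div,
      inv_mul_cancel₀ (by exact_mod_cast hn0.ne'), ENNReal.rpow_one, hn, two_mul]
    push_cast
    exact add_le_add h (h'.trans (pow_le_pow_right₀ h1 (Nat.sub_le n 1)))

lemma complexity_curvature_eq {R S : Type u} [CommRing R] [IsLocalRing R] [CommRing S]
    [IsLocalRing S] {M : ModuleCat.{u} R} {N : ModuleCat.{u} S}
    (h : ∀ n, betti N (n + 2) = betti M (n + 2) + betti M (n + 1)) :
    complexity M = complexity N ∧ curvature M = curvature N :=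
  ⟨iInf_congr fun c => iInf_congr_Prop (exists_growth_bound_iff h c) fun _ => rfl,
    limsup_rpow_eq h⟩

end Growth

end BurchExt


/-! ### Retractions with principal kernel and preimages of submodules -/

namespace BurchExt

section

variable {R S : Type u} [CommRing R] [CommRing S] [Algebra R S]

lemma nonempty_baseChange_equiv {x : R} (hS : Function.Surjective (algebraMap R S))
    (hx : RingHom.ker (algebraMap R S) = Ideal.span {x}) {T U : Type u} [AddCommGroup T]
    [Module R T] [AddCommGroup U] [Module S U] (π : T →ₛₗ[algebraMap R S] U)
    (hπ : Function.Surjective π) (hker : ∀ t, π t = 0 → ∃ t', t = x • t') :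
    Nonempty (S ⊗[R] T ≃ₗ[S] U) := by
  let : Module R U := Module.compHom U (algebraMap R S)
  have : IsScalarTower R S U := ⟨fun r s u => by
    rw [Algebra.smul_def, mul_smul]; rfl⟩
  let π' : T →ₗ[R] U := { π with map_smul' := π.map_smulₛₗ }
  refine ⟨LinearEquiv.ofBijective (π'.liftBaseChange S) ⟨?_, fun u => ?_⟩⟩
  · rw [injective_iff_map_eq_zero]
    intro z hz
    obtain ⟨t, rfl⟩ := TensorProduct.mk_surjective R T S hS z
    exact (one_tmul_eq_zero_iff hS hx t).2 (hker t (by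
      have : π' t = 0 := by simpa using hz
      exact this))
  · obtain ⟨t, rfl⟩ := hπ u
    exact ⟨1 ⊗ₜ t, by simp [π']⟩

end

/-- An `A`-algebra `B` with a retraction `B → A` whose kernel is generated by a regular element
`x`. -/
structure IsRetraction (A B : Type u) [CommRing A] [CommRing B] [Algebra A B] [Algebra B A]
    (x : B) : Prop where
  leftInverse : ∀ a : A, algebraMap B A (algebraMap A B a) = a
  ker : RingHom.ker (algebraMap B A) = Ideal.span {x}
  regular : IsSMulRegular B x

section Retraction

variable {A B : Type u} [CommRing A] [CommRing B] [Algebra A B] [Algebra B A] {x : B}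

namespace IsRetraction

variable (h : IsRetraction A B x)
include h

lemma surjective : Function.Surjective (algebraMap B A) := fun a => ⟨_, h.leftInverse a⟩

lemma map_self : algebraMap B A x = 0 := by
  rw [← RingHom.mem_ker, h.ker]; exact Ideal.mem_span_singleton_self x

lemma exists_eq_add (b : B) : ∃ c, b = algebraMap A B (algebraMap B A b) + x * c := by
  have : b - algebraMap A B (algebraMap B A b) ∈ RingHom.ker (algebraMap B A) := by
    rw [RingHom.mem_ker, map_sub, h.leftInverse, sub_self]
  rw [h.ker, Ideal.mem_span_singleton] at this
  obtain ⟨c, hc⟩ := this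
  exact ⟨c, by rw [← hc]; ring⟩

end IsRetraction

section Augmentation

variable (h : IsRetraction A B x) (N : Type u) [AddCommGroup N] [Module A N]

/-- The augmentation `B ⊗ N → N` of a retraction `B → A`. -/
noncomputable def aug : B ⊗[A] N →ₛₗ[algebraMap B A] N where
  toFun := TensorProduct.lift (LinearMap.mk₂ A (fun (b : B) (n : N) => algebraMap B A b • n)
    (fun b c n => by rw [map_add, add_smul])
    (fun a b n => by rw [Algebra.smul_def, map_mul, h.leftInverse, mul_smul])
    (fun b n n' => smul_add _ _ _) (fun a b n => smul_comm _ _ _))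
  map_add' := map_add _
  map_smul' b t := by
    induction t with
    | zero => simp
    | tmul c n => simp [TensorProduct.smul_tmul', mul_smul]
    | add t u ht hu => rw [smul_add, map_add, ht, hu, map_add, smul_add]

@[simp]
lemma aug_tmul (b : B) (n : N) : aug h N (b ⊗ₜ n) = algebraMap B A b • n := rfl

variable {N}

lemma aug_baseChange {L : Type u} [AddCommGroup L] [Module A L] (φ : L →ₗ[A] N) (t : B ⊗[A] L) :
    aug h N (φ.baseChange B t) = φ (aug h L t) := by
  induction t with
  | zero => simp
  | tmul c n => simp
  | add t u ht hu => simp only [map_add, ht, hu]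

lemma exists_eq_aug_add (t : B ⊗[A] N) : ∃ u, t = 1 ⊗ₜ aug h N t + x • u := by
  induction t with
  | zero => exact ⟨0, by simp⟩
  | tmul b n =>
    obtain ⟨c, hc⟩ := h.exists_eq_add b
    refine ⟨c ⊗ₜ n, ?_⟩
    rw [aug_tmul, ← TensorProduct.smul_tmul, Algebra.smul_def, mul_one, TensorProduct.smul_tmul',
      ← TensorProduct.add_tmul, smul_eq_mul, ← hc]
  | add t t' ht ht' =>
    obtain ⟨u, hu⟩ := ht
    obtain ⟨u', hu'⟩ := ht'
    refine ⟨u + u', ?_⟩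
    rw [map_add, TensorProduct.tmul_add, smul_add]
    nth_rw 1 [hu, hu']
    abel

lemma aug_smul_self (t : B ⊗[A] N) : aug h N (x • t) = 0 := by
  rw [LinearMap.map_smulₛₗ, h.map_self, zero_smul]

lemma aug_eq_zero_iff (t : B ⊗[A] N) : aug h N t = 0 ↔ ∃ u, t = x • u := by
  constructor
  · intro ht
    obtain ⟨u, hu⟩ := exists_eq_aug_add h t
    rw [ht, TensorProduct.tmul_zero, zero_add] at hu
    exact ⟨u, hu⟩
  · rintro ⟨u, rfl⟩
    exact aug_smul_self h u

lemma aug_surjective : Function.Surjective (aug h N) := fun n => ⟨1 ⊗ₜ n, by simp⟩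

include h in
variable (N) in
-- Multiplication by `x` on `B` has an `A`-linear left inverse (drop the constant term and divide by
-- `x`), so it stays injective after tensoring with any module, flat or not.
lemma IsRetraction.isSMulRegular_baseChange : IsSMulRegular (B ⊗[A] N) x := by
  let f : B →ₗ[A] B := LinearMap.mulLeft A x
  let g : B →ₗ[A] B := LinearMap.id - Algebra.linearMap A B ∘ₗ
    (⟨⟨algebraMap B A, map_add _⟩, fun a b => by
      simp [Algebra.smul_def, h.leftInverse]⟩ : B →ₗ[A] A)
  have hg (b : B) : g b ∈ LinearMap.range f := by
    obtain ⟨c, hc⟩ := h.exists_eq_add b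
    exact ⟨c, by simp [f, g]; rw [eq_comm, sub_eq_iff_eq_add']; exact hc⟩
  let e := LinearEquiv.ofInjective f h.regular
  let r : B →ₗ[A] B := e.symm.toLinearMap ∘ₗ g.codRestrict _ hg
  have hr : r ∘ₗ f = LinearMap.id := by
    ext b
    apply h.regular
    change f (e.symm _) = f b
    rw [show f (e.symm _) = _ from congrArg Subtype.val (e.apply_symm_apply _)]
    simp [f, g, h.map_self]
  intro t u htu
  have key (t : B ⊗[A] N) : r.rTensor N (x • t) = t := by
    have : x • t = f.rTensor N t := by
      induction t with
      | zero => simp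
      | tmul b n => simp [f, TensorProduct.smul_tmul']
      | add t u ht hu => rw [smul_add, ht, hu, map_add]
    rw [this, ← LinearMap.comp_apply, ← LinearMap.rTensor_comp, hr, LinearMap.rTensor_id,
      LinearMap.id_apply]
  rw [← key t, ← key u]
  exact congrArg _ htu

lemma ses_aug [Module B N] [IsScalarTower B A N] :
    SES (LinearMap.lsmul B (B ⊗[A] N) x)
      ({ aug h N with
        map_smul' := fun b t =>
          ((aug h N).map_smulₛₗ b t).trans (algebraMap_smul A b (aug h N t)) } : B ⊗[A] N →ₗ[B] N) where
  inj := h.isSMulRegular_baseChange N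
  exact t := (aug_eq_zero_iff h t).trans (exists_congr fun _ => eq_comm)
  surj := aug_surjective h

end Augmentation

section Pullback

variable (h : IsRetraction A B x) {L : Type u} [AddCommGroup L] [Module A L] (M : Submodule A L)

/-- The preimage of a submodule `M ⊆ L` under the augmentation `B ⊗ L → L`. -/
noncomputable def augComap : Submodule B (B ⊗[A] L) := M.comap (aug h L)

lemma mem_augComap {t : B ⊗[A] L} : t ∈ augComap h M ↔ aug h L t ∈ M := Iff.rfl

lemma exists_mkQ_eq_smul (t : augComap h M) :
    ∃ v, x • v = M.mkQ.baseChange B (t : B ⊗[A] L) := by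
  have : aug h _ (M.mkQ.baseChange B (t : B ⊗[A] L)) = 0 := by
    rw [aug_baseChange, Submodule.mkQ_apply, Submodule.Quotient.mk_eq_zero]
    exact t.2
  obtain ⟨v, hv⟩ := (aug_eq_zero_iff h _).1 this
  exact ⟨v, hv.symm⟩

/-- Division by `x` of the image in `B ⊗ L/M`. -/
noncomputable def augDiv : augComap h M →ₗ[B] B ⊗[A] (L ⧸ M) where
  toFun t := (exists_mkQ_eq_smul h M t).choose
  map_add' t u := h.isSMulRegular_baseChange _ (by
    refine (exists_mkQ_eq_smul h M (t + u)).choose_spec.trans ?_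
    simp only [smul_add]
    rw [(exists_mkQ_eq_smul h M t).choose_spec, (exists_mkQ_eq_smul h M u).choose_spec,
      Submodule.coe_add, map_add])
  map_smul' b t := h.isSMulRegular_baseChange _ (by
    refine (exists_mkQ_eq_smul h M (b • t)).choose_spec.trans ?_
    simp only [RingHom.id_apply, smul_comm x b]
    rw [(exists_mkQ_eq_smul h M t).choose_spec, Submodule.coe_smul, map_smul])

lemma smul_augDiv (t : augComap h M) :
    x • augDiv h M t = M.mkQ.baseChange B (t : B ⊗[A] L) :=
  (exists_mkQ_eq_smul h M t).choose_spec

/-- The map `B ⊗ M → B ⊗ L` with values in the preimage of `M`. -/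
noncomputable def augIncl : B ⊗[A] M →ₗ[B] augComap h M :=
  (M.subtype.baseChange B).codRestrict _ fun t => by
    rw [mem_augComap, aug_baseChange]
    exact (aug h M t).2

/-- The quotient map is division by `x`, not the plain projection to `B ⊗ (L/M)`, whose image is
only the multiples of `x`. Flatness serves only for injectivity on the left. -/
lemma ses_augComap [Module.Flat A B] : 
    SES (R := B) (A := B ⊗[A] M) (B := augComap h M) (C := B ⊗[A] (L ⧸ M)) (augIncl h M)
      (augDiv h M) where
  inj a b hab := (Module.Flat.lTensor_preserves_injective_linearMap (M := B) _
    M.subtype_injective) (congrArg Subtype.val hab)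
  exact t := by
    have : augDiv h M t = 0 ↔ M.mkQ.baseChange B (t : B ⊗[A] L) = 0 := by
      rw [← smul_augDiv]
      exact ⟨fun h => by rw [h, smul_zero], fun h' => h.isSMulRegular_baseChange _ (by
        simpa using h')⟩
    rw [this]
    refine ((lTensor_exact B (LinearMap.exact_subtype_mkQ M) M.mkQ_surjective) _).trans ?_
    exact ⟨fun ⟨y, hy⟩ => ⟨y, Subtype.ext hy⟩, fun ⟨y, hy⟩ => ⟨y, congrArg Subtype.val hy⟩⟩
  surj v := by
    obtain ⟨l, rfl⟩ := LinearMap.lTensor_surjective B M.mkQ_surjective v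
    refine ⟨⟨x • l, ?_⟩, h.isSMulRegular_baseChange _ ?_⟩
    · rw [mem_augComap, aug_smul_self]; exact M.zero_mem
    · simp only [smul_augDiv, map_smul]; rfl

/-- The reduction of the preimage of `M` modulo `x`. -/
noncomputable def augRed : augComap h M →ₛₗ[algebraMap B A] M × (L ⧸ M) where
  toFun t := (⟨aug h L t, t.2⟩, aug h _ (augDiv h M t))
  map_add' t u := by ext <;> simp
  map_smul' b t := by ext <;> simp [LinearMap.map_smulₛₗ]

lemma augRed_surjective : Function.Surjective (augRed h M) := by
  rintro ⟨m, n⟩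
  obtain ⟨l, rfl⟩ := M.mkQ_surjective n
  have ht : aug h L (1 ⊗ₜ (m : L) + x • 1 ⊗ₜ l) = m := by
    rw [map_add, aug_smul_self, aug_tmul, map_one, one_smul, add_zero]
  refine ⟨⟨1 ⊗ₜ (m : L) + x • 1 ⊗ₜ l, by rw [mem_augComap, ht]; exact m.2⟩,
    Prod.ext (Subtype.ext ht) ?_⟩
  have : augDiv h M ⟨1 ⊗ₜ (m : L) + x • 1 ⊗ₜ l, by rw [mem_augComap, ht]; exact m.2⟩ =
      1 ⊗ₜ M.mkQ l := h.isSMulRegular_baseChange _ (by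
    have : M.mkQ (m : L) = 0 := by simp
    simp only [smul_augDiv, map_add, LinearMap.baseChange_tmul, map_smul, this,
      TensorProduct.tmul_zero, zero_add])
  change aug h _ (augDiv h M _) = _
  rw [this, aug_tmul, map_one, one_smul]

/-- Vanishing of the first component gives `t = x • u` with `u` in `B ⊗ L`. The second component is
then the class of the augmentation of `u`, and its vanishing puts `u` in the preimage of `M`. -/
lemma augRed_eq_zero_iff (t : augComap h M) : augRed h M t = 0 ↔ ∃ u, t = x • u := by
  constructor
  · intro ht
    obtain ⟨u, hu⟩ := (aug_eq_zero_iff h (t : B ⊗[A] L)).1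
      (congrArg (fun z => (z.1 : L)) ht)
    have h1 : augDiv h M t = M.mkQ.baseChange B u := h.isSMulRegular_baseChange _ (by
      simp only [smul_augDiv, hu, map_smul])
    have h2 : aug h _ (augDiv h M t) = 0 := congrArg Prod.snd ht
    rw [h1, aug_baseChange, Submodule.mkQ_apply, Submodule.Quotient.mk_eq_zero] at h2
    exact ⟨⟨u, h2⟩, Subtype.ext hu⟩
  · rintro ⟨u, rfl⟩
    rw [LinearMap.map_smulₛₗ, h.map_self, zero_smul]

lemma nonempty_augComap_baseChange_equiv : Nonempty (A ⊗[B] augComap h M ≃ₗ[A] M × (L ⧸ M)) :=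
  nonempty_baseChange_equiv h.surjective h.ker (augRed h M) (augRed_surjective h M)
    fun t => (augRed_eq_zero_iff h M t).1

lemma exists_quotSMulTop_augComap_equiv :
    ∃ e : QuotSMulTop x (augComap h M) ≃+ M × (L ⧸ M), ∀ (a : A) z,
      e (algebraMap A B a • z) = a • e z := by
  let : Module B (M × (L ⧸ M)) := Module.compHom _ (algebraMap B A)
  let π : augComap h M →ₗ[B] M × (L ⧸ M) :=
    { augRed h M with map_smul' := (augRed h M).map_smulₛₗ }
  have hker : x • (⊤ : Submodule B (augComap h M)) = LinearMap.ker π := by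
    ext t
    rw [LinearMap.mem_ker, Submodule.mem_smul_pointwise_iff_exists]
    refine Iff.trans ⟨?_, ?_⟩ (augRed_eq_zero_iff h M t).symm
    · rintro ⟨u, -, rfl⟩; exact ⟨u, rfl⟩
    · rintro ⟨u, rfl⟩; exact ⟨u, trivial, rfl⟩
  let e : QuotSMulTop x (augComap h M) ≃ₗ[B] M × (L ⧸ M) :=
    (Submodule.quotEquivOfEq _ _ hker).trans
      (π.quotKerEquivOfSurjective (augRed_surjective h M))
  refine ⟨e.toAddEquiv, fun a z => (map_smul e _ z).trans ?_⟩
  change algebraMap B A (algebraMap A B a) • e z = _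
  rw [h.leftInverse]
  rfl

/-- For free `L` this presents the preimage as a first syzygy over `B` of `L/M`, with `x` acting as
zero on the latter. -/
lemma ses_augComap_subtype [Module B (L ⧸ M)] [IsScalarTower B A (L ⧸ M)] :
    SES (R := B) (A := augComap h M) (B := B ⊗[A] L) (C := L ⧸ M) (augComap h M).subtype
      ({ toFun := fun t => M.mkQ (aug h L t)
         map_add' := by simp
         map_smul' := fun b t =>
          (congrArg M.mkQ ((aug h L).map_smulₛₗ b t)).trans ((map_smul M.mkQ _ _).trans
            (algebraMap_smul A b (M.mkQ (aug h L t)))) } : B ⊗[A] L →ₗ[B] L ⧸ M) where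
  inj := Submodule.subtype_injective _
  exact t := by
    change M.mkQ (aug h L t) = 0 ↔ _
    rw [Submodule.mkQ_apply, Submodule.Quotient.mk_eq_zero, ← mem_augComap]
    simp
  surj := M.mkQ_surjective.comp (aug_surjective h)

end Pullback

end Retraction

end BurchExt


namespace BurchExt

/-! ### The localized polynomial ring and module as a retraction -/

section RingS

variable (R : Type u) [CommRing R] [IsLocalRing R]

lemma mem_primeCompl_iff {f : R[X]} : f ∈ (idealMX R).primeCompl ↔ IsUnit (f.coeff 0) := by
  rw [Ideal.mem_primeCompl_iff, idealMX_eq_comap, Ideal.mem_comap, Polynomial.constantCoeff_apply,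
    mem_maximalIdeal, mem_nonunits_iff, not_not]

/-- Evaluation at `X = 0`. -/
noncomputable def evalS : ringS R →+* R :=
  IsLocalization.lift (M := (idealMX R).primeCompl) (g := Polynomial.constantCoeff)
    fun y => (mem_primeCompl_iff R).1 y.2

noncomputable instance : Algebra (ringS R) R := (evalS R).toAlgebra

@[simp]
lemma algebraMap_ringS_algebraMap (f : R[X]) :
    algebraMap (ringS R) R (algebraMap R[X] (ringS R) f) = f.coeff 0 :=
  IsLocalization.lift_eq _ _

lemma isSMulRegular_X : IsSMulRegular R[X] (Polynomial.X : R[X]) := fun f g h => by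
  ext n
  have := congrArg (fun p => Polynomial.coeff p (n + 1)) h
  simpa using this

/-- Evaluation at `X = 0` is a retraction of `S` onto `R` with kernel generated by `X`. -/
lemma isRetraction : IsRetraction R (ringS R) (varS R) where
  leftInverse a := by
    rw [IsScalarTower.algebraMap_apply R R[X] (ringS R), algebraMap_ringS_algebraMap,
      Polynomial.algebraMap_eq, Polynomial.coeff_C_zero]
  ker := by
    ext s
    rw [RingHom.mem_ker, Ideal.mem_span_singleton]
    constructor
    · intro hs
      obtain ⟨f, g, rfl⟩ := IsLocalization.exists_mk'_eq (idealMX R).primeCompl s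
      have hf : f.coeff 0 = 0 := by
        rw [← algebraMap_ringS_algebraMap, ← IsLocalization.mk'_spec (ringS R) f g, map_mul, hs,
          zero_mul]
      rw [← Polynomial.X_mul_divX_add f, hf, map_zero, add_zero, IsLocalization.mk'_eq_mul_mk'_one,
        map_mul, mul_assoc]
      exact dvd_mul_right _ _
    · rintro ⟨t, rfl⟩
      rw [map_mul, varS, algebraMap_ringS_algebraMap, Polynomial.coeff_X_zero, zero_mul]
  regular := (isSMulRegular_X R).of_flat

instance : Module.Flat R (ringS R) := Module.Flat.trans R R[X] (ringS R)

instance : IsLocalHom (algebraMap (ringS R) R) :=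
  .of_surjective _ (isRetraction R).surjective

instance : IsLocalHom (algebraMap R (ringS R)) where
  map_nonunit a ha := by
    have := ha.map (algebraMap (ringS R) R)
    rwa [(isRetraction R).leftInverse] at this

end RingS

section ExtModule

variable {R : Type u} [CommRing R] [IsLocalRing R] {L : Type u} [AddCommGroup L] [Module R L]

variable (R L) in
/-- The module `L'` is the base change of `L`. -/
noncomputable def extModuleEquiv : extModule R L ≃ₗ[ringS R] ringS R ⊗[R] L :=
  (LocalizedModule.equivTensorProduct (idealMX R).primeCompl (PolynomialModule R L)).trans
    ((LinearEquiv.baseChange R[X] (ringS R) _ _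
      (PolynomialModule.polynomialTensorProductLEquivPolynomialModule R L).symm).trans
      (TensorProduct.AlgebraTensorModule.cancelBaseChange R R[X] (ringS R) (ringS R) L))

lemma aug_extModuleEquiv_mk_one (f : PolynomialModule R L) :
    aug (isRetraction R) L (extModuleEquiv R L (LocalizedModule.mk f 1)) = f.coeff 0 := by
  obtain ⟨z, rfl⟩ := (PolynomialModule.polynomialTensorProductLEquivPolynomialModule R L).surjective f
  have : extModuleEquiv R L (LocalizedModule.mk
      (PolynomialModule.polynomialTensorProductLEquivPolynomialModule R L z) 1) =
    TensorProduct.AlgebraTensorModule.cancelBaseChange R R[X] (ringS R) (ringS R) L (1 ⊗ₜ z) := by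
    simp [extModuleEquiv, LinearEquiv.baseChange, Localization.mk_one]
  rw [this]
  clear this
  induction z with
  | zero => simp
  | tmul p l =>
    rw [TensorProduct.AlgebraTensorModule.cancelBaseChange_tmul, aug_tmul]
    simp [PolynomialModule.polynomialTensorProductLEquivPolynomialModule, Algebra.smul_def]
    exact ((PolynomialModule.smul_single_apply 0 p l 0).trans (by simp)).symm
  | add a b ha hb =>
    rw [TensorProduct.tmul_add, map_add, map_add, ha, hb, map_add]
    rfl

lemma aug_extModuleEquiv_mk (f : PolynomialModule R L) (s : (idealMX R).primeCompl) :
    (s : R[X]).coeff 0 • aug (isRetraction R) L (extModuleEquiv R L (LocalizedModule.mk f s)) =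
      f.coeff 0 := by
  rw [← algebraMap_ringS_algebraMap, ← LinearMap.map_smulₛₗ, ← map_smul, ← aug_extModuleEquiv_mk_one]
  congr 2
  rw [algebraMap_smul, LocalizedModule.smul'_mk, ← Submonoid.smul_def, LocalizedModule.mk_cancel]

/-- Denominators have unit constant term, so the augmentation of a fraction is the constant
coefficient of its numerator up to a unit. -/
lemma mem_extSubmodule_iff (M : Submodule R L) (z : extModule R L) :
    z ∈ extSubmodule M ↔ extModuleEquiv R L z ∈ augComap (isRetraction R) M := by
  rw [mem_augComap]
  constructor
  · intro hz
    obtain ⟨m, hm, s, rfl⟩ := (Submodule.mem_localized' ..).1 hz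
    rw [← IsLocalizedModule.mk_eq_mk']
    have h1 := aug_extModuleEquiv_mk m s
    have h2 := (mem_primeCompl_iff R).1 s.2
    rw [← h2.unit_spec] at h1
    have h3 := congrArg (fun y => (h2.unit⁻¹ : Rˣ) • y) h1
    rw [← Units.smul_def, inv_smul_smul] at h3
    rw [h3]
    exact M.smul_mem _ hm
  · intro hz
    induction z using LocalizedModule.induction_on with
    | _ f s =>
      refine (Submodule.mem_localized' ..).2 ⟨f, ?_, s, (IsLocalizedModule.mk_eq_mk' ..).symm⟩
      change f.coeff 0 ∈ M
      rw [← aug_extModuleEquiv_mk f s]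
      exact M.smul_mem _ hz

/-- The submodule `M'` of `L'` is the preimage of `M` under the augmentation. -/
noncomputable def extSubmoduleEquiv (M : Submodule R L) :
    extSubmodule M ≃ₗ[ringS R] augComap (isRetraction R) M :=
  (extModuleEquiv R L).ofSubmodules _ _ (by
    ext t
    obtain ⟨z, rfl⟩ := (extModuleEquiv R L).surjective t
    rw [← mem_extSubmodule_iff]
    simp)

end ExtModule

end BurchExt


namespace BurchExt

/-! ### The Burch property of the extended submodule -/

section Comparison

variable {R : Type u} [CommRing R] [IsLocalRing R] {L : Type u} [AddCommGroup L] [Module R L]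
  (M : Submodule R L)

/-- The augmentation `π` is onto, `M'` is its preimage of `M`, and maximal ideals correspond. Lifts
of `(M : 𝔪)` lie in the colon of `M'`, and `π` sends `𝔫 M'` into `𝔪 M`, where `𝔫` is the maximal
ideal of `S`. Equality upstairs would therefore give equality downstairs. -/
lemma isBurch_extSubmodule (hM : IsBurch M) : IsBurch (extSubmodule M) := by
  let π : extModule R L →ₛₗ[algebraMap (ringS R) R] L :=
    (aug (isRetraction R) L).comp (extModuleEquiv R L).toLinearMap
  have hπ (z : extModule R L) : z ∈ extSubmodule M ↔ π z ∈ M := mem_extSubmodule_iff M z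
  have hsurj : Function.Surjective π :=
    (aug_surjective (isRetraction R)).comp (extModuleEquiv R L).surjective
  have hmax {s : ringS R} (hs : s ∈ maximalIdeal (ringS R)) :
      algebraMap (ringS R) R s ∈ maximalIdeal R := map_nonunit (algebraMap (ringS R) R) s hs
  intro heq
  refine hM (le_antisymm (Submodule.smul_le.2 fun a ha z hz => ?_)
    (Submodule.smul_mono le_rfl fun m hm a _ => M.smul_mem a hm))
  obtain ⟨z, rfl⟩ := hsurj z
  have hz' : z ∈ colonSubmodule (extSubmodule M) (maximalIdeal (ringS R)) := fun s hs => by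
    rw [hπ, LinearMap.map_smulₛₗ]
    exact hz _ (hmax hs)
  have ha' : algebraMap R (ringS R) a ∈ maximalIdeal (ringS R) :=
    map_nonunit (algebraMap R (ringS R)) a ha
  have h1 : algebraMap R (ringS R) a • z ∈ maximalIdeal (ringS R) • extSubmodule M :=
    heq ▸ Submodule.smul_mem_smul ha' hz'
  have h2 : maximalIdeal (ringS R) • extSubmodule M ≤ (maximalIdeal R • M).comap π :=
    Submodule.smul_le.2 fun s hs y hy => by
      rw [Submodule.mem_comap, LinearMap.map_smulₛₗ]
      exact Submodule.smul_mem_smul (hmax hs) ((hπ y).1 hy)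
  have h3 := h2 h1
  rwa [Submodule.mem_comap, LinearMap.map_smulₛₗ, (isRetraction R).leftInverse] at h3

/-- This is all that the dimension statements use of the Burch condition. For `M = L` the module
`L/M` has projective dimension `-∞`, unlike `L'` for `L` free and nonzero. -/
lemma IsBurch.nontrivial_quotient {M : Submodule R L} (hM : IsBurch M) : Nontrivial (L ⧸ M) := by
  rw [Submodule.Quotient.nontrivial_iff]
  rintro rfl
  refine hM ?_
  congr 1
  exact eq_top_iff.2 fun _ _ _ _ => trivial

end Comparison

/-! ### Projective dimension, G-dimension and Betti numbers of the preimage -/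

section ProjectiveDimension

lemma ses_subtype_mkQ {R : Type u} [CommRing R] {L : Type u} [AddCommGroup L] [Module R L]
    (M : Submodule R L) : SES M.subtype M.mkQ :=
  ⟨M.subtype_injective, LinearMap.exact_subtype_mkQ M, M.mkQ_surjective⟩

variable {R S : Type u} [CommRing R] [CommRing S] {A B : Type u} [AddCommGroup A] [Module R A]

lemma hasProjectiveDimensionLT_zero_iff :
    HasProjectiveDimensionLT (ModuleCat.of R A) 0 ↔ Subsingleton A := by
  rw [hasProjectiveDimensionLT_zero_iff_isZero, ModuleCat.isZero_iff_subsingleton]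

lemma projectiveDimension_congr_of_forall [AddCommGroup B] [Module S B] [Nontrivial A]
    [Nontrivial B] (h : ∀ n : ℕ, HasProjectiveDimensionLE (ModuleCat.of R A) n ↔
      HasProjectiveDimensionLE (ModuleCat.of S B) n) :
    projectiveDimension (ModuleCat.of R A) = projectiveDimension (ModuleCat.of S B) := by
  have h' (n : ℕ) : HasProjectiveDimensionLT (ModuleCat.of R A) n ↔
      HasProjectiveDimensionLT (ModuleCat.of S B) n := by
    cases n with
    | zero => simp [hasProjectiveDimensionLT_zero_iff, not_subsingleton]
    | succ n => exact h n
  simp only [projectiveDimension, h']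

lemma projectiveDimension_congr [AddCommGroup B] [Module R B] (e : A ≃ₗ[R] B) :
    projectiveDimension (ModuleCat.of R A) = projectiveDimension (ModuleCat.of R B) :=
  projectiveDimension_eq_of_iso e.toModuleIso

lemma hasProjectiveDimensionLE_of_prod [AddCommGroup B] [Module R B] {n : ℕ}
    (h : HasProjectiveDimensionLE (ModuleCat.of R (A × B)) n) :
    HasProjectiveDimensionLE (ModuleCat.of R B) n := by
  let r : Retract (ModuleCat.of R B) (ModuleCat.of R (A × B)) :=
    { i := ModuleCat.ofHom (LinearMap.inr R A B)
      r := ModuleCat.ofHom (LinearMap.snd R A B)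
      retract := by rw [← ModuleCat.ofHom_comp, LinearMap.snd_comp_inr]; rfl }
  exact r.hasProjectiveDimensionLT _

lemma hasProjectiveDimensionLE_of_projective [Module.Projective R A] (n : ℕ) :
    HasProjectiveDimensionLE (ModuleCat.of R A) n := by
  have : HasProjectiveDimensionLT (ModuleCat.of R A) 1 :=
    projective_iff_hasProjectiveDimensionLT_one.1 ((IsProjective.iff_projective _).1 inferInstance)
  exact hasProjectiveDimensionLT_of_ge _ 1 _ (by lia)

lemma HasProjectiveDimensionLE.succ {n : ℕ} (h : HasProjectiveDimensionLE (ModuleCat.of R A) n) :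
    HasProjectiveDimensionLE (ModuleCat.of R A) (n + 1) :=
  have : HasProjectiveDimensionLT (ModuleCat.of R A) (n + 1) := h
  hasProjectiveDimensionLT_of_ge _ (n + 1) _ (by lia)

end ProjectiveDimension

section Abstract

variable {R S : Type u} [CommRing R] [CommRing S] [Algebra R S] [Algebra S R] {x : S}
  (h : IsRetraction R S x) {L : Type u} [AddCommGroup L] [Module R L] (M : Submodule R L)

lemma exists_quotSMulTop_equiv {T : Type u} [AddCommGroup T] [Module S T]
    (e : T ≃ₗ[S] augComap h M) :
    ∃ e : QuotSMulTop x T ≃+ M × (L ⧸ M), ∀ (r : R) (z : QuotSMulTop x T),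
      e (algebraMap R S r • z) = r • e z := by
  obtain ⟨e₁, he₁⟩ := exists_quotSMulTop_augComap_equiv h M
  let e' := QuotSMulTop.congr (M'' := augComap h M) x e
  refine ⟨e'.toAddEquiv.trans e₁, fun r z => ?_⟩
  change e₁ (e' _) = r • e₁ (e' z)
  rw [map_smul, he₁]

lemma nontrivial_augComap [Nontrivial (L ⧸ M)] : Nontrivial (augComap h M) := by
  obtain ⟨n, hn⟩ := exists_ne (0 : L ⧸ M)
  obtain ⟨t, ht⟩ := augRed_surjective h M (0, n)
  refine ⟨t, 0, ?_⟩
  rintro rfl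
  rw [map_zero] at ht
  exact hn (congrArg Prod.snd ht).symm

lemma isSMulRegular_augComap : IsSMulRegular (augComap h M) x :=
  (h.isSMulRegular_baseChange L).of_injective (augComap h M).subtype
    (Submodule.subtype_injective _)

/-- Base change along a retraction `S → R`. -/
abbrev IsRetraction.evalClass : BaseChangeClass S R :=
  regularClass S R x h.surjective h.ker h.regular

/-- Upwards, the preimage is an extension of `S ⊗ (L/M)` by `S ⊗ M`, and `M` inherits the bound from
`L/M` because `L` is free. Downwards, reduce modulo the regular element `x` and take the direct
summand `L/M`. -/
lemma hasProjectiveDimensionLE_augComap_iff [Module.Flat R S] [Module.Free R L] (n : ℕ) :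
    HasProjectiveDimensionLE (ModuleCat.of R (L ⧸ M)) n ↔
      HasProjectiveDimensionLE (ModuleCat.of S (augComap h M)) n := by
  constructor
  · intro hN
    have hM : HasProjectiveDimensionLE (ModuleCat.of R M) n :=
      (ses_subtype_mkQ M).shortExact.hasProjectiveDimensionLT_X₁ (n + 1)
        (hasProjectiveDimensionLE_of_projective n) (HasProjectiveDimensionLE.succ hN)
    have h1 := (flatClass R S).hasProjectiveDimensionLE trivial hM
    have h2 := (flatClass R S).hasProjectiveDimensionLE trivial hN
    exact (ses_augComap h M).shortExact.hasProjectiveDimensionLT_X₂ (n + 1) h1 h2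
  · intro hT
    have h1 := h.evalClass.hasProjectiveDimensionLE (T := augComap h M) (isSMulRegular_augComap h M) hT
    obtain ⟨e⟩ := nonempty_augComap_baseChange_equiv h M
    refine hasProjectiveDimensionLE_of_prod (A := M) ?_
    rw [← projectiveDimension_le_iff] at h1 ⊢
    rwa [← projectiveDimension_congr e]

variable [IsNoetherianRing R] [IsNoetherianRing S]

lemma hasGRes_augComap_iff [Module.Flat R S] [Module.Finite R L] [Module.Free R L] (n : ℕ) :
    HasGRes R n (L ⧸ M) ↔ HasGRes S n (augComap h M) := by
  constructor
  · intro hN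
    have hL : HasGRes R n L := HasGRes.mono (Nat.zero_le n) GProj.of_projective
    have hM : HasGRes R n M := (ses_subtype_mkQ M).hasGRes_left hL hN.succ
    exact (ses_augComap h M).hasGRes_mid
      (flatClass_preservesGProj.hasGRes hM trivial) (flatClass_preservesGProj.hasGRes hN trivial)
  · intro hT
    have h1 := (regularClass_preservesGProj h.surjective h.ker h.regular).hasGRes hT
      (isSMulRegular_augComap h M)
    obtain ⟨e⟩ := nonempty_augComap_baseChange_equiv h M
    exact ((h1.congr e).congr (LinearEquiv.prodComm R _ _)).of_prod

variable [IsLocalRing R] [IsLocalRing S] [IsLocalHom (algebraMap S R)]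

include h in
lemma IsRetraction.residueField_bijective :
    Function.Bijective (algebraMap (ResidueField S) (ResidueField R)) := by
  refine ⟨RingHom.injective _, fun y => ?_⟩
  obtain ⟨r, rfl⟩ := residue_surjective y
  obtain ⟨s, rfl⟩ := h.surjective r
  exact ⟨residue _ s, rfl⟩

lemma betti_augComap [Module.Finite R L] (n : ℕ) :
    betti (ModuleCat.of S (augComap h M)) n =
      betti (ModuleCat.of R M) n + betti (ModuleCat.of R (L ⧸ M)) n := by
  obtain ⟨e⟩ := nonempty_augComap_baseChange_equiv h M
  have hT : h.evalClass.Good (augComap h M) := isSMulRegular_augComap h M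
  rw [← betti_baseChange h.residueField_bijective h.evalClass hT, betti_congr e, betti_prod]

lemma complexity_curvature_augComap [Module.Finite R L] [Module.Free R L] {T : Type u}
    [AddCommGroup T] [Module S T] (e : T ≃ₗ[S] augComap h M) :
    complexity (ModuleCat.of R M) = complexity (ModuleCat.of S T) ∧
      curvature (ModuleCat.of R M) = curvature (ModuleCat.of S T) :=
  complexity_curvature_eq fun n => by
    rw [betti_congr (B := augComap h M) e, betti_augComap, (ses_subtype_mkQ M).betti_succ]

-- For `M = 𝔪` in `L = R`, the preimage is a first syzygy over `S` of the residue field, so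
-- `β_{n+2}` over `S` is `β_{n+2} + β_{n+1}` over `R`.
include h in
lemma complexity_curvature_residueField [Module.Flat R S] :
    complexity (ModuleCat.of R (ResidueField R)) = complexity (ModuleCat.of S (ResidueField S)) ∧
      curvature (ModuleCat.of R (ResidueField R)) = curvature (ModuleCat.of S (ResidueField S)) :=
  complexity_curvature_eq fun n => by
    let e : ResidueField S ≃ₗ[S] R ⧸ maximalIdeal R :=
      LinearEquiv.ofBijective (IsScalarTower.toAlgHom S (ResidueField S)
        (ResidueField R)).toLinearMap h.residueField_bijective
    rw [betti_congr e, (ses_augComap_subtype h (maximalIdeal R)).betti_succ,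
      betti_augComap, ← (ses_subtype_mkQ (maximalIdeal R)).betti_succ, add_comm]
    exact add_comm _ _

lemma gDim_augComap [Module.Flat R S] [Module.Finite R L] [Module.Free R L] {T : Type u}
    [AddCommGroup T] [Module S T] (e : T ≃ₗ[S] augComap h M) :
    gDim (ModuleCat.of R (L ⧸ M)) = gDim (ModuleCat.of S T) := by
  rw [gDim_congr (A := T) (B := augComap h M) e]
  exact iInf_congr fun n => iInf_congr_Prop (hasGRes_augComap_iff h M n) fun _ => rfl

lemma projectiveDimension_augComap [Module.Flat R S] [Module.Free R L] [Nontrivial (L ⧸ M)]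
    {T : Type u} [AddCommGroup T] [Module S T] (e : T ≃ₗ[S] augComap h M) :
    projectiveDimension (ModuleCat.of R (L ⧸ M)) = projectiveDimension (ModuleCat.of S T) := by
  have := nontrivial_augComap h M
  rw [projectiveDimension_congr (A := T) (B := augComap h M) e]
  exact projectiveDimension_congr_of_forall (hasProjectiveDimensionLE_augComap_iff h M)

end Abstract

end BurchExt


namespace BurchExt

lemma withBot_enat_add_one_inj (a b : WithBot ℕ∞) : a + 1 = b + 1 ↔ a = b := by
  refine ⟨fun h => ?_, fun h => h ▸ rfl⟩
  induction a with
  | bot => induction b with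
    | bot => rfl
    | coe b => exact absurd h (by rw [WithBot.bot_add]; exact WithBot.bot_ne_coe)
  | coe a => induction b with
    | bot => exact absurd h (by rw [WithBot.bot_add]; exact WithBot.coe_ne_bot)
    | coe b =>
      exact congrArg _ (WithTop.add_right_cancel (z := (1 : ℕ∞)) ENat.one_ne_top
        (WithBot.coe_injective h))

/-! ### Regularity: embedding dimension and Krull dimension -/

section Regular

/-- `Hom(N, k)` is the `k`-dual of `k ⊗ N`, whose dimension is the minimal number of generators. -/
lemma betti_zero {R : Type u} [CommRing R] [IsLocalRing R] {L : Type u} [AddCommGroup L]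
    [Module R L] (N : Submodule R L) (hN : N.FG) : betti (ModuleCat.of R N) 0 = N.spanFinrank := by
  have : Module.Finite R N := Module.Finite.iff_fg.2 hN
  let e₁ : Ext (ModuleCat.of R N) (ModuleCat.of R (ResidueField R)) 0 ≃ₗ[R] (N →ₗ[R] ResidueField R) :=
    Ext.linearEquiv₀.trans ModuleCat.homLinearEquiv
  let e₂ : Ext (ModuleCat.of R N) (ModuleCat.of R (ResidueField R)) 0 ≃ₗ[ResidueField R]
      (N →ₗ[R] ResidueField R) := e₁.extendScalarsOfSurjective residue_surjective
  rw [betti, (e₂.trans (LinearMap.liftBaseChangeEquiv (ResidueField R))).finrank_eq,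
    ← TensorProduct.spanFinrank_top_eq_of_residueField N hN,
    ← Module.finrank_eq_spanFinrank_of_free]
  exact Subspace.dual_finrank_eq

variable {R S : Type u} [CommRing R] [CommRing S] [Algebra R S] [Algebra S R] {x : S}
  (h : IsRetraction R S x)

lemma aug_self_eq (t : S ⊗[R] R) :
    aug h R t = algebraMap S R (TensorProduct.AlgebraTensorModule.rid R S S t) := by
  induction t with
  | zero => simp
  | tmul s r => simp [Algebra.smul_def, h.leftInverse, mul_comm]
  | add a b ha hb => simp only [map_add, ha, hb]

variable [IsLocalRing R] [IsLocalRing S] [IsLocalHom (algebraMap S R)]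

/-- The maximal ideal of `S` is the preimage of that of `R`. -/
noncomputable def maximalIdealEquiv :
    augComap h (maximalIdeal R) ≃ₗ[S] maximalIdeal S :=
  (TensorProduct.AlgebraTensorModule.rid R S S).ofSubmodules _ _ (by
    ext s
    obtain ⟨t, rfl⟩ := (TensorProduct.AlgebraTensorModule.rid R S S).surjective s
    have : TensorProduct.AlgebraTensorModule.rid R S S t ∈ maximalIdeal S ↔
        t ∈ augComap h (maximalIdeal R) := by
      rw [mem_augComap, aug_self_eq]
      exact (map_mem_nonunits_iff (algebraMap S R) _).symm
    rw [this]
    simp)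

variable [IsNoetherianRing R] [IsNoetherianRing S]

include h

lemma IsRetraction.mem_maximalIdeal : x ∈ maximalIdeal S := by
  have : algebraMap S R x ∈ maximalIdeal R := h.map_self ▸ zero_mem _
  exact (map_mem_nonunits_iff (algebraMap S R) _).1 this

/-- The maximal ideal of `S` is the preimage of `𝔪`, so its zeroth Betti number is the sum of those
of `𝔪` and of `k`, the latter being `1`. -/
lemma spanFinrank_maximalIdeal_eq_add_one :
    (maximalIdeal S).spanFinrank = (maximalIdeal R).spanFinrank + 1 := by
  have h1 : betti (ModuleCat.of R (R ⧸ maximalIdeal R)) 0 = 1 := by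
    rw [← betti_congr (Submodule.topEquiv (R := R) (M := R ⧸ maximalIdeal R)),
      betti_zero _ Module.Finite.fg_top]
    have : (⊤ : Submodule R (R ⧸ maximalIdeal R)) = Submodule.span R {1} := by
      refine (Submodule.eq_top_iff'.2 fun y => ?_).symm
      obtain ⟨r, rfl⟩ := Ideal.Quotient.mk_surjective y
      exact Submodule.mem_span_singleton.2 ⟨r, by rw [Algebra.smul_def, mul_one]; rfl⟩
    rw [this, Submodule.spanFinrank_singleton one_ne_zero]
  rw [← betti_zero _ (maximalIdeal S).fg_of_isNoetherianRing,
    ← betti_congr (A := augComap h (maximalIdeal R)) (maximalIdealEquiv h),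
    betti_augComap, h1, betti_zero _ (maximalIdeal R).fg_of_isNoetherianRing]

lemma ringKrullDim_eq_add_one : ringKrullDim S = ringKrullDim R + 1 := by
  rw [← ringKrullDim_quotient_span_singleton_succ_eq_ringKrullDim h.regular h.mem_maximalIdeal,
    ← h.ker, ringKrullDim_eq_of_ringEquiv (RingHom.quotientKerEquivOfSurjective h.surjective)]

lemma isRegularLocalRing_iff_of_isRetraction : IsRegularLocalRing R ↔ IsRegularLocalRing S := by
  rw [isRegularLocalRing_iff, isRegularLocalRing_iff, spanFinrank_maximalIdeal_eq_add_one h,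
    ringKrullDim_eq_add_one h, Nat.cast_add, Nat.cast_one]
  exact (withBot_enat_add_one_inj _ _).symm

end Regular

end BurchExt


namespace BurchExt

/-! ### Injective dimension through vanishing of Ext -/

section InjectiveDimension

variable {R : Type u} [CommRing R]

/-- Baer's criterion is the case `n = 0`; embedding `M` in an injective module and passing to the
cokernel lowers `n`. -/
lemma hasInjectiveDimensionLE_of_extZero_quotient {n : ℕ} {M : Type u} [AddCommGroup M] [Module R M]
    (h : ∀ I : Ideal R, ExtZero R (R ⧸ I) M (n + 1)) :
    HasInjectiveDimensionLE (ModuleCat.of R M) n := by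
  induction n generalizing M with
  | zero =>
    have : Module.Injective R M := Module.Baer.injective fun I g => by
      obtain ⟨ψ, hψ⟩ := (ses_subtype_mkQ I).extend (h I) g
      exact ⟨ψ, fun x hx => LinearMap.congr_fun hψ ⟨x, hx⟩⟩
    exact injective_iff_hasInjectiveDimensionLT_one.1
      (Module.injective_object_of_injective_module R M)
  | succ n ih =>
    let E : ModuleCat.{u} R := CategoryTheory.Injective.under (ModuleCat.of R M)
    have hE' : CategoryTheory.Injective E :=
      inferInstanceAs (CategoryTheory.Injective (CategoryTheory.Injective.under _))
    let f : M →ₗ[R] E := (CategoryTheory.Injective.ι (ModuleCat.of R M)).hom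
    have hf : Function.Injective f := (ModuleCat.mono_iff_injective _).1
      (inferInstanceAs (Mono (CategoryTheory.Injective.ι (ModuleCat.of R M))))
    have hs : SES f (LinearMap.range f).mkQ :=
      ⟨hf, LinearMap.exact_map_mkQ_range f, Submodule.mkQ_surjective _⟩
    have hE (N : Type u) [AddCommGroup N] [Module R N] (i : ℕ) :
        ExtZero R N E (i + 1) :=
      HasInjectiveDimensionLT.subsingleton E 1 (i + 1) (by lia) (ModuleCat.of R N)
    exact (hs.shortExact.hasInjectiveDimensionLT_X₃_iff n hE').1
      (ih fun I => hs.ext_right' (hE _ _) (h I))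

/-- Testing on finite modules alone suffices since Baer's criterion needs only cyclic ones, and
finiteness makes Nakayama applicable. -/
lemma isGorenstein_iff [IsLocalRing R] : IsGorenstein R ↔ ∃ n : ℕ, ∀ i, n ≤ i →
    ∀ (N : Type u) [AddCommGroup N] [Module R N] [Module.Finite R N], ExtZero R N R i := by
  rw [IsGorenstein, injectiveDimension_ne_top_iff]
  constructor
  · rintro ⟨n, hn⟩
    exact ⟨n + 1, fun i hi N _ _ _ => HasInjectiveDimensionLT.subsingleton (ModuleCat.of R R) (n + 1) i hi (ModuleCat.of R N)⟩
  · rintro ⟨n, hn⟩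
    exact ⟨n, hasInjectiveDimensionLE_of_extZero_quotient fun I => hn _ (by lia) _⟩

lemma extZero_of_extZero_quotient {R : Type u} [CommRing R] [IsLocalRing R] [IsNoetherianRing R]
    {A C N : Type u} [AddCommGroup A] [Module R A] [AddCommGroup C] [Module R C]
    [AddCommGroup N] [Module R N] [Module.Finite R A] [Module.Finite R N] {x : R}
    {g : A →ₗ[R] C} (hx : x ∈ maximalIdeal R) (h : SES (LinearMap.lsmul R A x) g) {i : ℕ}
    (hC : ExtZero R N C i) : ExtZero R N A i := by
  refine subsingleton_of_forall_exists_smul hx fun e => ?_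
  obtain ⟨y, rfl⟩ := Ext.covariant_sequence_exact₂ _ h.shortExact e (hC.elim _ _)
  refine ⟨y, ?_⟩
  rw [Ext.smul_eq_comp_mk₀]
  rfl

end InjectiveDimension

/-! ### Depth; the Gorenstein and Cohen-Macaulay properties -/

section Depth

/-- The module `A ⧸ xA` is the last term of the exact sequence given by the multiplication by `x`. -/
noncomputable def SES.quotSMulTopEquiv {R : Type u} [CommRing R] {A C : Type u} [AddCommGroup A]
    [Module R A] [AddCommGroup C] [Module R C] {x : R} {g : A →ₗ[R] C}
    (h : SES (LinearMap.lsmul R A x) g) : QuotSMulTop x A ≃ₗ[R] C :=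
  (Submodule.quotEquivOfEq _ _ (by
    ext y
    rw [LinearMap.mem_ker, h.exact y, Submodule.mem_smul_pointwise_iff_exists]
    simp)).trans (g.quotKerEquivOfSurjective h.surj)

section

variable {A : Type u} [CommRing A] [IsLocalRing A] [IsNoetherianRing A]
  {N : Type u} [AddCommGroup N] [Module A N] [Module.Finite A N]

lemma support_quotient_maximalIdeal : Module.support A (ModuleCat.of A (A ⧸ maximalIdeal A)) =
    PrimeSpectrum.zeroLocus (maximalIdeal A : Set A) := by
  rw [Module.support_eq_zeroLocus]
  exact congrArg (fun I : Ideal A => PrimeSpectrum.zeroLocus (I : Set A)) Ideal.annihilator_quotient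

lemma maximalIdeal_smul_top_lt [Nontrivial N] :
    maximalIdeal A • (⊤ : Submodule A (ModuleCat.of A N)) < ⊤ :=
  lt_top_iff_ne_top.2 fun h => (top_ne_bot : (⊤ : Submodule A N) ≠ ⊥)
    (Submodule.eq_bot_of_le_smul_of_le_jacobson_bot _ ⊤ Module.Finite.fg_top h.ge
      (maximalIdeal_le_jacobson _))

lemma mem_maximalIdeal_of_isRegular {rs : List A} (h : RingTheory.Sequence.IsRegular N rs) :
    ∀ r ∈ rs, r ∈ maximalIdeal A := by
  intro r hr
  have : Ideal.ofList rs ≤ maximalIdeal A := le_maximalIdeal fun h' =>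
    h.top_ne_smul (by rw [h', Submodule.top_smul])
  exact this (Ideal.subset_span hr)

lemma extZero_of_isRegular [Nontrivial N] {rs : List A} (h : RingTheory.Sequence.IsRegular N rs)
    {i : ℕ} (hi : i < rs.length) : ExtZero A (A ⧸ maximalIdeal A) N i :=
  ModuleCat.subsingleton_ext_of_exists_isRegular (maximalIdeal A)
    (ModuleCat.of A (A ⧸ maximalIdeal A)) support_quotient_maximalIdeal.le (ModuleCat.of A N)
    maximalIdeal_smul_top_lt rs (mem_maximalIdeal_of_isRegular h) h i hi

lemma exists_isRegular_of_extZero [Nontrivial N] {n : ℕ}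
    (h : ∀ i < n, ExtZero A (A ⧸ maximalIdeal A) N i) :
    ∃ rs : List A, rs.length = n ∧ RingTheory.Sequence.IsRegular N rs := by
  obtain ⟨rs, h1, -, h2⟩ := ModuleCat.exists_isRegular_of_exists_subsingleton_ext (maximalIdeal A) n
    (ModuleCat.of A N) maximalIdeal_smul_top_lt (ModuleCat.of A (A ⧸ maximalIdeal A))
    support_quotient_maximalIdeal h
  exact ⟨rs, h1, h2⟩

lemma natCast_le_ringDepth_iff {n : ℕ} : (n : ℕ∞) ≤ ringDepth A ↔
    ∃ rs : List A, rs.length = n ∧ RingTheory.Sequence.IsRegular A rs := by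
  constructor
  · intro h
    obtain ⟨rs, hrs, hn⟩ : ∃ rs : List A, RingTheory.Sequence.IsRegular A rs ∧ n ≤ rs.length := by
      cases n with
      | zero => exact ⟨[], RingTheory.Sequence.IsRegular.nil A A, Nat.zero_le _⟩
      | succ n =>
        have h' : (n : ℕ∞) < ringDepth A := lt_of_lt_of_le (by exact_mod_cast n.lt_succ_self) h
        obtain ⟨rs, h1⟩ := lt_iSup_iff.1 h'
        obtain ⟨h2, h3⟩ := lt_iSup_iff.1 h1
        exact ⟨rs, h2, by exact_mod_cast h3⟩
    exact exists_isRegular_of_extZero fun i hi => extZero_of_isRegular hrs (hi.trans_le hn)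
  · rintro ⟨rs, rfl, h⟩
    exact le_iSup₂_of_le rs h le_rfl

end

variable {R S : Type u} [CommRing R] [CommRing S] [Algebra R S] [Algebra S R] {x : S}
  (h : IsRetraction R S x)

include h

lemma IsRetraction.ses : SES (LinearMap.lsmul S S x) (Algebra.linearMap S R) :=
  ses_mul_algebraMap h.surjective h.ker h.regular

lemma IsRetraction.isRegular_cons {rs : List R} (hrs : RingTheory.Sequence.IsRegular R rs) :
    RingTheory.Sequence.IsRegular S (x :: rs.map (algebraMap R S)) := by
  rw [RingTheory.Sequence.isRegular_cons_iff]
  refine ⟨h.regular, ?_⟩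
  refine (h.ses.quotSMulTopEquiv.toAddEquiv.isRegular_congr ?_).2 hrs
  refine List.forall₂_map_left_iff.mpr <| List.forall₂_same.mpr fun r _ y => ?_
  refine (map_smul h.ses.quotSMulTopEquiv _ y).trans ?_
  rw [Algebra.smul_def, h.leftInverse]
  rfl

variable [IsLocalRing R] [IsLocalRing S] [IsLocalHom (algebraMap S R)]
  [IsNoetherianRing R] [IsNoetherianRing S]

/-- From `R` to `S`: replace `N` by a syzygy, on which `x` is regular, compute Ext into `R` over
either ring, and lift the vanishing from `R = S/xS` to `S` by Nakayama. From `S` to `R`: by flat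
base change Ext of `N` into `R` is computed over `S`, where `R = S/xS`. -/
lemma isGorenstein_iff_of_isRetraction [Module.Flat R S] : IsGorenstein R ↔ IsGorenstein S := by
  have : IsScalarTower R S R :=
    IsScalarTower.of_algebraMap_eq fun a => (h.leftInverse a).symm
  have : Module.Finite S R := Module.Finite.of_surjective (Algebra.linearMap S R) h.surjective
  rw [isGorenstein_iff, isGorenstein_iff]
  constructor
  · rintro ⟨n, hn⟩
    -- The bound is `n + 2` because the degree shift `SES.ext_iff` starts in degree two.
    refine ⟨n + 2, fun i hi N _ _ _ => ?_⟩
    obtain ⟨i, rfl⟩ : ∃ j, i = j + 2 := ⟨i - 2, by lia⟩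
    obtain ⟨P, _, _, _, _, g, hs⟩ := exists_free_ses (R := S) (C := N)
    rw [hs.ext_iff]
    have := hs.finite_left
    have hT : h.evalClass.Good (LinearMap.ker g) :=
      h.evalClass.of_injective (Submodule.subtype_injective _) (h.evalClass.of_free inferInstance)
    exact extZero_of_extZero_quotient h.mem_maximalIdeal h.ses
      ((h.evalClass.extZero_iff R _ _ hT).1 (hn _ (by lia) _))
  · rintro ⟨n, hn⟩
    refine ⟨n, fun i hi N _ _ _ => ?_⟩
    rw [← (flatClass R S).extZero_iff R i N trivial]
    exact h.ses.ext_right' (hn i hi _) (hn _ (by lia) _)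

/-- A regular sequence on `R` is lifted and `x` is put in front. Conversely, regular sequences on
`S` need not begin with `x`, so the length is read from Ext of the residue field: the sequence `S →
S → R` loses exactly one degree. -/
lemma ringDepth_eq_add_one : ringDepth S = ringDepth R + 1 := by
  have : Module.Finite S R := by
    have : IsScalarTower R S R :=
      IsScalarTower.of_algebraMap_eq fun a => (h.leftInverse a).symm
    exact Module.Finite.of_surjective (Algebra.linearMap S R) h.surjective
  have key (n : ℕ) : ((n + 1 : ℕ) : ℕ∞) ≤ ringDepth S ↔ (n : ℕ∞) ≤ ringDepth R := by
    rw [natCast_le_ringDepth_iff, natCast_le_ringDepth_iff]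
    constructor
    · rintro ⟨rs, hn, hrs⟩
      obtain ⟨rs', hn', hrs'⟩ := exists_isRegular_of_extZero (A := S) (N := R) (n := n)
        fun i hi => h.ses.ext_right' (extZero_of_isRegular hrs (by lia))
          (extZero_of_isRegular hrs (by lia))
      refine ⟨rs'.map (algebraMap S R), by simpa, ?_⟩
      refine ((AddEquiv.refl R).isRegular_congr ?_).1 hrs'
      exact List.forall₂_map_right_iff.mpr <| List.forall₂_same.mpr fun r _ y => by
        simp [Algebra.smul_def]
    · rintro ⟨rs, hn, hrs⟩
      exact ⟨x :: rs.map (algebraMap R S), by simpa, h.isRegular_cons hrs⟩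
  refine ENat.eq_of_forall_natCast_le_iff fun n => ?_
  cases n with
  | zero => simp
  | succ n =>
    rw [key, Nat.cast_add, Nat.cast_one]
    exact (ENat.add_le_add_iff_right ENat.one_ne_top).symm

lemma isCohenMacaulay_iff_of_isRetraction : IsCohenMacaulay R ↔ IsCohenMacaulay S := by
  rw [IsCohenMacaulay, IsCohenMacaulay, ringDepth_eq_add_one h, ringKrullDim_eq_add_one h]
  exact (withBot_enat_add_one_inj _ _).symm

end Depth

end BurchExt


namespace BurchExt

/-! ### The completion of `S` as a power series ring -/

section EvalNilpotent

open PowerSeries in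
/-- The evaluation of power series at a nilpotent element. -/
noncomputable def evalNilpotent {A B : Type*} [CommRing A] [CommRing B] (g : A →+* B) (b : B)
    (n : ℕ) (hb : b ^ n = 0) : A⟦X⟧ →+* B where
  toFun f := (trunc n f).eval₂ g b
  map_zero' := by simp
  map_add' := by simp
  map_one' := by
    cases n with
    | zero => exact (subsingleton_of_zero_eq_one (by simpa using hb.symm)).elim _ _
    | succ n => simp [trunc_one]
  map_mul' f f' := by
    rw [← Polynomial.eval₂_mul, ← sub_eq_zero, ← Polynomial.eval₂_sub]
    obtain ⟨p, hp⟩ : Polynomial.X ^ n ∣ trunc n (f * f') - trunc n f * trunc n f' := by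
      refine Polynomial.X_pow_dvd_iff.2 fun d hd => ?_
      rw [Polynomial.coeff_sub, coeff_trunc, if_pos hd,
        coeff_mul_eq_coeff_trunc_mul_trunc f f' hd, sub_eq_zero, ← Polynomial.coe_mul,
        Polynomial.coeff_coe]
    rw [hp, Polynomial.eval₂_mul, Polynomial.eval₂_X_pow, hb, zero_mul]

open PowerSeries in
lemma evalNilpotent_apply {A B : Type*} [CommRing A] [CommRing B] (g : A →+* B) (b : B)
    (n : ℕ) (hb : b ^ n = 0) (f : A⟦X⟧) :
    evalNilpotent g b n hb f = ∑ i ∈ Finset.range n, g (coeff i f) * b ^ i :=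
  eval₂_trunc_eq_sum_range b g n f

end EvalNilpotent

section AdicCompletion

variable {A : Type u} [CommRing A] {I : Ideal A}

lemma exists_adicCauchy (I : Ideal A) (y : AdicCompletion I A) : ∃ a : ℕ → A,
    (∀ n, AdicCompletion.evalₐ I n y = Ideal.Quotient.mk _ (a n)) ∧
      ∀ {m n : ℕ}, m ≤ n → a n - a m ∈ I ^ m := by
  obtain ⟨a, rfl⟩ := AdicCompletion.mk_surjective I A y
  refine ⟨a.val, fun n => AdicCompletion.evalₐ_mk I n a, fun {m n} hmn => ?_⟩
  rw [← Ideal.Quotient.eq]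
  exact AdicCompletion.Ideal.mk_eq_mk I hmn a

lemma exists_evalₐ_eq (a : ℕ → A) (ha : ∀ {m n : ℕ}, m ≤ n → a n - a m ∈ I ^ m) :
    ∃ y : AdicCompletion I A, ∀ n, AdicCompletion.evalₐ I n y = Ideal.Quotient.mk _ (a n) := by
  refine ⟨AdicCompletion.mk I A ⟨a, fun {m n} hmn => ?_⟩, fun n => AdicCompletion.evalₐ_mk I n _⟩
  rw [SModEq.comm, SModEq.sub_mem, smul_eq_mul, Ideal.mul_top]
  exact ha hmn

end AdicCompletion

namespace IsRetraction

variable {R S : Type u} [CommRing R] [CommRing S] [Algebra R S] [Algebra S R] {x : S}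
  (h : IsRetraction R S x)

/-- The coefficient of `x` onwards: `s = s₀ + x * shift s`. -/
noncomputable def shift : S →ₗ[R] S where
  toFun s := (h.exists_eq_add s).choose
  map_add' s t := h.regular <| by
    have h1 := (h.exists_eq_add s).choose_spec
    have h2 := (h.exists_eq_add t).choose_spec
    have h3 := (h.exists_eq_add (s + t)).choose_spec
    simp only [smul_eq_mul, map_add] at *
    linear_combination h1 + h2 - h3
  map_smul' r s := h.regular <| by
    have h1 := (h.exists_eq_add s).choose_spec
    have h3 := (h.exists_eq_add (r • s)).choose_spec
    simp only [smul_eq_mul, Algebra.smul_def, map_mul, h.leftInverse, RingHom.id_apply] at *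
    linear_combination (algebraMap R S r) * h1 - h3

lemma eq_add_shift (s : S) : s = algebraMap R S (algebraMap S R s) + x * h.shift s :=
  (h.exists_eq_add s).choose_spec

lemma shift_add_mul (a : R) (t : S) : h.shift (algebraMap R S a + x * t) = t :=
  h.regular <| by
    have h1 := h.eq_add_shift (algebraMap R S a + x * t)
    rw [map_add (algebraMap S R), map_mul, h.leftInverse, h.map_self, zero_mul, add_zero] at h1
    exact (add_left_cancel h1).symm

lemma shift_mul (t : S) : h.shift (x * t) = t := by
  simpa using h.shift_add_mul 0 t

/-- The coefficients of the expansion of an element of `S` in powers of `x`. -/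
noncomputable def coeff : ℕ → S →+ R
  | 0 => (algebraMap S R : S →+ R)
  | i + 1 => (coeff i).comp h.shift.toAddMonoidHom

lemma coeff_zero (s : S) : h.coeff 0 s = algebraMap S R s := rfl

lemma coeff_succ (i : ℕ) (s : S) : h.coeff (i + 1) s = h.coeff i (h.shift s) := rfl

lemma exists_eq_sum_add (n : ℕ) (s : S) : ∃ t,
    s = ∑ i ∈ Finset.range n, algebraMap R S (h.coeff i s) * x ^ i + x ^ n * t := by
  induction n generalizing s with
  | zero => exact ⟨s, by simp⟩
  | succ n ih =>
    obtain ⟨t, ht⟩ := ih (h.shift s)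
    refine ⟨t, ?_⟩
    rw [Finset.sum_range_succ']
    simp only [coeff_succ, coeff_zero, pow_zero, mul_one, pow_succ, ← mul_assoc, ← Finset.sum_mul]
    linear_combination h.eq_add_shift s + x * ht

lemma coeff_sum (n : ℕ) (a : ℕ → R) (i : ℕ) (hi : i < n) :
    h.coeff i (∑ j ∈ Finset.range n, algebraMap R S (a j) * x ^ j) = a i := by
  induction n generalizing a i with
  | zero => simp at hi
  | succ n ih =>
    have : ∑ j ∈ Finset.range (n + 1), algebraMap R S (a j) * x ^ j =
        algebraMap R S (a 0) + x * ∑ j ∈ Finset.range n, algebraMap R S (a (j + 1)) * x ^ j := by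
      rw [Finset.sum_range_succ', Finset.mul_sum, add_comm]
      simp only [pow_zero, mul_one, pow_succ]
      congr 1
      exact Finset.sum_congr rfl fun j _ => by ring
    rw [this]
    cases i with
    | zero => simp [coeff_zero, h.leftInverse, h.map_self]
    | succ i => rw [coeff_succ, shift_add_mul, ih (fun j => a (j + 1)) i (by lia)]

variable [IsLocalRing R] [IsLocalRing S] [IsLocalHom (algebraMap S R)]

section

include h

lemma algebraMap_mem_maximalIdeal {a : R} (ha : a ∈ maximalIdeal R) :
    algebraMap R S a ∈ maximalIdeal S :=
  (map_mem_nonunits_iff (algebraMap S R) _).1 (by rwa [h.leftInverse])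

lemma maximalIdeal_pow_le (n : ℕ) :
    maximalIdeal R ^ n ≤ (maximalIdeal S ^ n).comap (algebraMap R S) := by
  rw [← Ideal.map_le_iff_le_comap, Ideal.map_pow]
  exact Ideal.pow_right_mono (Ideal.map_le_iff_le_comap.2 fun a ha =>
    Ideal.mem_comap.2 (h.algebraMap_mem_maximalIdeal ha)) n

end

/-- The shift obeys a twisted Leibniz rule: shifting `a * b` gives the constant term of `a` times
the shift of `b`, plus the shift of `a` times `b`. Induction then shows that it lowers the adic
order by at most one. -/
lemma shift_mem {n : ℕ} {s : S} (hs : s ∈ maximalIdeal S ^ (n + 1)) :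
    h.shift s ∈ maximalIdeal S ^ n := by
  induction n generalizing s with
  | zero => simp
  | succ n ih =>
    rw [pow_succ'] at hs
    refine Submodule.mul_induction_on hs (fun a ha b hb => ?_) fun a b ha hb => ?_
    · have h1 : a * b = algebraMap S R a • b + x * (h.shift a * b) := by
        rw [Algebra.smul_def]
        linear_combination b * h.eq_add_shift a
      rw [h1, map_add, map_smul, shift_mul, Algebra.smul_def]
      refine add_mem ?_ (Ideal.mul_mem_left _ _ hb)
      rw [pow_succ']
      exact Ideal.mul_mem_mul (h.algebraMap_mem_maximalIdeal
        ((map_mem_nonunits_iff (algebraMap S R) _).2 ha)) (ih hb)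
    · rw [map_add]
      exact add_mem ha hb

lemma coeff_mem (i : ℕ) {n : ℕ} {s : S} (hs : s ∈ maximalIdeal S ^ (n + i)) :
    h.coeff i s ∈ maximalIdeal R ^ n := by
  induction i generalizing s with
  | zero =>
    have : maximalIdeal S ^ n ≤ (maximalIdeal R ^ n).comap (algebraMap S R) := by
      rw [← Ideal.map_le_iff_le_comap, Ideal.map_pow]
      exact Ideal.pow_right_mono (Ideal.map_le_iff_le_comap.2 fun a ha =>
        (map_mem_nonunits_iff (algebraMap S R) _).2 ha) n
    exact this hs
  | succ i ih => exact ih (h.shift_mem hs)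

variable [IsNoetherianRing R] [IsNoetherianRing S]

/-- The map `R → R ⧸ 𝔪 ^ n → S ⧸ 𝔪 ^ n` on the completion of `R`. -/
noncomputable def completionQuotient (n : ℕ) :
    AdicCompletion (maximalIdeal R) R →+* S ⧸ maximalIdeal S ^ n :=
  (Ideal.quotientMap _ (algebraMap R S) (h.maximalIdeal_pow_le n)).comp
    (AdicCompletion.evalₐ (maximalIdeal R) n : _ →+* _)

lemma completionQuotient_eq {n : ℕ} {y : AdicCompletion (maximalIdeal R) R} {a : R}
    (ha : AdicCompletion.evalₐ (maximalIdeal R) n y = Ideal.Quotient.mk _ a) :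
    h.completionQuotient n y = Ideal.Quotient.mk _ (algebraMap R S a) := by
  change Ideal.quotientMap _ (algebraMap R S) (h.maximalIdeal_pow_le n)
    (AdicCompletion.evalₐ (maximalIdeal R) n y) = _
  rw [ha, Ideal.quotientMap_mk]

lemma factor_completionQuotient {m n : ℕ} (hmn : m ≤ n)
    (y : AdicCompletion (maximalIdeal R) R) :
    Ideal.Quotient.factorPow (maximalIdeal S) hmn (h.completionQuotient n y) =
      h.completionQuotient m y := by
  obtain ⟨a, ha, ha'⟩ := exists_adicCauchy _ y
  rw [h.completionQuotient_eq (ha n), h.completionQuotient_eq (ha m)]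
  refine Ideal.Quotient.eq.2 ?_
  rw [← map_sub]
  exact h.maximalIdeal_pow_le m (ha' hmn)

lemma x_pow_mem (h : IsRetraction R S x) (n : ℕ) : x ^ n ∈ maximalIdeal S ^ n :=
  Ideal.pow_mem_pow h.mem_maximalIdeal n

open PowerSeries in
/-- The map `R^⟦X⟧ → S ⧸ 𝔪 ^ n` sending `X` to `x`. -/
noncomputable def powerSeriesQuotient (n : ℕ) :
    (AdicCompletion (maximalIdeal R) R)⟦X⟧ →+* S ⧸ maximalIdeal S ^ n :=
  evalNilpotent (h.completionQuotient n) (Ideal.Quotient.mk _ x) n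
    (by rw [← map_pow]; exact Ideal.Quotient.eq_zero_iff_mem.2 (h.x_pow_mem n))

open PowerSeries in
lemma powerSeriesQuotient_eq {n : ℕ} {f : (AdicCompletion (maximalIdeal R) R)⟦X⟧} {a : ℕ → R}
    (ha : ∀ i, AdicCompletion.evalₐ (maximalIdeal R) n (PowerSeries.coeff i f) =
      Ideal.Quotient.mk _ (a i)) :
    h.powerSeriesQuotient n f =
      Ideal.Quotient.mk _ (∑ i ∈ Finset.range n, algebraMap R S (a i) * x ^ i) := by
  rw [powerSeriesQuotient, evalNilpotent_apply, map_sum]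
  refine Finset.sum_congr rfl fun i _ => ?_
  rw [h.completionQuotient_eq (ha i), map_mul, map_pow]

open PowerSeries in
lemma factorPow_comp_powerSeriesQuotient {m n : ℕ} (hmn : m ≤ n) :
    (Ideal.Quotient.factorPow (maximalIdeal S) hmn).comp (h.powerSeriesQuotient n) =
      h.powerSeriesQuotient m := by
  ext f
  rw [RingHom.comp_apply, powerSeriesQuotient, powerSeriesQuotient, evalNilpotent_apply,
    evalNilpotent_apply, map_sum]
  refine (Finset.sum_subset (Finset.range_subset_range.2 hmn) fun i _ hi => ?_).symm.trans
    (Finset.sum_congr rfl fun i _ => ?_)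
  · rw [map_mul, ← map_pow]
    have : Ideal.Quotient.factorPow (maximalIdeal S) hmn (Ideal.Quotient.mk _ (x ^ i)) = 0 :=
      Ideal.Quotient.eq_zero_iff_mem.2
        (Ideal.pow_le_pow_right (by simpa using hi) (h.x_pow_mem i))
    rw [this, mul_zero]
  · rw [map_mul, map_pow, h.factor_completionQuotient hmn]
    rfl

open PowerSeries in
/-- The map from the power series over the completion of `R` to the completion of `S`. -/
noncomputable def powerSeriesMap :
    (AdicCompletion (maximalIdeal R) R)⟦X⟧ →+* AdicCompletion (maximalIdeal S) S :=
  AdicCompletion.liftRingHom _ h.powerSeriesQuotient h.factorPow_comp_powerSeriesQuotient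

lemma powerSeriesMap_injective : Function.Injective h.powerSeriesMap := by
  rw [injective_iff_map_eq_zero]
  intro f hf
  refine PowerSeries.ext fun i => ?_
  refine AdicCompletion.ext_evalₐ (I := maximalIdeal R) fun k => ?_
  -- Reading the `i`-th coefficient loses `i` orders of precision; the extra `1` keeps `i` within
  -- the range of summation when `k = 0`.
  have hn := congrArg (AdicCompletion.evalₐ (maximalIdeal S) (k + 1 + i)) hf
  rw [powerSeriesMap, AdicCompletion.evalₐ_liftRingHom, map_zero] at hn
  choose a ha ha' using fun j => exists_adicCauchy _ (PowerSeries.coeff j f)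
  rw [h.powerSeriesQuotient_eq (a := fun j => a j (k + 1 + i)) fun j => ha j _,
    Ideal.Quotient.eq_zero_iff_mem] at hn
  have h1 := h.coeff_mem i hn
  rw [h.coeff_sum _ _ _ (by lia)] at h1
  rw [ha, map_zero, map_zero, Ideal.Quotient.eq_zero_iff_mem]
  have h2 := add_mem (Ideal.pow_le_pow_right k.le_succ h1)
    (neg_mem (ha' i (show k ≤ k + 1 + i by lia)))
  simpa using h2

lemma powerSeriesMap_surjective : Function.Surjective h.powerSeriesMap := by
  intro y
  obtain ⟨s, hs, hs'⟩ := exists_adicCauchy _ y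
  -- The `i`-th coefficient modulo `𝔪 ^ m` is taken from the approximation of order `m + i`, to
  -- compensate for the loss of `i` orders.
  have h1 (i : ℕ) {m n : ℕ} (hmn : m ≤ n) :
      h.coeff i (s (n + i)) - h.coeff i (s (m + i)) ∈ maximalIdeal R ^ m := by
    rw [← map_sub]
    exact h.coeff_mem i (hs' (by lia))
  choose a ha using fun i => exists_evalₐ_eq (I := maximalIdeal R) _ (h1 i)
  refine ⟨PowerSeries.mk a, AdicCompletion.ext_evalₐ (I := maximalIdeal S) fun n => ?_⟩
  rw [powerSeriesMap, AdicCompletion.evalₐ_liftRingHom,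
    h.powerSeriesQuotient_eq (a := fun i => h.coeff i (s (n + i)))
      fun i => by rw [PowerSeries.coeff_mk, ha], hs, Ideal.Quotient.eq]
  obtain ⟨t, ht⟩ := h.exists_eq_sum_add n (s n)
  -- The coefficient errors lie in `𝔪 ^ (n - i)` and are multiplied by `x ^ i`, so each term has
  -- order at least `n`.
  have h2 : ∑ i ∈ Finset.range n, algebraMap R S (h.coeff i (s (n + i))) * x ^ i - s n =
      ∑ i ∈ Finset.range n, algebraMap R S (h.coeff i (s (n + i) - s n)) * x ^ i - x ^ n * t := by
    simp only [map_sub, sub_mul, Finset.sum_sub_distrib]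
    linear_combination -ht
  rw [h2]
  refine sub_mem (sum_mem fun i hi => ?_) (Ideal.mul_mem_right _ _ (h.x_pow_mem n))
  obtain ⟨j, rfl⟩ := Nat.exists_eq_add_of_le' (Finset.mem_range.1 hi).le
  rw [pow_add]
  exact Ideal.mul_mem_mul (h.maximalIdeal_pow_le j (h.coeff_mem i (hs' (by lia)))) (h.x_pow_mem i)

open PowerSeries in
/-- The completion of `S` is the ring of power series over the completion of `R`. -/
noncomputable def completionEquiv :
    (AdicCompletion (maximalIdeal R) R)⟦X⟧ ≃+* AdicCompletion (maximalIdeal S) S :=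
  RingEquiv.ofBijective h.powerSeriesMap
    ⟨h.powerSeriesMap_injective, h.powerSeriesMap_surjective⟩

end IsRetraction

end BurchExt


namespace BurchExt

/-! ### Complete intersections -/

section RegularSequences

variable {R S : Type u} [CommRing R] [CommRing S] [Algebra R S] [Algebra S R] {x : S}
  (h : IsRetraction R S x)

include h

/-- Put `x` in front, permute it to the end (the ring is local Noetherian) and drop it; no flatness
is needed. -/
lemma IsRetraction.isRegular_map [IsLocalRing S] [IsNoetherianRing S] {rs : List R}
    (hrs : RingTheory.Sequence.IsRegular R rs) :
    RingTheory.Sequence.IsRegular S (rs.map (algebraMap R S)) := by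
  have h1 := IsLocalRing.isRegular_of_perm (h.isRegular_cons hrs)
    (List.perm_append_singleton x (rs.map (algebraMap R S))).symm
  refine ⟨((RingTheory.Sequence.isWeaklyRegular_append_iff S _ _).1 h1.toIsWeaklyRegular).1, ?_⟩
  intro h2
  refine h1.top_ne_smul (h2.trans (le_antisymm (Submodule.smul_mono_left ?_) (h2 ▸ le_top)))
  rw [Ideal.ofList_append]
  exact le_sup_left

end RegularSequences

/-- The kernel of a surjection of `Q[[X]]`-like rings is generated by the kernel on the
constants. -/
lemma ker_eq_map_of_isRetraction {Q P A B : Type u} [CommRing Q] [CommRing P] [CommRing A]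
    [CommRing B] [Algebra Q P] [Algebra P Q] {x : P} (h : IsRetraction Q P x) [IsLocalRing P]
    [IsNoetherianRing P] (hx : x ∈ maximalIdeal P) [Algebra A B] [Algebra B A] {y : B} (h' : IsRetraction A B y) (f : Q →+* A)
    (g : P →+* B) (hg : g x = y) (hfg : ∀ q, g (algebraMap Q P q) = algebraMap A B (f q)) :
    RingHom.ker g = (RingHom.ker f).map (algebraMap Q P) := by
  refine le_antisymm ?_ (Ideal.map_le_iff_le_comap.2 fun q hq => ?_)
  -- For `p` in the kernel, the constant term lies in `ker f`, and regularity of `y` puts the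
  -- cofactor of `x` back in `ker g`; Nakayama for `(x)` finishes.
  · refine Submodule.le_of_le_smul_of_le_jacobson_bot (I := Ideal.span {x})
      ((isNoetherianRing_iff_ideal_fg P).1 inferInstance _) ?_ ?_
    · exact (Ideal.span_singleton_le_iff_mem _).2 (maximalIdeal_le_jacobson _ hx)
    · intro p hp
      obtain ⟨p', hp'⟩ := h.exists_eq_add p
      have h1 : algebraMap A B (f (algebraMap P Q p)) + y * g p' = 0 := by
        rw [← hfg, ← hg, ← map_mul, ← map_add, ← hp']
        exact hp
      have h2 : f (algebraMap P Q p) = 0 := by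
        have := congrArg (algebraMap B A) h1
        rwa [map_add, map_mul, h'.map_self, zero_mul, add_zero, h'.leftInverse, map_zero] at this
      have h3 : g p' = 0 := h'.regular (by simpa [h2] using h1)
      rw [hp']
      exact Submodule.add_mem_sup (Ideal.mem_map_of_mem _ h2)
        (Submodule.smul_mem_smul (Ideal.mem_span_singleton_self x) h3)
  · rw [Ideal.mem_comap, RingHom.mem_ker, hfg, show f q = 0 from hq, map_zero]

section PowerSeries

open PowerSeries

variable (A : Type u) [CommRing A]

/-- The evaluation of power series at `0`. -/
noncomputable abbrev powerSeriesAlgebra : Algebra A⟦X⟧ A := (constantCoeff (R := A)).toAlgebra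

lemma isRetraction_powerSeries : letI := powerSeriesAlgebra A
    IsRetraction A A⟦X⟧ (PowerSeries.X : A⟦X⟧) := by
  let := powerSeriesAlgebra A
  refine ⟨fun a => constantCoeff_C a, ?_, fun f g hfg => ?_⟩
  · ext f
    rw [Ideal.mem_span_singleton, X_dvd_iff]
    rfl
  · ext n
    simpa using congrArg (PowerSeries.coeff (n + 1)) hfg

end PowerSeries

section CompleteIntersection

variable {R S : Type u} [CommRing R] [CommRing S] [Algebra R S] [Algebra S R] {x : S}
  (h : IsRetraction R S x) [IsLocalRing R] [IsLocalRing S] [IsLocalHom (algebraMap S R)]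
  [IsNoetherianRing R] [IsNoetherianRing S]

include h

open PowerSeries in
-- If `R̂ = Q/(rs)`, then `Ŝ ≅ R̂⟦X⟧ = Q⟦X⟧/(rs)`, and `Q⟦X⟧` is regular because it retracts onto
-- `Q`.
lemma isCompleteIntersection_of_isRetraction (hR : IsCompleteIntersection R) :
    IsCompleteIntersection S := by
  obtain ⟨Q, _, _, rs, hrs, ⟨e⟩⟩ := hR
  let := powerSeriesAlgebra Q
  let := powerSeriesAlgebra (AdicCompletion (maximalIdeal R) R)
  have hQ := isRetraction_powerSeries Q
  have hA := isRetraction_powerSeries (AdicCompletion (maximalIdeal R) R)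
  have : IsLocalHom (algebraMap Q⟦X⟧ Q) :=
    ⟨fun f hf => PowerSeries.isUnit_iff_constantCoeff.2 hf⟩
  have : IsRegularLocalRing Q⟦X⟧ := (isRegularLocalRing_iff_of_isRetraction hQ).1 inferInstance
  let f : Q →+* AdicCompletion (maximalIdeal R) R := (e : _ →+* _).comp (Ideal.Quotient.mk (Ideal.ofList rs))
  have hf : RingHom.ker f = Ideal.ofList rs := by
    ext p
    exact (map_eq_zero_iff e e.injective).trans Ideal.Quotient.eq_zero_iff_mem
  have hf' : Function.Surjective f := e.surjective.comp Ideal.Quotient.mk_surjective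
  have hker := ker_eq_map_of_isRetraction hQ hQ.mem_maximalIdeal hA f (PowerSeries.map f)
    (PowerSeries.map_X f) fun q => PowerSeries.map_C f q
  refine ⟨Q⟦X⟧, inferInstance, this, rs.map (algebraMap Q Q⟦X⟧), hQ.isRegular_map hrs, ⟨?_⟩⟩
  exact ((Ideal.quotEquivOfEq (by rw [hker, hf, Ideal.map_ofList])).trans
    (RingHom.quotientKerEquivOfSurjective (PowerSeries.map_surjective f hf'))).trans
      h.completionEquiv

open PowerSeries in
-- Lift the variable of `R̂⟦X⟧ ≅ Q/(rs)` to `q` in `Q`; appending `q` to the sequence cuts out `R̂`,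
-- and regularity persists because the variable is regular on power series.
lemma isCompleteIntersection_of_isRetraction' (hS : IsCompleteIntersection S) :
    IsCompleteIntersection R := by
  obtain ⟨Q, _, _, rs, hrs, ⟨e⟩⟩ := hS
  let := powerSeriesAlgebra (AdicCompletion (maximalIdeal R) R)
  have hA := isRetraction_powerSeries (AdicCompletion (maximalIdeal R) R)
  let e' := e.trans h.completionEquiv.symm
  obtain ⟨q, hq⟩ := Ideal.Quotient.mk_surjective (e'.symm PowerSeries.X)
  let f : Q →+* AdicCompletion (maximalIdeal R) R :=
    (constantCoeff (R := AdicCompletion (maximalIdeal R) R)).comp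
      ((e' : _ →+* _).comp (Ideal.Quotient.mk (Ideal.ofList rs)))
  have hq' : e' (Ideal.Quotient.mk _ q) = PowerSeries.X := by rw [hq, e'.apply_symm_apply]
  have hmem (p : Q) : p ∈ Ideal.ofList rs ↔ e' (Ideal.Quotient.mk _ p) = 0 := by
    rw [map_eq_zero_iff e' e'.injective, Ideal.Quotient.eq_zero_iff_mem]
  have hf : RingHom.ker f = Ideal.ofList (rs ++ [q]) := by
    ext p
    rw [Ideal.ofList_append, Ideal.ofList_singleton, Submodule.mem_sup]
    refine Iff.trans (b := PowerSeries.X ∣ e' (Ideal.Quotient.mk _ p)) PowerSeries.X_dvd_iff.symm ?_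
    constructor
    · rintro ⟨g, hg⟩
      obtain ⟨p', rfl⟩ := (e'.surjective.comp Ideal.Quotient.mk_surjective) g
      refine ⟨p - q * p', (hmem _).2 ?_, q * p',
        Ideal.mul_mem_right _ _ (Ideal.mem_span_singleton_self q), by ring⟩
      rw [map_sub, map_sub, map_mul, map_mul, hq', hg, Function.comp_apply, sub_self]
    · rintro ⟨a, ha, b, hb, rfl⟩
      obtain ⟨b, rfl⟩ := Ideal.mem_span_singleton.1 hb
      rw [map_add, map_add, (hmem a).1 ha, zero_add, map_mul, map_mul, hq']
      exact dvd_mul_right _ _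
  have hf' : Function.Surjective f :=
    hA.surjective.comp (e'.surjective.comp Ideal.Quotient.mk_surjective)
  refine ⟨Q, inferInstance, inferInstance, rs ++ [q], ⟨?_, ?_⟩,
    ⟨(Ideal.quotEquivOfEq hf.symm).trans (RingHom.quotientKerEquivOfSurjective hf')⟩⟩
  · rw [RingTheory.Sequence.isWeaklyRegular_append_iff]
    refine ⟨hrs.toIsWeaklyRegular, ?_⟩
    rw [RingTheory.Sequence.isWeaklyRegular_singleton_iff,
      isSMulRegular_quotient_iff_mem_of_smul_mem]
    intro p hp
    rw [smul_eq_mul, Ideal.mul_top] at hp ⊢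
    rw [hmem, smul_eq_mul, map_mul, map_mul, hq'] at hp
    rw [hmem]
    exact hA.regular (by simpa using hp)
  · intro htop
    rw [smul_eq_mul, Ideal.mul_top, ← hf] at htop
    have h1 : f 1 = 0 := (RingHom.mem_ker (f := f)).1 (htop ▸ Submodule.mem_top)
    have h2 := congrArg (AdicCompletion.evalₐ (maximalIdeal R) 1) h1
    rw [map_one, map_one, map_zero, ← map_one (Ideal.Quotient.mk _),
      Ideal.Quotient.eq_zero_iff_mem, pow_one] at h2
    exact (Ideal.ne_top_iff_one _).1 (maximalIdeal.isMaximal R).ne_top h2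

lemma isCompleteIntersection_iff_of_isRetraction :
    IsCompleteIntersection R ↔ IsCompleteIntersection S :=
  ⟨isCompleteIntersection_of_isRetraction h, isCompleteIntersection_of_isRetraction' h⟩

end CompleteIntersection

end BurchExt


/-! ### A common treatment of projective and Gorenstein dimension -/

namespace BurchExt

/-- The properties common to the projective dimension and the Gorenstein dimension of finitely
generated modules over Noetherian local rings: `LE n A` says that the dimension is at most `n`. -/
structure ModuleDimension where
  LE : ∀ {Q : Type u} [CommRing Q] (_ : ℕ) (A : Type u) [AddCommGroup A] [Module Q A], Prop
  congr : ∀ {Q : Type u} [CommRing Q] [IsNoetherianRing Q] {A B : Type u} [AddCommGroup A] [Module Q A]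
    [AddCommGroup B] [Module Q B] {n : ℕ}, (A ≃ₗ[Q] B) → LE (Q := Q) n A → LE (Q := Q) n B
  succ : ∀ {Q : Type u} [CommRing Q] [IsNoetherianRing Q] {A : Type u} [AddCommGroup A] [Module Q A] {n : ℕ},
    LE (Q := Q) n A → LE (Q := Q) (n + 1) A
  of_projective : ∀ {Q : Type u} [CommRing Q] [IsNoetherianRing Q] {A : Type u} [AddCommGroup A] [Module Q A]
    [Module.Finite Q A] [Module.Projective Q A] (n : ℕ), LE (Q := Q) n A
  left : ∀ {Q : Type u} [CommRing Q] [IsNoetherianRing Q] {A B C : Type u} [AddCommGroup A]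
    [Module Q A] [AddCommGroup B] [Module Q B] [AddCommGroup C] [Module Q C] {f : A →ₗ[Q] B}
    {g : B →ₗ[Q] C} {n : ℕ}, SES f g → LE (Q := Q) n B → LE (Q := Q) (n + 1) C → LE (Q := Q) n A
  mid : ∀ {Q : Type u} [CommRing Q] [IsNoetherianRing Q] {A B C : Type u} [AddCommGroup A]
    [Module Q A] [AddCommGroup B] [Module Q B] [AddCommGroup C] [Module Q C] {f : A →ₗ[Q] B}
    {g : B →ₗ[Q] C} {n : ℕ}, SES f g → LE (Q := Q) n A → LE (Q := Q) n C → LE (Q := Q) n B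
  right : ∀ {Q : Type u} [CommRing Q] [IsNoetherianRing Q] {A B C : Type u} [AddCommGroup A]
    [Module Q A] [AddCommGroup B] [Module Q B] [AddCommGroup C] [Module Q C] {f : A →ₗ[Q] B}
    {g : B →ₗ[Q] C} {n : ℕ}, SES f g → LE (Q := Q) n A → LE (Q := Q) n B → LE (Q := Q) (n + 1) C
  of_quotSMulTop : ∀ {Q : Type u} [CommRing Q] [IsNoetherianRing Q] [IsLocalRing Q] {A : Type u}
    [AddCommGroup A] [Module Q A] [Module.Finite Q A] {x : Q} {n : ℕ}, x ∈ maximalIdeal Q →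
    IsSMulRegular A x → LE (Q := Q) (n + 1) (QuotSMulTop x A) → LE (Q := Q) n A
  flat : ∀ {Q P : Type u} [CommRing Q] [CommRing P] [Algebra Q P] [Module.Flat Q P]
    [IsNoetherianRing Q] [IsNoetherianRing P] {A : Type u} [AddCommGroup A] [Module Q A] {n : ℕ},
    LE (Q := Q) n A → LE (Q := P) n (P ⊗[Q] A)
  hasGRes : ∀ {Q : Type u} [CommRing Q] [IsNoetherianRing Q] {A : Type u} [AddCommGroup A]
    [Module Q A] [Module.Finite Q A] {n : ℕ}, LE (Q := Q) n A → HasGRes Q n A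

/-- The Gorenstein dimension. -/
def gDimension : ModuleDimension.{u} where
  LE {Q} _ n A _ _ := HasGRes Q n A
  congr e h := h.congr e
  succ h := h.succ
  of_projective n := HasGRes.mono n.zero_le GProj.of_projective
  left := by intro Q _ _ A B C _ _ _ _ _ _ f g n h hB hC; exact h.hasGRes_left hB hC
  mid := by intro Q _ _ A B C _ _ _ _ _ _ f g n h hA hC; exact h.hasGRes_mid hA hC
  right := by intro Q _ _ A B C _ _ _ _ _ _ f g n h hA hB; exact h.hasGRes_right hA hB.succ
  of_quotSMulTop hx hA h := hasGRes_of_quotSMulTop hx hA h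
  flat h := flatClass_preservesGProj.hasGRes h trivial
  hasGRes h := h

lemma HasProjectiveDimensionLE.hasGRes {Q : Type u} [CommRing Q] [IsNoetherianRing Q] {A : Type u}
    [AddCommGroup A] [Module Q A] [Module.Finite Q A] {n : ℕ}
    (h : HasProjectiveDimensionLE (ModuleCat.of Q A) n) : HasGRes Q n A := by
  induction n generalizing A with
  | zero =>
    have : HasProjectiveDimensionLT (ModuleCat.of Q A) 1 := h
    have : Module.Projective Q A := (IsProjective.iff_projective A).2
      (projective_iff_hasProjectiveDimensionLT_one.2 this)
    exact GProj.of_projective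
  | succ n ih =>
    obtain ⟨P, _, _, _, _, g, hs⟩ := exists_free_ses (R := Q) (C := A)
    have := hs.finite_left
    exact hs.hasGRes_succ GProj.of_projective (ih
      (hs.shortExact.hasProjectiveDimensionLT_X₁ (n + 1)
        (hasProjectiveDimensionLE_of_projective n) h))

lemma withBot_enat_le_of_add_one_le {a : WithBot ℕ∞} {n : ℕ} (h : a + 1 ≤ (n + 1 : ℕ)) :
    a ≤ n := by
  induction a with
  | bot => exact bot_le
  | coe a =>
    have h' : a + 1 ≤ (n : ℕ∞) + 1 := WithBot.coe_le_coe.1 h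
    exact WithBot.coe_le_coe.2 ((ENat.add_le_add_iff_right ENat.one_ne_top).1 h')

/-- The projective dimension. -/
def projDimension : ModuleDimension.{u} where
  LE {Q} _ n A _ _ := HasProjectiveDimensionLE (ModuleCat.of Q A) n
  congr e h := by
    rw [← projectiveDimension_le_iff] at h ⊢
    rwa [← projectiveDimension_congr e]
  succ h := HasProjectiveDimensionLE.succ h
  of_projective n := hasProjectiveDimensionLE_of_projective n
  left := by
    intro Q _ _ A B C _ _ _ _ _ _ f g n h hB hC
    exact h.shortExact.hasProjectiveDimensionLT_X₁ (n + 1) hB hC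
  mid := by
    intro Q _ _ A B C _ _ _ _ _ _ f g n h hA hC
    exact h.shortExact.hasProjectiveDimensionLT_X₂ (n + 1) hA hC
  right := by
    intro Q _ _ A B C _ _ _ _ _ _ f g n h hA hB
    exact h.shortExact.hasProjectiveDimensionLT_X₃ (n + 1) hA (HasProjectiveDimensionLE.succ hB)
  of_quotSMulTop {Q _ _ _ A _ _ _ x n} hx hA h := by
    rw [← projectiveDimension_le_iff] at h ⊢
    rw [ModuleCat.projectiveDimension_quotSMulTop_eq_succ_of_isSMulRegular (ModuleCat.of Q A) x hA hx] at h
    exact withBot_enat_le_of_add_one_le h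
  flat {Q P _ _ _ _ _ _ _ _ _ _} h := (flatClass Q P).hasProjectiveDimensionLE trivial h
  hasGRes h := HasProjectiveDimensionLE.hasGRes h

section Scalars

variable {Q P : Type u} [CommRing Q] [CommRing P] [Algebra Q P]
  {A B C : Type u} [AddCommGroup A] [Module Q A] [Module P A] [IsScalarTower Q P A]
  [AddCommGroup B] [Module Q B] [Module P B] [IsScalarTower Q P B]
  [AddCommGroup C] [Module Q C] [Module P C] [IsScalarTower Q P C]

lemma SES.restrictScalars {f : A →ₗ[P] B} {g : B →ₗ[P] C} (h : SES f g) :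
    SES (f.restrictScalars Q) (g.restrictScalars Q) := ⟨h.inj, h.exact, h.surj⟩

end Scalars

lemma ModuleDimension.pi (d : ModuleDimension.{u}) {Q : Type u} [CommRing Q] [IsNoetherianRing Q]
    {A : Type u} [AddCommGroup A] [Module Q A] {n : ℕ} (h : d.LE (Q := Q) n A) (m : ℕ) :
    d.LE (Q := Q) n (Fin m → A) := by
  induction m with
  | zero => exact d.of_projective n
  | succ m ih => exact d.congr (Fin.consLinearEquiv Q fun _ => A) (d.mid SES.prod h ih)

lemma ModuleDimension.of_free (d : ModuleDimension.{u}) {Q P : Type u} [CommRing Q]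
    [IsNoetherianRing Q] [CommRing P] [Nontrivial P] [Algebra Q P] {F : Type u} [AddCommGroup F] [Module P F]
    [Module Q F] [IsScalarTower Q P F] [Module.Free P F] [Module.Finite P F] {n : ℕ}
    (h : d.LE (Q := Q) n P) : d.LE (Q := Q) n F :=
  d.congr ((Module.finBasis P F).equivFun.symm.restrictScalars Q) (d.pi h _)

/-- The dimension of a nonzero module over a quotient of a ring is at least that of a perfect
quotient. -/
lemma ModuleDimension.le_of_surjective (d : ModuleDimension.{u}) {Q P : Type u} [CommRing Q]
    [IsNoetherianRing Q] [CommRing P] [Algebra Q P] (hP : Function.Surjective (algebraMap Q P))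
    (hd : ∀ n : ℕ, moduleGrade (ModuleCat.of Q P) ≤ n → d.LE (Q := Q) n P)
    {A : Type u} [AddCommGroup A] [Module P A] [Module Q A] [IsScalarTower Q P A]
    [Module.Finite P A] [Nontrivial A] {n : ℕ} (h : d.LE (Q := Q) n A) : d.LE (Q := Q) n P := by
  have : Module.Finite Q P := Module.Finite.of_surjective (Algebra.linearMap Q P) hP
  have : Module.Finite Q A := Module.Finite.trans P A
  exact hd n ((moduleGrade_le_of_surjective hP).trans
    (moduleGrade_le_gDim.trans (gDim_le_iff.2 (d.hasGRes h))))

end BurchExt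


/-! ### Transfer of dimension bounds between diagrams over `R` and over `S` -/

namespace BurchExt

lemma algebra_smulCommClass (A Q P : Type u) [CommRing A] [CommRing Q] [CommRing P] [Algebra A P]
    [Algebra Q P] : SMulCommClass A Q P :=
  ⟨fun a q p => by simp only [Algebra.smul_def]; ring⟩

section Restriction

variable {R S : Type u} [CommRing R] [CommRing S] [Algebra R S] [Algebra S R] {x : S}
  (h : IsRetraction R S x) {L : Type u} [AddCommGroup L] [Module R L] (M : Submodule R L)
  [Module.Free R L] [Module.Finite R L] [IsLocalRing R] [IsLocalRing S]
  [IsNoetherianRing R] [IsNoetherianRing S] [IsLocalHom (algebraMap S R)] [Module.Flat R S]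
  {P Q : Type u} [CommRing P] [CommRing Q] [IsLocalRing P] [IsLocalRing Q]
  [IsNoetherianRing Q] [Algebra S P] [Algebra R P] [IsScalarTower R S P] [Algebra Q P]
  [SMulCommClass S Q P] [SMulCommClass R Q P] [IsLocalHom (algebraMap S P)]
  [IsLocalHom (algebraMap Q P)] [Module.Flat S P]

/-- Since `P ⊗ (S ⊗ L)` is free over `P`, perfection bounds its dimension by `n`, so `P ⊗_S (L/M)`
has dimension at most `n + 1`. This module is `P ⊗_R (L/M)` modulo `x`, so descent along `x`
recovers `n`. -/
lemma le_baseChange_quotient_of_augComap (hP : Function.Surjective (algebraMap Q P))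
    (d : ModuleDimension.{u})
    (hd : ∀ n : ℕ, moduleGrade (ModuleCat.of Q P) ≤ n → d.LE (Q := Q) n P) [Nontrivial (L ⧸ M)]
    {n : ℕ} (hT : d.LE (Q := Q) n (P ⊗[S] augComap h M)) :
    d.LE (Q := Q) n (P ⊗[R] (L ⧸ M)) := by
  let : Module S (L ⧸ M) := Module.compHom _ (algebraMap S R)
  have : IsScalarTower S R (L ⧸ M) := ⟨fun s r y => by
    rw [Algebra.smul_def, mul_smul]; rfl⟩
  have : Module.Finite Q P := Module.Finite.of_surjective (Algebra.linearMap Q P) hP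
  have : Module.FaithfullyFlat S P := Module.FaithfullyFlat.of_flat_of_isLocalHom
  have := nontrivial_augComap h M
  have : Nontrivial (P ⊗[S] augComap h M) :=
    Module.FaithfullyFlat.lTensor_nontrivial S P (augComap h M)
  have hn : d.LE (Q := Q) n P := d.le_of_surjective hP hd hT
  have hL : d.LE (Q := Q) n (P ⊗[S] (S ⊗[R] L)) := d.of_free (P := P) hn
  have h1 := ((flatClass S P).ses (ses_augComap_subtype h M) trivial).restrictScalars (Q := Q)
  have h2 := ((flatClass S P).ses (ses_aug h (N := L ⧸ M)) trivial).restrictScalars (Q := Q)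
  have hN := d.right h1 hT hL
  -- The lift `q` may be a zero divisor on `Q`; only its regularity on the module is available.
  obtain ⟨q, hq⟩ := hP (algebraMap S P x)
  have hqm : q ∈ maximalIdeal Q := by
    refine (map_mem_nonunits_iff (algebraMap Q P) _).1 ?_
    rw [hq]
    exact (map_mem_nonunits_iff (algebraMap S P) _).2 h.mem_maximalIdeal
  have hf : ((LinearMap.lsmul S (S ⊗[R] (L ⧸ M)) x).baseChange P).restrictScalars Q =
      LinearMap.lsmul Q (P ⊗[S] (S ⊗[R] (L ⧸ M))) q := by
    refine LinearMap.ext fun t => ?_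
    change (LinearMap.lsmul S (S ⊗[R] (L ⧸ M)) x).baseChange P t = q • t
    induction t with
    | zero => simp
    | tmul p s =>
      rw [LinearMap.baseChange_tmul, LinearMap.lsmul_apply, ← TensorProduct.smul_tmul,
        TensorProduct.smul_tmul', Algebra.smul_def, Algebra.smul_def, hq]
    | add a b ha hb => rw [map_add, ha, hb, smul_add]
  rw [hf] at h2
  have : Module.Finite Q (P ⊗[S] (S ⊗[R] (L ⧸ M))) := Module.Finite.trans P _
  have hU := d.of_quotSMulTop hqm h2.inj (d.congr h2.quotSMulTopEquiv.symm hN)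
  exact d.congr ((TensorProduct.AlgebraTensorModule.cancelBaseChange R S P P
    (L ⧸ M)).restrictScalars Q) hU

end Restriction

section Extension

variable {R S : Type u} [CommRing R] [CommRing S] [Algebra R S] [Algebra S R] {x : S}
  (h : IsRetraction R S x) {L : Type u} [AddCommGroup L] [Module R L] (M : Submodule R L)
  [Module.Free R L] [Module.Finite R L] [IsLocalRing R] 
  {P Q P' Q' : Type u} [CommRing P] [CommRing Q] [CommRing P'] [CommRing Q'] [IsLocalRing P]
  [IsNoetherianRing Q] [IsNoetherianRing Q'] [Algebra R P] [Algebra Q P] [Algebra S P']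
  [Algebra Q' P'] [SMulCommClass S Q' P'] [SMulCommClass R Q P] [IsLocalHom (algebraMap R P)]
  [Algebra Q Q'] [Module.Flat R P] [Module.Flat S P'] [Module.Flat R S] [Module.Flat Q Q']
  [Algebra P P'] [Algebra Q P'] [IsScalarTower Q Q' P'] [IsScalarTower Q P P']
  [Algebra R P'] [IsScalarTower R S P'] [IsScalarTower R P P']

/-- `Q' ⊗ P` is generated by `1 ⊗ 1`, which is annihilated by the extension of `ker (Q → P)`; by
hypothesis this is all of `ker (Q' → P')`. -/
lemma isPushout_of_surjective (hP : Function.Surjective (algebraMap Q P))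
    (hP' : Function.Surjective (algebraMap Q' P'))
    (hker : RingHom.ker (algebraMap Q' P') =
      (RingHom.ker (algebraMap Q P)).map (algebraMap Q Q')) : Algebra.IsPushout Q Q' P P' := by
  let f : P →ₗ[Q] P' := (IsScalarTower.toAlgHom Q P P').toLinearMap
  have hf : Function.Bijective (f.liftBaseChange Q') := by
    constructor
    · rw [injective_iff_map_eq_zero]
      intro z
      let c : Q' →ₗ[Q'] Q' ⊗[Q] P := (LinearMap.id : Q' →ₗ[Q'] Q').smulRight (1 ⊗ₜ 1)
      have hc (z) : ∃ q, c q = z := by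
        induction z with
        | zero => exact ⟨0, map_zero _⟩
        | tmul q p =>
          obtain ⟨r, rfl⟩ := hP p
          refine ⟨q * algebraMap Q Q' r, ?_⟩
          simp only [c, LinearMap.smulRight_apply, LinearMap.id_apply, TensorProduct.smul_tmul',
            smul_eq_mul, mul_one]
          rw [mul_comm, ← Algebra.smul_def, TensorProduct.smul_tmul, ← Algebra.algebraMap_eq_smul_one]
        | add a b ha hb =>
          obtain ⟨q, rfl⟩ := ha
          obtain ⟨r, rfl⟩ := hb
          exact ⟨q + r, map_add _ _ _⟩
      obtain ⟨q, rfl⟩ := hc z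
      intro hz
      have h1 : q ∈ RingHom.ker (algebraMap Q' P') := by
        simpa [c, f, Algebra.smul_def] using hz
      have h2 : RingHom.ker (algebraMap Q' P') ≤ LinearMap.ker c := by
        rw [hker, Ideal.map_le_iff_le_comap]
        intro r hr
        rw [Ideal.mem_comap, LinearMap.mem_ker]
        simp only [c, LinearMap.smulRight_apply, LinearMap.id_apply, algebraMap_smul]
        rw [← TensorProduct.tmul_smul, ← Algebra.algebraMap_eq_smul_one, (RingHom.mem_ker).1 hr,
          TensorProduct.tmul_zero]
      exact h2 h1
    · intro p
      obtain ⟨q, rfl⟩ := hP' p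
      exact ⟨q ⊗ₜ 1, by simp [f, Algebra.smul_def]⟩
  exact ⟨IsBaseChange.of_equiv (LinearEquiv.ofBijective _ hf) fun p => by simp [f]⟩

/-- By the pushout property, `P' ⊗_S (S ⊗_R V)` is the flat base change of `P ⊗_R V` from `Q` to
`Q'`. Applying this to `L/M` and to `M`, whose bound again rests on perfection, controls both ends
of the sequence of the preimage. -/
lemma le_baseChange_augComap_of_quotient (hP : Function.Surjective (algebraMap Q P))
    (d : ModuleDimension.{u}) [Algebra.IsPushout Q Q' P P']
    (hd : ∀ n : ℕ, moduleGrade (ModuleCat.of Q P) ≤ n → d.LE (Q := Q) n P) [Nontrivial (L ⧸ M)]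
    {n : ℕ} (hN : d.LE (Q := Q) n (P ⊗[R] (L ⧸ M))) :
    d.LE (Q := Q') n (P' ⊗[S] augComap h M) := by
  have : Module.FaithfullyFlat R P := Module.FaithfullyFlat.of_flat_of_isLocalHom
  have : Nontrivial (P ⊗[R] (L ⧸ M)) := Module.FaithfullyFlat.lTensor_nontrivial R P (L ⧸ M)
  have hn : d.LE (Q := Q) n P := d.le_of_surjective hP hd hN
  have hL : d.LE (Q := Q) n (P ⊗[R] L) := d.of_free (P := P) hn
  have h1 := ((flatClass R P).ses (ses_subtype_mkQ M) trivial).restrictScalars (Q := Q)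
  have hM : d.LE (Q := Q) n (P ⊗[R] M) := d.left h1 hL (d.succ hN)
  have key (V : Type u) [AddCommGroup V] [Module R V] (hV : d.LE (Q := Q) n (P ⊗[R] V)) :
      d.LE (Q := Q') n (P' ⊗[S] (S ⊗[R] V)) := by
    let e₁ : P' ⊗[P] (P ⊗[R] V) ≃ₗ[Q'] Q' ⊗[Q] (P ⊗[R] V) :=
      Algebra.IsPushout.cancelBaseChange Q Q' P P' (P ⊗[R] V)
    let e₂ : P' ⊗[P] (P ⊗[R] V) ≃ₗ[Q'] P' ⊗[R] V :=
      (TensorProduct.AlgebraTensorModule.cancelBaseChange R P P' P' V).restrictScalars Q'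
    let e₃ : P' ⊗[S] (S ⊗[R] V) ≃ₗ[Q'] P' ⊗[R] V :=
      (TensorProduct.AlgebraTensorModule.cancelBaseChange R S P' P' V).restrictScalars Q'
    exact d.congr ((e₁.symm.trans e₂).trans e₃.symm) (d.flat (P := Q') hV)
  exact d.mid (((flatClass S P').ses (ses_augComap h M) trivial).restrictScalars (Q := Q'))
    (key _ hM) (key _ hN)

end Extension

end BurchExt


/-! ### Functoriality of the extension; restricting and extending diagrams -/

namespace BurchExt

section Functoriality

variable {A B : Type u} [CommRing A] [CommRing B] [IsLocalRing A] [IsLocalRing B] (f : A →+* B)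
  [IsLocalHom f]

lemma comap_idealMX : idealMX A = (idealMX B).comap (Polynomial.mapRingHom f) := by
  ext p
  rw [Ideal.mem_comap, idealMX_eq_comap, idealMX_eq_comap, Ideal.mem_comap, Ideal.mem_comap,
    Polynomial.constantCoeff_apply, Polynomial.constantCoeff_apply, Polynomial.coe_mapRingHom,
    Polynomial.coeff_map]
  exact (map_mem_nonunits_iff f _).symm

/-- The functoriality of `R ↦ R[X]_⟨𝔪, X⟩` for local homomorphisms. -/
noncomputable def ringSMap : ringS A →+* ringS B :=
  Localization.localRingHom _ _ (Polynomial.mapRingHom f) (comap_idealMX f)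

instance : IsLocalHom (ringSMap f) := Localization.isLocalHom_localRingHom _ _ _ _

lemma ringSMap_algebraMap_polynomial (p : A[X]) :
    ringSMap f (algebraMap A[X] (ringS A) p) = algebraMap B[X] (ringS B) (p.map f) :=
  Localization.localRingHom_to_map _ _ _ _ _

lemma ringSMap_algebraMap (a : A) :
    ringSMap f (algebraMap A (ringS A) a) = algebraMap B (ringS B) (f a) := by
  rw [IsScalarTower.algebraMap_apply A A[X] (ringS A), ringSMap_algebraMap_polynomial,
    Polynomial.algebraMap_eq, Polynomial.map_C,
    IsScalarTower.algebraMap_apply B B[X] (ringS B)]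
  rfl

lemma ringSMap_varS : ringSMap f (varS A) = varS B := by
  rw [varS, ringSMap_algebraMap_polynomial, Polynomial.map_X, varS]

lemma ringSMap_surjective (hf : Function.Surjective f) : Function.Surjective (ringSMap f) := by
  intro s
  obtain ⟨p, q, rfl⟩ := IsLocalization.exists_mk'_eq (idealMX B).primeCompl s
  obtain ⟨p', rfl⟩ := Polynomial.map_surjective f hf p
  obtain ⟨q', hq'⟩ := Polynomial.map_surjective f hf q
  have hq : q' ∈ (idealMX A).primeCompl := by
    have h2 := (mem_primeCompl_iff B).1 q.2
    rw [← hq', Polynomial.coeff_map] at h2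
    exact (mem_primeCompl_iff A).2 ((isUnit_map_iff f _).1 h2)
  refine ⟨IsLocalization.mk' _ p' ⟨q', hq⟩, ?_⟩
  have h3 : IsLocalization.mk' (ringS A) p' (⟨q', hq⟩ : (idealMX A).primeCompl) *
      algebraMap A[X] (ringS A) q' = algebraMap A[X] (ringS A) p' := IsLocalization.mk'_spec _ _ _
  rw [IsLocalization.eq_mk'_iff_mul_eq, ← hq', ← ringSMap_algebraMap_polynomial, ← map_mul, h3,
    ringSMap_algebraMap_polynomial]

attribute [local instance] Polynomial.algebra in
lemma ringSMap_flat (hf : f.Flat) : (ringSMap f).Flat := by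
  let := f.toAlgebra
  exact RingHom.Flat.localRingHom
    (RingHom.Flat.isStableUnderBaseChange A B A[X] B[X] hf) _ _ _

lemma ker_ringSMap [IsNoetherianRing A] :
    RingHom.ker (ringSMap f) = (RingHom.ker f).map (algebraMap A (ringS A)) :=
  ker_eq_map_of_isRetraction (isRetraction A) (isRetraction A).mem_maximalIdeal (isRetraction B) f
    _ (ringSMap_varS f) (ringSMap_algebraMap f)

end Functoriality

namespace FlatSurjDiagram

variable {R : Type u} [CommRing R]

section BaseChange

variable (D : FlatSurjDiagram R)

instance : SMulCommClass R D.Q D.R' := algebra_smulCommClass R D.Q D.R'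

/-- The module `R' ⊗ M` over `Q`. -/
noncomputable def baseChangeEquiv (M : Type u) [AddCommGroup M] [Module R M] :
    D.baseChange (ModuleCat.of R M) ≃ₗ[D.Q] D.R' ⊗[R] M :=
  { AddEquiv.refl (D.R' ⊗[R] M) with
    map_smul' := fun q (t : D.R' ⊗[R] M) => algebraMap_smul D.R' q t }

noncomputable def quotientKerEquiv :
    (D.Q ⧸ RingHom.ker (algebraMap D.Q D.R')) ≃ₗ[D.Q] D.R' :=
  (Algebra.linearMap D.Q D.R').quotKerEquivOfSurjective D.surjective

lemma isGQuasiDeformation_iff :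
    D.IsGQuasiDeformation ↔ gDim D.ringModule = moduleGrade D.ringModule := by
  rw [IsGQuasiDeformation, gDim_congr D.quotientKerEquiv, moduleGrade_congr D.quotientKerEquiv]
  rfl

end BaseChange

section Restrict

variable {S : Type u} [CommRing S] [Algebra R S] [Module.Flat R S] [IsLocalHom (algebraMap R S)]
  (D : FlatSurjDiagram S)

variable (R) in
/-- The restriction of a diagram `S → R' ← Q` to a diagram `R → R' ← Q`. -/
@[reducible]
noncomputable def restrict : FlatSurjDiagram R :=
  letI : Algebra R D.R' := ((algebraMap S D.R').comp (algebraMap R S)).toAlgebra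
  haveI : IsScalarTower R S D.R' := .of_algebraMap_eq fun _ => rfl
  { R' := D.R'
    Q := D.Q
    localHomR := RingHom.isLocalHom_comp (algebraMap S D.R') (algebraMap R S)
    flat := Module.Flat.trans R S D.R'
    surjective := D.surjective }

end Restrict

section Extend

variable [IsLocalRing R] (D : FlatSurjDiagram R)

/-- The diagram `R[X]_⟨𝔪, X⟩ → R'[X]_⟨𝔪, X⟩ ← Q[X]_⟨𝔪, X⟩`. -/
noncomputable def extend : FlatSurjDiagram (ringS R) :=
  letI : Algebra (ringS R) (ringS D.R') := (ringSMap (algebraMap R D.R')).toAlgebra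
  letI : Algebra (ringS D.Q) (ringS D.R') := (ringSMap (algebraMap D.Q D.R')).toAlgebra
  { R' := ringS D.R'
    Q := ringS D.Q
    localHomR := inferInstanceAs (IsLocalHom (ringSMap (algebraMap R D.R')))
    localHomQ := inferInstanceAs (IsLocalHom (ringSMap (algebraMap D.Q D.R')))
    flat := ringSMap_flat _ (RingHom.flat_algebraMap_iff.2 inferInstance)
    surjective := ringSMap_surjective _ D.surjective }

end Extend

end FlatSurjDiagram

end BurchExt


/-! ### Perfection and invariance of (G-)quasi-deformations -/

namespace BurchExt

namespace FlatSurjDiagram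

section Restrict

variable {R S : Type u} [CommRing R] [CommRing S] [Algebra R S] [Algebra S R] {x : S}
  (h : IsRetraction R S x) {L : Type u} [AddCommGroup L] [Module R L] (M : Submodule R L)
  [Module.Free R L] [Module.Finite R L] [IsLocalRing R] [IsLocalRing S]
  [IsNoetherianRing R] [IsNoetherianRing S] [IsLocalHom (algebraMap S R)] [Module.Flat R S]
  [IsLocalHom (algebraMap R S)]
  (D : FlatSurjDiagram S) (d : ModuleDimension.{u})

/-- The quotient defining the diagram has minimal dimension. -/
def IsPerfect {R : Type u} [CommRing R] (d : ModuleDimension.{u}) (D : FlatSurjDiagram R) : Prop :=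
  ∀ n : ℕ, moduleGrade D.ringModule ≤ n → d.LE (Q := D.Q) n D.R'

lemma le_restrict_baseChange (hD : D.IsPerfect d) [Nontrivial (L ⧸ M)] {T : Type u} [AddCommGroup T]
    [Module S T] (e : T ≃ₗ[S] augComap h M) {n : ℕ}
    (hT : d.LE (Q := D.Q) n (D.baseChange (ModuleCat.of S T))) :
    d.LE (Q := D.Q) n ((D.restrict R).baseChange (ModuleCat.of R (L ⧸ M))) := by
  let : Algebra R D.R' := ((algebraMap S D.R').comp (algebraMap R S)).toAlgebra
  have : IsScalarTower R S D.R' := .of_algebraMap_eq fun _ => rfl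
  have : SMulCommClass R D.Q D.R' := algebra_smulCommClass R D.Q D.R'
  have h1 : d.LE (Q := D.Q) n (D.R' ⊗[S] T) := d.congr (D.baseChangeEquiv T) hT
  have h2 : d.LE (Q := D.Q) n (D.R' ⊗[S] augComap h M) :=
    d.congr ((e.baseChange S D.R' T (augComap h M)).restrictScalars D.Q) h1
  exact d.congr ((D.restrict R).baseChangeEquiv (L ⧸ M)).symm
    (le_baseChange_quotient_of_augComap h M D.surjective d hD h2)

end Restrict

lemma moduleGrade_le_gDim_ringModule {R : Type u} [CommRing R] (D : FlatSurjDiagram R) :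
    moduleGrade D.ringModule ≤ gDim D.ringModule :=
  moduleGrade_le_gDim (R := D.Q) (A := D.R')

lemma IsGQuasiDeformation.isPerfect {R : Type u} [CommRing R] {D : FlatSurjDiagram R}
    (hD : D.IsGQuasiDeformation) : D.IsPerfect gDimension := by
  rw [isGQuasiDeformation_iff] at hD
  exact fun n hn => gDim_le_iff (R := D.Q) (A := D.R').1 (hD.le.trans hn)

/-- Both the projective dimension and the lower bound for the grade come from the length of the
regular sequence; together they make quasi-deformations perfect. -/
lemma projectiveDimension_ringModule {R : Type u} [CommRing R] {D : FlatSurjDiagram R}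
    {rs : List D.Q} (hrs : RingTheory.Sequence.IsRegular D.Q rs)
    (hker : RingHom.ker (algebraMap D.Q D.R') = Ideal.ofList rs) :
    projectiveDimension D.ringModule = rs.length ∧ rs.length ≤ moduleGrade D.ringModule := by
  let e : (D.Q ⧸ Ideal.ofList rs) ≃ₗ[D.Q] D.R' :=
    (Submodule.quotEquivOfEq _ _ hker.symm).trans D.quotientKerEquiv
  constructor
  · rw [← ModuleCat.projectiveDimension_quotient_eq_length rs hrs]
    exact projectiveDimension_congr (A := D.R') (e.symm.trans (Shrink.linearEquiv D.Q _).symm)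
  · rw [show D.ringModule = ModuleCat.of D.Q D.R' from rfl, ← moduleGrade_congr e,
      natCast_le_moduleGrade_iff]
    have hle : Ideal.ofList rs ≤ maximalIdeal D.Q := le_maximalIdeal fun h' =>
      hrs.top_ne_smul (by rw [h', Submodule.top_smul])
    refine ModuleCat.subsingleton_ext_of_exists_isRegular (Ideal.ofList rs)
      (ModuleCat.of D.Q (D.Q ⧸ Ideal.ofList rs)) ?_ (ModuleCat.of D.Q D.Q) ?_ rs
      (fun r hr => Ideal.subset_span hr) hrs
    · rw [Module.support_eq_zeroLocus]
      exact (congrArg (fun I : Ideal D.Q => PrimeSpectrum.zeroLocus (I : Set D.Q))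
        Ideal.annihilator_quotient).le
    · exact lt_of_le_of_lt (Submodule.smul_mono_left hle) (maximalIdeal_smul_top_lt (N := D.Q))

lemma IsQuasiDeformation.isPerfect {R : Type u} [CommRing R] {D : FlatSurjDiagram R}
    (hD : D.IsQuasiDeformation) : D.IsPerfect projDimension := by
  obtain ⟨rs, hrs, hker⟩ := hD
  obtain ⟨h1, h2⟩ := projectiveDimension_ringModule hrs hker
  intro n hn
  refine (projectiveDimension_le_iff D.ringModule n).1 ?_
  rw [h1]
  have h3 : rs.length ≤ n := by exact_mod_cast h2.trans hn
  exact_mod_cast h3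

section Extension

variable {R S : Type u} [CommRing R] [CommRing S] [Algebra R S]
  (D : FlatSurjDiagram R) (D' : FlatSurjDiagram S) [Algebra D.Q D'.Q]

/-- A diagram `S → S' ← Q'` extends a diagram `R → R' ← Q` if `S'` is the base change of `R'`
along a flat map `Q → Q'` that preserves regular sequences. -/
structure IsExtension : Prop where
  flat : Module.Flat D.Q D'.Q
  ker : RingHom.ker (algebraMap D'.Q D'.R') =
    (RingHom.ker (algebraMap D.Q D.R')).map (algebraMap D.Q D'.Q)
  isRegular_map : ∀ rs : List D.Q, RingTheory.Sequence.IsRegular D.Q rs →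
    RingTheory.Sequence.IsRegular D'.Q (rs.map (algebraMap D.Q D'.Q))

namespace IsExtension

variable {D D'} [Algebra D.R' D'.R'] [Algebra D.Q D'.R'] [Algebra R D'.R']
  [IsScalarTower D.Q D'.Q D'.R'] [IsScalarTower D.Q D.R' D'.R'] [IsScalarTower R S D'.R']
  [IsScalarTower R D.R' D'.R'] (E : D.IsExtension D')

include E

lemma isPushout : Algebra.IsPushout D.Q D'.Q D.R' D'.R' :=
  have := E.flat
  isPushout_of_surjective D.surjective D'.surjective E.ker

lemma le_baseChange [IsLocalRing R] [Module.Flat R S] [Algebra S R] {x : S}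
    (h : IsRetraction R S x) {L : Type u} [AddCommGroup L] [Module R L] (M : Submodule R L)
    [Module.Free R L] [Module.Finite R L] {d : ModuleDimension.{u}} (hD : D.IsPerfect d)
    [Nontrivial (L ⧸ M)] {T : Type u} [AddCommGroup T] [Module S T] (e : T ≃ₗ[S] augComap h M)
    {n : ℕ} (hN : d.LE (Q := D.Q) n (D.baseChange (ModuleCat.of R (L ⧸ M)))) :
    d.LE (Q := D'.Q) n (D'.baseChange (ModuleCat.of S T)) := by
  have := E.flat
  have := E.isPushout
  have h1 : d.LE (Q := D.Q) n (D.R' ⊗[R] (L ⧸ M)) := d.congr (D.baseChangeEquiv _) hN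
  have h2 := le_baseChange_augComap_of_quotient (Q' := D'.Q) (P' := D'.R') h M D.surjective d hD h1
  have h3 : d.LE (Q := D'.Q) n (D'.R' ⊗[S] T) :=
    d.congr ((e.symm.baseChange S D'.R' (augComap h M) T).restrictScalars D'.Q) h2
  exact d.congr (D'.baseChangeEquiv T).symm h3

lemma nonempty_equiv : Nonempty (D'.Q ⊗[D.Q] D.R' ≃ₗ[D'.Q] D'.R') :=
  ⟨E.isPushout.out.equiv⟩

lemma moduleGrade_le : moduleGrade D.ringModule ≤ moduleGrade D'.ringModule := by
  have := E.flat
  obtain ⟨e⟩ := E.nonempty_equiv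
  refine ENat.forall_natCast_le_iff_le.1 fun n hn => ?_
  have : Module.Finite D.Q D.R' := Module.Finite.of_surjective (Algebra.linearMap _ _) D.surjective
  have h1 : ∀ i < n, ExtZero D.Q D.R' D.Q i := natCast_le_moduleGrade_iff.1 hn
  exact natCast_le_moduleGrade_iff (R := D'.Q) (A := D'.R') |>.2 fun i hi =>
    (extZero_congr_left e i).1 (extZero_baseChange_of_flat i _ (h1 i hi))

lemma gDim_le : gDim D'.ringModule ≤ gDim D.ringModule := by
  have := E.flat
  obtain ⟨e⟩ := E.nonempty_equiv
  have := gDim_le_of_forall (R := D'.Q) (S := D.Q) (A := D'.R') (T := D.R') (k := 0) fun n hn =>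
    (flatClass_preservesGProj.hasGRes hn trivial).congr e
  rwa [Nat.cast_zero, add_zero] at this

/-- Flat base change cannot lower the grade or raise the G-dimension, and grade is at most
G-dimension; equality for `D` squeezes all four numbers together. -/
lemma isGQuasiDeformation (hD : D.IsGQuasiDeformation) :
    D'.IsGQuasiDeformation ∧ gDim D'.ringModule = gDim D.ringModule := by
  rw [isGQuasiDeformation_iff] at hD ⊢
  have h1 := E.moduleGrade_le
  have h2 := E.gDim_le
  have h3 := D'.moduleGrade_le_gDim_ringModule
  exact ⟨le_antisymm (h2.trans (hD.le.trans h1)) h3,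
    le_antisymm h2 (hD.le.trans (h1.trans h3))⟩

lemma isQuasiDeformation (hD : D.IsQuasiDeformation) : D'.IsQuasiDeformation ∧
      projectiveDimension D'.ringModule = projectiveDimension D.ringModule := by
  obtain ⟨rs, hrs, hker⟩ := hD
  have hrs' := E.isRegular_map rs hrs
  have hker' := E.ker
  rw [hker, Ideal.map_ofList] at hker'
  refine ⟨⟨_, hrs', hker'⟩, ?_⟩
  rw [(projectiveDimension_ringModule hrs hker).1, (projectiveDimension_ringModule hrs' hker').1,
    List.length_map]

end IsExtension

end Extension

end FlatSurjDiagram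

end BurchExt


namespace BurchExt

/-! ### CI-dimension and CM-dimension -/

section Values

lemma enatToEReal_mono : Monotone enatToEReal := fun a b hab => by
  rw [enatToEReal, enatToEReal, EReal.coe_ennreal_le_coe_ennreal_iff]
  exact_mod_cast hab

lemma enatToEReal_gDim_le {Q Q' : Type u} [CommRing Q] [CommRing Q'] [IsNoetherianRing Q]
    [IsNoetherianRing Q'] {A : ModuleCat.{u} Q} {B : ModuleCat.{u} Q'}
    (h : ∀ n, gDimension.LE (Q := Q) n A → gDimension.LE (Q := Q') n B) :
    enatToEReal (gDim B) ≤ enatToEReal (gDim A) := by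
  have := gDim_le_of_forall (R := Q') (S := Q) (A := B) (T := A) (k := 0) h
  rw [Nat.cast_zero, add_zero] at this
  exact enatToEReal_mono this

/-- Nontriviality of `A` rules out the value `-∞`, which bounds by natural numbers do not detect. -/
lemma pdEReal_le {Q Q' : Type u} [CommRing Q] [CommRing Q'] {A : ModuleCat.{u} Q}
    {B : ModuleCat.{u} Q'} [Nontrivial A]
    (h : ∀ n, projDimension.LE (Q := Q) n A → projDimension.LE (Q := Q') n B) :
    pdEReal B ≤ pdEReal A := by
  have h' : projectiveDimension B ≤ projectiveDimension A := by
    induction hA : projectiveDimension A with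
    | bot =>
      have h1 : HasProjectiveDimensionLT (ModuleCat.of Q A) 0 :=
        (projectiveDimension_lt_iff (X := A) (n := 0)).1 (hA ▸ WithBot.bot_lt_coe _)
      exact (not_subsingleton A (hasProjectiveDimensionLT_zero_iff.1 h1)).elim
    | coe a =>
      induction a with
      | top => exact le_top
      | coe n =>
        exact (projectiveDimension_le_iff B n).2 (h n ((projectiveDimension_le_iff A n).1 hA.le))
  rw [pdEReal, pdEReal]
  generalize projectiveDimension A = a at *
  generalize projectiveDimension B = b at *
  induction b with
  | bot => exact bot_le
  | coe b =>
    induction a with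
    | bot => exact absurd h' (by simp)
    | coe a => exact enatToEReal_mono (WithBot.coe_le_coe.1 h')

end Values

open FlatSurjDiagram

section Infimum

variable {R : Type u} [CommRing R] [IsLocalRing R] [IsNoetherianRing R]
  {L : Type u} [AddCommGroup L] [Module R L] (M : Submodule R L)
  [Module.Free R L] [Module.Finite R L]

variable (D : FlatSurjDiagram R) in
lemma exists_isExtension : ∃ D' : FlatSurjDiagram (ringS R), 
    ∃ (_ : Algebra D.Q D'.Q) (_ : Algebra D.R' D'.R') (_ : Algebra D.Q D'.R') (_ : Algebra R D'.R'),
      IsScalarTower D.Q D'.Q D'.R' ∧ IsScalarTower D.Q D.R' D'.R' ∧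
      IsScalarTower R (ringS R) D'.R' ∧ IsScalarTower R D.R' D'.R' ∧ D.IsExtension D' := by
  let i₁ : Algebra D.Q D.extend.Q := (inferInstance : Algebra D.Q (ringS D.Q))
  let i₂ : Algebra D.R' D.extend.R' := (inferInstance : Algebra D.R' (ringS D.R'))
  let i₃ : Algebra D.Q D.extend.R' := (inferInstance : Algebra D.Q (ringS D.R'))
  let i₄ : Algebra R D.extend.R' := (inferInstance : Algebra R (ringS D.R'))
  refine ⟨D.extend, i₁, i₂, i₃, i₄, ?_, ?_, ?_, ?_, ⟨?_, ?_, ?_⟩⟩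
  · exact .of_algebraMap_eq fun q => (ringSMap_algebraMap (algebraMap D.Q D.R') q).symm
  · exact (inferInstance : IsScalarTower D.Q D.R' (ringS D.R'))
  · exact .of_algebraMap_eq fun q => (ringSMap_algebraMap (algebraMap R D.R') q).symm
  · exact (inferInstance : IsScalarTower R D.R' (ringS D.R'))
  · exact (inferInstance : Module.Flat D.Q (ringS D.Q))
  · exact ker_ringSMap _
  · exact fun rs hrs => (isRetraction D.Q).isRegular_map hrs

variable [Nontrivial (L ⧸ M)] {T : Type u} [AddCommGroup T] [Module (ringS R) T]
  (e : T ≃ₗ[ringS R] augComap (isRetraction R) M)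

include e in
lemma nontrivial_of_equiv_augComap : Nontrivial T :=
  have := nontrivial_augComap (isRetraction R) M
  e.toEquiv.nontrivial

lemma nontrivial_baseChange {A : Type u} [CommRing A] [IsLocalRing A] (D : FlatSurjDiagram A)
    (N : Type u) [AddCommGroup N] [Module A N] [Nontrivial N] :
    Nontrivial (D.baseChange (ModuleCat.of A N)) :=
  have : Module.FaithfullyFlat A D.R' := Module.FaithfullyFlat.of_flat_of_isLocalHom
  Module.FaithfullyFlat.lTensor_nontrivial A D.R' N

-- Restricting a diagram keeps `Q` and `R'`, so the subtracted term is unchanged; extending a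
-- diagram preserves it by `IsExtension.isGQuasiDeformation`. Only the dimension of the base-changed
-- module has to be compared.
include e in
theorem cmDim_eq : cmDim (ModuleCat.of R (L ⧸ M)) = cmDim (ModuleCat.of (ringS R) T) := by
  have := nontrivial_of_equiv_augComap M e
  rw [cmDim, cmDim, if_neg (not_subsingleton _), if_neg (not_subsingleton _)]
  apply le_antisymm
  · refine le_iInf₂ fun D hD => iInf₂_le_of_le (D.restrict R) hD ?_
    exact EReal.sub_le_sub (enatToEReal_gDim_le fun n hn =>
      D.le_restrict_baseChange (isRetraction R) M gDimension hD.isPerfect e hn) le_rfl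
  · refine le_iInf₂ fun D hD => ?_
    obtain ⟨D', _, _, _, _, _, _, _, _, E⟩ := exists_isExtension D
    obtain ⟨h1, h2⟩ := E.isGQuasiDeformation hD
    refine iInf₂_le_of_le D' h1 (EReal.sub_le_sub (enatToEReal_gDim_le fun n hn =>
      E.le_baseChange (isRetraction R) M hD.isPerfect e hn) (enatToEReal_mono h2.ge))

include e in
theorem ciDim_eq : ciDim (ModuleCat.of R (L ⧸ M)) = ciDim (ModuleCat.of (ringS R) T) := by
  have := nontrivial_of_equiv_augComap M e
  rw [ciDim, ciDim, if_neg (not_subsingleton _), if_neg (not_subsingleton _)]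
  apply le_antisymm
  · refine le_iInf₂ fun D hD => iInf₂_le_of_le (D.restrict R) hD ?_
    have := nontrivial_baseChange D T
    exact EReal.sub_le_sub (pdEReal_le fun n hn =>
      D.le_restrict_baseChange (isRetraction R) M projDimension hD.isPerfect e hn) le_rfl
  · refine le_iInf₂ fun D hD => ?_
    obtain ⟨D', _, _, _, _, _, _, _, _, E⟩ := exists_isExtension D
    obtain ⟨h1, h2⟩ := E.isQuasiDeformation hD
    have := nontrivial_baseChange D (L ⧸ M)
    refine iInf₂_le_of_le D' h1 (EReal.sub_le_sub (pdEReal_le fun n hn =>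
      E.le_baseChange (isRetraction R) M hD.isPerfect e hn) ?_)
    rw [pdEReal, pdEReal, h2]

end Infimum

end BurchExt

theorem mainTheorem8 {R : Type u} [CommRing R] [IsLocalRing R] [IsNoetherianRing R]
    {L : Type u} [AddCommGroup L] [Module R L] [Module.Finite R L]
    (M : Submodule R L) (hM : BurchExt.IsBurch M) :
    -- (1)
    ((IsRegularLocalRing R ↔ IsRegularLocalRing (BurchExt.ringS R)) ∧
      (BurchExt.IsCompleteIntersection R ↔ BurchExt.IsCompleteIntersection (BurchExt.ringS R)) ∧
      (BurchExt.IsGorenstein R ↔ BurchExt.IsGorenstein (BurchExt.ringS R)) ∧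
      (BurchExt.IsCohenMacaulay R ↔ BurchExt.IsCohenMacaulay (BurchExt.ringS R))) ∧
    -- (2)
    BurchExt.IsBurch (BurchExt.extSubmodule M) ∧
    -- (3) an isomorphism of `R`-modules
    (∃ e : QuotSMulTop (BurchExt.varS R) (BurchExt.extSubmodule M) ≃+ M × (L ⧸ M),
      ∀ (r : R) (z : QuotSMulTop (BurchExt.varS R) (BurchExt.extSubmodule M)),
        e (algebraMap R (BurchExt.ringS R) r • z) = r • e z) ∧
    -- (4)
    (Module.Free R L →
      (projectiveDimension (ModuleCat.of R (L ⧸ M)) =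
          projectiveDimension (ModuleCat.of (BurchExt.ringS R) (BurchExt.extSubmodule M)) ∧
        BurchExt.ciDim (ModuleCat.of R (L ⧸ M)) =
          BurchExt.ciDim (ModuleCat.of (BurchExt.ringS R) (BurchExt.extSubmodule M)) ∧
        BurchExt.gDim (ModuleCat.of R (L ⧸ M)) =
          BurchExt.gDim (ModuleCat.of (BurchExt.ringS R) (BurchExt.extSubmodule M)) ∧
        BurchExt.cmDim (ModuleCat.of R (L ⧸ M)) =
          BurchExt.cmDim (ModuleCat.of (BurchExt.ringS R) (BurchExt.extSubmodule M))) ∧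
      (BurchExt.complexity (ModuleCat.of R M) =
          BurchExt.complexity (ModuleCat.of (BurchExt.ringS R) (BurchExt.extSubmodule M)) ∧
        BurchExt.curvature (ModuleCat.of R M) =
          BurchExt.curvature
            (ModuleCat.of (BurchExt.ringS R) (BurchExt.extSubmodule M)))) ∧
    -- (5)
    (BurchExt.complexity (ModuleCat.of R (ResidueField R)) =
        BurchExt.complexity
          (ModuleCat.of (BurchExt.ringS R) (ResidueField (BurchExt.ringS R))) ∧
      BurchExt.curvature (ModuleCat.of R (ResidueField R)) =
        BurchExt.curvature
          (ModuleCat.of (BurchExt.ringS R) (ResidueField (BurchExt.ringS R)))) := by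
  have h := BurchExt.isRetraction R
  have e := BurchExt.extSubmoduleEquiv M
  have := hM.nontrivial_quotient
  refine ⟨⟨?_, ?_, ?_, ?_⟩, BurchExt.isBurch_extSubmodule M hM,
    BurchExt.exists_quotSMulTop_equiv h M e, fun hL => ⟨⟨?_, ?_, ?_, ?_⟩, ?_⟩, ?_⟩
  · exact BurchExt.isRegularLocalRing_iff_of_isRetraction h
  · exact BurchExt.isCompleteIntersection_iff_of_isRetraction h
  · exact BurchExt.isGorenstein_iff_of_isRetraction h
  · exact BurchExt.isCohenMacaulay_iff_of_isRetraction h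
  · exact BurchExt.projectiveDimension_augComap h M e
  · exact BurchExt.ciDim_eq M e
  · exact BurchExt.gDim_augComap h M e
  · exact BurchExt.cmDim_eq M e
  · exact BurchExt.complexity_curvature_augComap h M e
  · exact BurchExt.complexity_curvature_residueField h
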